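/- **The one edge observable.** Let $r\ge 3$ be an integer, $q=e^{i\pi/r}$, $[n]_q=\frac{q^n-q^{-n}}{q-q^{-1}}$, $L=\{0,\tfrac12,1,\dots,\tfrac{r-2}{2}\}$, $\dim_q(j)=(-1)^{2j}[2j+1]_q$ for $j\in L$, and $N=\sum_{l\in L}\dim_q(l)^2$. Let $M$ be a triangulated compact 3-manifold, possibly with boundary (a finite simplicial complex in which the link of every vertex is a combinatorial 2-sphere or 2-ball); if $\partial M\neq\emptyset$, fix a labelling $\beta$ of the edges of $\partial M$ by elements of $L$. A state $S$ is a labelling of the edges of the triangulation by elements of $L$ that equals $\beta$ on $\partial M$. It is admissible if on every triangle its labels $a,b,c$ satisfy $a\le b+c$, $b\le a+c$, $c\le a+b$, $a+b+c\in\mathbb Z$ and $a+b+c\le r-2$. The Turaev–Viro state sum is $$Z(M)=N^{-n_{\mathrm{int}}-\frac12 n_{\partial}}\sum_{S\text{ admissible}}\ \prod_{e}A_S(e)\prod_{f}A_S(f)\prod_{t}A_S(t),$$ where $n_{\mathrm{int}}$ and $n_\partial$ are the numbers of vertices in the interior and on the boundary, and $e,f,t$ run over the edges, triangles and tetrahedra.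 Here $A_S(e)=\dim_q(S(e))$; $A_S(f)=1/\theta$, with $\theta$ the Kauffman bracket evaluation of the theta network carrying the labels of the edges of $f$; and $A_S(t)$ is the Kauffman bracket evaluation of the tetrahedral network carrying the labels of the edges of $t$, whose trivalent vertices correspond to the triangles of $t$. For edges and triangles of $\partial M$ the amplitude is replaced by its principal square root. Explicitly, with $[n]_q!=[1]_q\cdots[n]_q$ and doubled labels: for labels $a,b,c$ and $h=\frac{a+b+c}2$, $$\theta=\frac{(-1)^{h}[h+1]_q!\,[h-a]_q!\,[h-b]_q!\,[h-c]_q!}{[a]_q!\,[b]_q!\,[c]_q!},$$ and $$A_S(t)=\frac{\prod_{F,p}[b_p-a_F]_q!}{\prod_{e\subset t}[l_e]_q!}\ \sum_{\max a_F\le s\le \min b_p}\frac{(-1)^s[s+1]_q!}{\prod_F[s-a_F]_q!\,\prod_p[b_p-s]_q!},$$ where $l_e$ is the doubled label of the edge $e$, $F$ runs over the four triangles of $t$, $a_F$ is half the sum of the doubled labels of $F$, $p$ runs over the three pairs of opposite edges of $t$, and $b_p$ is half the sum of the doubled labels of the four other edges. Let $\mathcal O=(e)$, where $e$ is an edge of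 the triangulation with at least one endpoint in the interior of $M$ (any edge, if $M$ is closed). For $j\in L$ let $Z(M,\mathcal O)[j]$ be the same expression as $Z(M)$, with the sum restricted to the admissible states with $S(e)=j$. If $Z(M)\neq 0$, then for every $j\in L$ $$W(M,\mathcal O)[j]:=\frac{Z(M,\mathcal O)[j]}{Z(M)}=\frac{\dim_q(j)^2}{N}.$$ In particular the value depends neither on the manifold, nor on the boundary labels, nor on how the edge sits in the triangulation. -/

import Mathlib

noncomputable section

namespace TuraevViro

/-! ### Combinatorial spheres, balls and 3-manifolds -/

section Complexes

variable {W : Type*} [DecidableEq W]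

/-- The full simplex on the finite vertex set `S`: all nonempty subsets of `S`. -/
def simplex (S : Finset W) : PreAbstractSimplicialComplex W where
  faces := {s | s.Nonempty ∧ s ⊆ S}
  isRelLowerSet_faces := fun _ hs => ⟨hs.1, fun _ hts ht => ⟨ht, hts.trans hs.2⟩⟩

/-- The boundary of the simplex on `S`: all nonempty proper subsets of `S`. -/
def simplexBoundary (S : Finset W) : PreAbstractSimplicialComplex W where
  faces := {s | s.Nonempty ∧ s ⊂ S}
  isRelLowerSet_faces := fun _ hs => ⟨hs.1, fun _ hts ht => ⟨ht, hts.trans_ssubset hs.2⟩⟩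

/-- The link of the vertex `v` in `K`. -/
def link (K : PreAbstractSimplicialComplex W) (v : W) : PreAbstractSimplicialComplex W where
  faces := {s | s.Nonempty ∧ v ∉ s ∧ insert v s ∈ K.faces}
  isRelLowerSet_faces := fun _ hs => ⟨hs.1, fun _ hts ht =>
    ⟨ht, fun hv => hs.2.1 (hts hv),
      (K.isRelLowerSet_faces hs.2.2).2 (Finset.insert_subset_insert v hts)
        (Finset.insert_nonempty _ _)⟩⟩

/-- `K'` is obtained from `K` by starring a face `A` of `K` at a new vertex `a`: the open star of
`A`, that is `A * lk(A)`, is replaced by `a * ∂A * lk(A)`. -/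
def IsStarring (K K' : PreAbstractSimplicialComplex W) : Prop :=
  ∃ A ∈ K.faces, ∃ a : W, {a} ∉ K.faces ∧
    K'.faces = {s | s ∈ K.faces ∧ ¬ A ⊆ s} ∪
      {s | ∃ σ : Finset W, s = insert a σ ∧ ¬ A ⊆ σ ∧ σ ∪ A ∈ K.faces}

/-- Stellar equivalence: the equivalence relation generated by starring. (Starring a face that is
a single vertex renames this vertex, so isomorphisms to fresh vertex names are included.) -/
def StellarEquiv (K K' : PreAbstractSimplicialComplex W) : Prop :=
  Relation.EqvGen IsStarring K K'

/-- Combinatorial `n`-sphere: stellar equivalent to the boundary of an `(n+1)`-simplex. The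
vertices are placed in `W ⊕ ℕ`, so that new vertices are always available. -/
def IsSphere (n : ℕ) (K : PreAbstractSimplicialComplex W) : Prop :=
  StellarEquiv (K.map (Sum.inl : W → W ⊕ ℕ))
    (simplexBoundary ((Finset.range (n + 2)).image (Sum.inr : ℕ → W ⊕ ℕ)))

/-- Combinatorial `n`-ball: stellar equivalent to an `n`-simplex. -/
def IsBall (n : ℕ) (K : PreAbstractSimplicialComplex W) : Prop :=
  StellarEquiv (K.map (Sum.inl : W → W ⊕ ℕ))
    (simplex ((Finset.range (n + 1)).image (Sum.inr : ℕ → W ⊕ ℕ)))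

end Complexes

variable {V : Type*} [Fintype V] [DecidableEq V]

/-- A triangulated compact 3-manifold, possibly with boundary: a finite simplicial complex (with
vertex set `V`) such that the link of every vertex is a 2-sphere or a 2-ball. -/
def IsTriangulated3Manifold (K : AbstractSimplicialComplex V) : Prop :=
  ∀ v : V, IsSphere 2 (link K.toPreAbstractSimplicialComplex v) ∨
    IsBall 2 (link K.toPreAbstractSimplicialComplex v)

open Classical in
/-- The faces of `K` with `n` vertices. -/
def facesOfCard (K : AbstractSimplicialComplex V) (n : ℕ) : Finset (Finset V) :=
  Finset.univ.filter fun s => s ∈ K.faces ∧ s.card = n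

/-- The edges of the triangulation. -/
def edges (K : AbstractSimplicialComplex V) : Finset (Finset V) := facesOfCard K 2

/-- The triangles of the triangulation. -/
def triangles (K : AbstractSimplicialComplex V) : Finset (Finset V) := facesOfCard K 3

/-- The tetrahedra of the triangulation. -/
def tetrahedra (K : AbstractSimplicialComplex V) : Finset (Finset V) := facesOfCard K 4

/-- The triangles of `∂M`: those contained in exactly one tetrahedron. -/
def boundaryTriangles (K : AbstractSimplicialComplex V) : Finset (Finset V) :=
  (triangles K).filter fun f => ((tetrahedra K).filter fun t => f ⊆ t).card = 1

/-- The edges of `∂M`. -/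
def boundaryEdges (K : AbstractSimplicialComplex V) : Finset (Finset V) :=
  (edges K).filter fun e => ∃ f ∈ boundaryTriangles K, e ⊆ f

/-- The vertices of `∂M`. -/
def boundaryVertices (K : AbstractSimplicialComplex V) : Finset V :=
  Finset.univ.filter fun v => ∃ f ∈ boundaryTriangles K, v ∈ f

/-- One edge observables: edges with at least one vertex in the interior of `M`, so that the edge
meets `∂M` at most in its other vertex. -/
def IsOneEdgeObservable (K : AbstractSimplicialComplex V) (e : Finset V) : Prop :=
  e ∈ edges K ∧ ∃ v ∈ e, v ∉ boundaryVertices K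

/-! ### Quantum numbers

The spin `j ∈ {0, 1/2, 1, …, (r-2)/2}` is represented by `n = 2 j ∈ {0, …, r-2}`, an element of
`Fin (r - 1)`. -/

/-- `q = exp (iπ / r)`. -/
def q (r : ℕ) : ℂ := Complex.exp (Complex.I * Real.pi / r)

/-- `[n]_q = (q^n - q^{-n}) / (q - q^{-1})`. -/
def qInt (r n : ℕ) : ℂ := (q r ^ n - (q r)⁻¹ ^ n) / (q r - (q r)⁻¹)

/-- `[n]_q! = [1]_q [2]_q ⋯ [n]_q`. -/
def qFactorial (r n : ℕ) : ℂ := ∏ i ∈ Finset.range n, qInt r (i + 1)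

/-- `dim_q(j) = (-1)^{2j} [2j+1]_q`, with `n = 2j`. -/
def dimq (r n : ℕ) : ℂ := (-1) ^ n * qInt r (n + 1)

/-- `N = ∑_{l ∈ L} dim_q(l)^2`. -/
def N (r : ℕ) : ℂ := ∑ l : Fin (r - 1), dimq r l ^ 2

/-! ### Amplitudes

Throughout, `l e` is the (doubled) spin on the edge `e`; the edges of a simplex `s` are its
two-element subsets. -/

/-- The sum of the doubled spins over all edges of the simplex `s`. -/
def labelSum (l : Finset V → ℕ) (s : Finset V) : ℕ := ∑ e ∈ s.powersetCard 2, l e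

/-- Admissibility of the labels `a, b, c` on the edges of a triangle, in doubled spins: `a+b+c` is
even, `a ≤ b+c`, `b ≤ a+c`, `c ≤ a+b` (that is, `2a, 2b, 2c ≤ a+b+c`) and `a+b+c ≤ 2(r-2)`. -/
def IsAdmissibleTriangle (r : ℕ) (l : Finset V → ℕ) (f : Finset V) : Prop :=
  Even (labelSum l f) ∧ (∀ e ∈ f.powersetCard 2, 2 * l e ≤ labelSum l f) ∧
    labelSum l f ≤ 2 * (r - 2)

/-- The Kauffman bracket evaluation of the theta network labelled by the edges of the triangle `f`:
for labels `a, b, c` and `h = (a+b+c)/2` it is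
`(-1)^h [h+1]! [h-a]! [h-b]! [h-c]! / ([a]! [b]! [c]!)`. -/
def theta (r : ℕ) (l : Finset V → ℕ) (f : Finset V) : ℂ :=
  (-1) ^ (labelSum l f / 2) * qFactorial r (labelSum l f / 2 + 1) *
      (∏ e ∈ f.powersetCard 2, qFactorial r (labelSum l f / 2 - l e)) /
    ∏ e ∈ f.powersetCard 2, qFactorial r (l e)

/-- The three pairs `{e, t \ e}` of opposite edges of a tetrahedron `t`. -/
def oppositePairs (t : Finset V) : Finset (Finset (Finset V)) :=
  (t.powersetCard 2).image fun e => {e, t \ e}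

/-- Half the label sum of the four edges of `t` outside a pair `p` of opposite edges. -/
def quadHalf (l : Finset V → ℕ) (t : Finset V) (p : Finset (Finset V)) : ℕ :=
  (labelSum l t - ∑ e ∈ p, l e) / 2

/-- The Kauffman bracket evaluation of the tetrahedral network whose six lines carry the labels of
the edges of `t` and whose four vertices correspond to the triangles of `t`:
`(∏_{F,p} [b_p - a_F]! / ∏_e [l e]!) ∑_s (-1)^s [s+1]! / (∏_F [s - a_F]! ∏_p [b_p - s]!)`,
where `F` runs over the four triangles, `a_F` is half the label sum of `F`, `p` runs over the three
pairs of opposite edges, `b_p` is half the label sum of the four other edges, and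
`max a_F ≤ s ≤ min b_p`. -/
def tet (r : ℕ) (l : Finset V → ℕ) (t : Finset V) : ℂ :=
  ((∏ F ∈ t.powersetCard 3, ∏ p ∈ oppositePairs t,
        qFactorial r (quadHalf l t p - labelSum l F / 2)) /
      ∏ e ∈ t.powersetCard 2, qFactorial r (l e)) *
    ∑ s ∈ (Finset.range (labelSum l t + 1)).filter (fun s =>
        (∀ F ∈ t.powersetCard 3, labelSum l F / 2 ≤ s) ∧
          ∀ p ∈ oppositePairs t, s ≤ quadHalf l t p),
      (-1) ^ s * qFactorial r (s + 1) /
        ((∏ F ∈ t.powersetCard 3, qFactorial r (s - labelSum l F / 2)) *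
          ∏ p ∈ oppositePairs t, qFactorial r (quadHalf l t p - s))

/-! ### The state sum -/

/-- A labelling of the edges of the triangulation by spins. -/
abbrev Labelling (K : AbstractSimplicialComplex V) (r : ℕ) : Type _ :=
  {e // e ∈ edges K} → Fin (r - 1)

/-- A labelling of the edges of the boundary by spins. -/
abbrev BoundaryLabelling (K : AbstractSimplicialComplex V) (r : ℕ) : Type _ :=
  {e // e ∈ boundaryEdges K} → Fin (r - 1)

/-- The doubled spin on an edge (with value `0` on sets that are not edges, which is never used). -/
def edgeLabel {K : AbstractSimplicialComplex V} {r : ℕ} (S : Labelling K r) (e : Finset V) : ℕ :=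
  if h : e ∈ edges K then (S ⟨e, h⟩ : ℕ) else 0

/-- Admissible states: the labels on every triangle are admissible. -/
def IsAdmissible {K : AbstractSimplicialComplex V} {r : ℕ} (S : Labelling K r) : Prop :=
  ∀ f ∈ triangles K, IsAdmissibleTriangle r (edgeLabel S) f

/-- The labelling `S` restricts to `β` on the boundary. -/
def ExtendsBoundary {K : AbstractSimplicialComplex V} {r : ℕ} (β : BoundaryLabelling K r)
    (S : Labelling K r) : Prop :=
  ∀ (e : Finset V) (he : e ∈ edges K) (hb : e ∈ boundaryEdges K), S ⟨e, he⟩ = β ⟨e, hb⟩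

/-- The product of the amplitudes of a state: `dim_q` for edges, `1/theta` for triangles, the
tetrahedral network for tetrahedra; boundary edges and boundary triangles contribute the square
root of their amplitude. -/
def weight {K : AbstractSimplicialComplex V} {r : ℕ} (S : Labelling K r) : ℂ :=
  (∏ e ∈ edges K, if e ∈ boundaryEdges K then dimq r (edgeLabel S e) ^ (1 / 2 : ℂ)
      else dimq r (edgeLabel S e)) *
    (∏ f ∈ triangles K, if f ∈ boundaryTriangles K then (theta r (edgeLabel S) f)⁻¹ ^ (1 / 2 : ℂ)
      else (theta r (edgeLabel S) f)⁻¹) *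
    ∏ t ∈ tetrahedra K, tet r (edgeLabel S) t

/-- The normalisation: a factor `N⁻¹` for each interior vertex and `N^{-1/2}` for each boundary
vertex; it is `N ^ (-n₀)` if the manifold is closed. -/
def normalisation (K : AbstractSimplicialComplex V) (r : ℕ) : ℂ :=
  ∏ v : V, if v ∈ boundaryVertices K then (N r)⁻¹ ^ (1 / 2 : ℂ) else (N r)⁻¹

open Classical in
/-- The Turaev–Viro state sum `Z(M)` with fixed labelling `β` of the boundary edges (no condition
if the manifold is closed). -/
def Z (K : AbstractSimplicialComplex V) (r : ℕ) (β : BoundaryLabelling K r) : ℂ :=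
  normalisation K r *
    ∑ S ∈ (Finset.univ : Finset (Labelling K r)).filter
      (fun S => IsAdmissible S ∧ ExtendsBoundary β S), weight S

open Classical in
/-- The state sum `Z(M, O)[j]`, where the label of the edge `e` is kept fixed at `j`. -/
def ZFixed (K : AbstractSimplicialComplex V) (r : ℕ) (β : BoundaryLabelling K r)
    (e : {e // e ∈ edges K}) (j : Fin (r - 1)) : ℂ :=
  normalisation K r *
    ∑ S ∈ (Finset.univ : Finset (Labelling K r)).filter
      (fun S => IsAdmissible S ∧ ExtendsBoundary β S ∧ S e = j), weight S

/-- The expectation value `W(M, O)[j] = Z(M, O)[j] / Z(M)`; meaningful only if `Z(M) ≠ 0`. -/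
def W (K : AbstractSimplicialComplex V) (r : ℕ) (β : BoundaryLabelling K r)
    (e : {e // e ∈ edges K}) (j : Fin (r - 1)) : ℂ :=
  ZFixed K r β e j / Z K r β

end TuraevViro

end

noncomputable section

namespace TuraevViro

/-! ### Quantum integers and factorials -/

/-- Quantum integers `[n]_q` for integral `n`. -/
def qZ (r : ℕ) (n : ℤ) : ℂ := (q r ^ n - q r ^ (-n)) / (q r - (q r)⁻¹)

theorem q_ne_zero (r : ℕ) : q r ≠ 0 := Complex.exp_ne_zero _

theorem qZ_natCast (r n : ℕ) : qZ r n = qInt r n := by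
  simp [qZ, qInt]

theorem qZ_neg (r : ℕ) (n : ℤ) : qZ r (-n) = -qZ r n := by
  unfold qZ; rw [neg_neg, ← neg_div, neg_sub]

theorem qZ_zero (r : ℕ) : qZ r 0 = 0 := by simp [qZ]

theorem qZ_mul_sub_mul (r : ℕ) {a b c d : ℤ} (h : a + b = c + d) :
    qZ r a * qZ r b - qZ r c * qZ r d = qZ r (a - d) * qZ r (c - a) := by
  have hq := q_ne_zero r
  obtain rfl : b = c + d - a := by omega
  unfold qZ
  rw [div_mul_div_comm, div_mul_div_comm, div_mul_div_comm, ← sub_div]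
  congr 1
  simp only [zpow_sub₀ hq, zpow_add₀ hq, zpow_neg]
  have ha := zpow_ne_zero a hq
  have hc := zpow_ne_zero c hq
  have hd := zpow_ne_zero d hq
  field_simp
  ring

theorem q_pow (r n : ℕ) : q r ^ n = Complex.exp ((Real.pi * n / r : ℝ) * Complex.I) := by
  rw [q, ← Complex.exp_nat_mul]; congr 1; push_cast; ring

theorem q_pow_sub (r n : ℕ) :
    q r ^ n - (q r)⁻¹ ^ n = 2 * Complex.I * (Real.sin (Real.pi * n / r) : ℝ) := by
  rw [inv_pow, q_pow, ← Complex.exp_neg, ← neg_mul, ← Complex.ofReal_neg, Complex.exp_mul_I,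
    Complex.exp_mul_I, ← Complex.ofReal_cos, ← Complex.ofReal_cos, ← Complex.ofReal_sin,
    ← Complex.ofReal_sin, Real.cos_neg, Real.sin_neg]
  push_cast; ring

theorem qInt_eq_sin (r n : ℕ) :
    qInt r n = ((Real.sin (Real.pi * n / r) / Real.sin (Real.pi / r) : ℝ) : ℂ) := by
  have h1 := q_pow_sub r 1
  rw [pow_one, pow_one, Nat.cast_one, mul_one] at h1
  rw [qInt, q_pow_sub, h1, mul_div_mul_left _ _ (by simp)]
  push_cast; rfl

theorem sin_pi_mul_div_pos {r n : ℕ} (hn : 0 < n) (hr : n < r) :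
    0 < Real.sin (Real.pi * n / r) := by
  have hr0 : (0 : ℝ) < r := by exact_mod_cast hn.trans hr
  apply Real.sin_pos_of_pos_of_lt_pi
  · have : (0 : ℝ) < n := by exact_mod_cast hn
    positivity
  · rw [div_lt_iff₀ hr0]
    have : (n : ℝ) < r := by exact_mod_cast hr
    exact mul_lt_mul_of_pos_left this Real.pi_pos

theorem qInt_ne_zero {r n : ℕ} (hn : 0 < n) (hr : n < r) : qInt r n ≠ 0 := by
  rw [qInt_eq_sin]
  have h1 := sin_pi_mul_div_pos hn hr
  have h2 := sin_pi_mul_div_pos (r := r) (n := 1) one_pos (by omega)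
  rw [Nat.cast_one, mul_one] at h2
  exact_mod_cast (div_pos h1 h2).ne'

theorem qZ_ne_zero {r : ℕ} {n : ℤ} (hn : 0 < n) (hr : n < r) : qZ r n ≠ 0 := by
  lift n to ℕ using hn.le
  rw [qZ_natCast]; exact qInt_ne_zero (by omega) (by omega)

theorem qInt_self (r : ℕ) : qInt r r = 0 := by
  rw [qInt_eq_sin]
  rcases Nat.eq_zero_or_pos r with rfl | h
  · simp
  · rw [mul_div_assoc, div_self (by positivity)]; simp

theorem qInt_one {r : ℕ} (hr : 2 ≤ r) : qInt r 1 = 1 := by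
  rw [qInt_eq_sin, Nat.cast_one, mul_one, div_self, Complex.ofReal_one]
  have := sin_pi_mul_div_pos (r := r) (n := 1) one_pos (by omega)
  rw [Nat.cast_one, mul_one] at this
  exact this.ne'

theorem qFactorial_zero (r : ℕ) : qFactorial r 0 = 1 := by simp [qFactorial]

theorem qFactorial_succ (r n : ℕ) : qFactorial r (n + 1) = qInt r (n + 1) * qFactorial r n := by
  rw [qFactorial, Finset.prod_range_succ, mul_comm]; rfl

theorem qFactorial_ne_zero {r n : ℕ} (h : n < r) : qFactorial r n ≠ 0 :=
  Finset.prod_ne_zero_iff.2 fun i hi =>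
    qInt_ne_zero (Nat.succ_pos i) (by have := Finset.mem_range.1 hi; omega)

theorem qFactorial_eq_zero {r n : ℕ} (hr : 0 < r) (h : r ≤ n) : qFactorial r n = 0 :=
  Finset.prod_eq_zero (i := r - 1) (Finset.mem_range.2 (by omega))
    (by rw [Nat.sub_add_cancel hr, qInt_self])

/-- The inverse `1 / [n]_q!` of the quantum factorial, zero for negative `n`. -/
def invFac (r : ℕ) (n : ℤ) : ℂ := if n < 0 then 0 else (qFactorial r n.toNat)⁻¹

theorem invFac_of_neg (r : ℕ) {n : ℤ} (h : n < 0) : invFac r n = 0 := if_pos h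

theorem invFac_natCast (r n : ℕ) : invFac r n = (qFactorial r n)⁻¹ := by
  simp [invFac]

theorem invFac_pred {r : ℕ} {n : ℤ} (h : n < r) : invFac r (n - 1) = qZ r n * invFac r n := by
  rcases lt_trichotomy n 0 with h0 | rfl | h0
  · rw [invFac_of_neg r h0, invFac_of_neg r (by omega), mul_zero]
  · rw [invFac_of_neg r (by omega), qZ_zero, zero_mul]
  · obtain ⟨m, rfl⟩ : ∃ m : ℕ, n = ((m + 1 : ℕ) : ℤ) := ⟨(n - 1).toNat, by omega⟩
    have h1 : qInt r (m + 1) ≠ 0 := qInt_ne_zero (by omega) (by exact_mod_cast h)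
    rw [qZ_natCast, invFac_natCast, qFactorial_succ, mul_inv, mul_inv_cancel_left₀ h1,
      show ((m + 1 : ℕ) : ℤ) - 1 = m by push_cast; ring, invFac_natCast]

/-! ### The Racah sum and its contiguity relations -/

/-- The summand of the Racah sum. -/
def racahTerm (r : ℕ) (a b c d x y z : ℤ) (s : ℕ) : ℂ :=
  (-1) ^ s * qFactorial r (s + 1) *
    (invFac r (s - a) * invFac r (s - b) * invFac r (s - c) * invFac r (s - d) *
      (invFac r (x - s) * invFac r (y - s) * invFac r (z - s)))

/-- The sum in the Racah formula for the tetrahedral network, as a function of the half sums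
`a, b, c, d` over the triangles and `x, y, z` over the quadrilaterals. -/
def racahSum (r : ℕ) (a b c d x y z : ℤ) : ℂ :=
  ∑ s ∈ Finset.range r, racahTerm r a b c d x y z s

theorem sum_range_telescope_zero {r : ℕ} {f G : ℕ → ℂ} (h : ∀ s < r, f s = G (s + 1) - G s)
    (h0 : G 0 = 0) (hr : G r = 0) : ∑ s ∈ Finset.range r, f s = 0 := by
  rw [Finset.sum_congr rfl fun s hs => h s (Finset.mem_range.1 hs), Finset.sum_range_sub, h0, hr,
    sub_zero]

theorem sum_range_shift {r : ℕ} {f : ℕ → ℂ} (h0 : f 0 = 0) (hr : f r = 0) :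
    ∑ s ∈ Finset.range r, f s = ∑ s ∈ Finset.range r, f (s + 1) := by
  have h1 := Finset.sum_range_succ f r
  rw [Finset.sum_range_succ', h0, hr, add_zero, add_zero] at h1
  exact h1.symm

theorem racahSum_contiguous_add_add {r : ℕ} (hr : 0 < r) {d a b c x y z : ℤ}
    (hsum : d + a + b + c = x + y + z) (hd : 0 ≤ d) (ha : 0 ≤ a) (hb : 0 ≤ b) (hc : 0 ≤ c)
    (hx : x - a + 1 < r) (hy : y - a < r) (hz : z - a < r) :
    qZ r (z - d + 1) * qZ r (y - d + 1) *
        racahSum r (a + 1) (b + 1) (c + 1) d (x + 1) (y + 1) (z + 1) -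
      qZ r (x - b + 1) * qZ r (x - a + 1) * racahSum r a b (c + 1) d (x + 1) y z =
    -(qZ r (a + b - x + 1) * qZ r (c + 2) * racahSum r a b c d x y z) := by
  have hshift : racahSum r (a + 1) (b + 1) (c + 1) d (x + 1) (y + 1) (z + 1) =
      ∑ s ∈ Finset.range r,
        racahTerm r (a + 1) (b + 1) (c + 1) d (x + 1) (y + 1) (z + 1) (s + 1) := by
    apply sum_range_shift
    · rw [racahTerm, invFac_of_neg r (show ((0 : ℕ) : ℤ) - (a + 1) < 0 by push_cast; omega)]; simp
    · rw [racahTerm, qFactorial_eq_zero hr (by omega)]; simp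
  rw [hshift, eq_neg_iff_add_eq_zero]
  simp only [racahSum]
  rw [Finset.mul_sum, Finset.mul_sum, Finset.mul_sum, ← Finset.sum_sub_distrib,
    ← Finset.sum_add_distrib]
  apply sum_range_telescope_zero (G := fun s : ℕ => (-1) ^ s * qFactorial r (s + 1) *
    (invFac r (s - a - 1) * invFac r (s - b - 1) * invFac r (s - c - 1) * invFac r (s - d) *
      (invFac r (x + 1 - s) * invFac r (y - s) * invFac r (z - s))))
  · intro s hs
    by_cases has : (s : ℤ) < a
    · simp only [racahTerm]
      rw [invFac_of_neg r (show (s : ℤ) - a < 0 by omega),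
        invFac_of_neg r (show (s : ℤ) - a - 1 < 0 by omega),
        invFac_of_neg r (show ((s + 1 : ℕ) : ℤ) - (a + 1) < 0 by push_cast; omega),
        invFac_of_neg r (show ((s + 1 : ℕ) : ℤ) - a - 1 < 0 by push_cast; omega)]
      ring
    by_cases hs1 : s + 1 = r
    · simp only [racahTerm]
      rw [qFactorial_eq_zero (n := s + 1) hr (by omega),
        qFactorial_eq_zero (n := s + 1 + 1) hr (by omega)]
      ring
    have e1 := invFac_pred (r := r) (n := s - a) (by omega)
    have e2 := invFac_pred (r := r) (n := s - b) (by omega)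
    have e3 := invFac_pred (r := r) (n := s - c) (by omega)
    have e4 := invFac_pred (r := r) (n := s + 1 - d) (by omega)
    have e5 := invFac_pred (r := r) (n := x + 1 - s) (by omega)
    have e6 := invFac_pred (r := r) (n := y - s) (by omega)
    have e7 := invFac_pred (r := r) (n := z - s) (by omega)
    have e8 := qFactorial_succ r (s + 1)
    rw [← qZ_natCast, show ((s + 1 + 1 : ℕ) : ℤ) = s + 2 by push_cast; ring] at e8
    have E1 : qZ r (z - d + 1) * qZ r (y - d + 1) - qZ r (y - s) * qZ r (z - s) =
        qZ r (y + z - s - d + 1) * qZ r (s + 1 - d) := by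
      have := qZ_mul_sub_mul r (show (z - d + 1) + (y - d + 1) =
        (y + z - s - d + 1) + (s + 1 - d) by ring)
      rw [show z - d + 1 - (s + 1 - d) = z - s by ring,
        show y + z - s - d + 1 - (z - d + 1) = y - s by ring] at this
      linear_combination this
    have E2 : qZ r (x - b + 1) * qZ r (x - a + 1) - qZ r (s - a) * qZ r (s - b) =
        qZ r (x + 1 - s) * qZ r (s - a - b + x + 1) := by
      have := qZ_mul_sub_mul r (show (x - b + 1) + (x - a + 1) =
        (x + 1 - s) + (s - a - b + x + 1) by ring)
      rw [show x - b + 1 - (s - a - b + x + 1) = -(s - a) by ring,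
        show x + 1 - s - (x - b + 1) = -(s - b) by ring, qZ_neg, qZ_neg] at this
      linear_combination this
    have E3 : qZ r (s + 2) * qZ r (y + z - s - d + 1) + qZ r (s - c) * qZ r (s - a - b + x + 1) =
        qZ r (a + b - x + 1) * qZ r (c + 2) := by
      have := qZ_mul_sub_mul r (show ((s : ℤ) + 2) + (y + z - s - d + 1) =
        (a + b - x + 1) + (c + 2) by omega)
      rw [show (s : ℤ) + 2 - (c + 2) = s - c by ring,
        show a + b - x + 1 - ((s : ℤ) + 2) = -(s - a - b + x + 1) by ring, qZ_neg] at this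
      linear_combination this
    simp only [racahTerm]
    push_cast
    rw [show (s : ℤ) + 1 - (a + 1) = s - a by ring, show (s : ℤ) + 1 - (b + 1) = s - b by ring,
      show (s : ℤ) + 1 - (c + 1) = s - c by ring, show (s : ℤ) - (c + 1) = s - c - 1 by ring,
      show x + 1 - ((s : ℤ) + 1) = x + 1 - s - 1 by ring,
      show y + 1 - ((s : ℤ) + 1) = y - s by ring,
      show z + 1 - ((s : ℤ) + 1) = z - s by ring,
      show (s : ℤ) - d = s + 1 - d - 1 by ring,
      show x - (s : ℤ) = x + 1 - s - 1 by ring,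
      show (s : ℤ) + 1 - a - 1 = s - a by ring, show (s : ℤ) + 1 - b - 1 = s - b by ring,
      show (s : ℤ) + 1 - c - 1 = s - c by ring,
      show y - ((s : ℤ) + 1) = y - s - 1 by ring,
      show z - ((s : ℤ) + 1) = z - s - 1 by ring,
      e1, e2, e3, e4, e5, e6, e7, e8, pow_succ]
    linear_combination (-(-1) ^ s * qFactorial r (s + 1) * (invFac r (s - a) * invFac r (s - b) *
      invFac r (s - c) * invFac r (s + 1 - d) * (invFac r (x + 1 - s) * invFac r (y - s) *
      invFac r (z - s)))) * (qZ r (s + 2) * qZ r (x + 1 - s) * E1 +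
        qZ r (s - c) * qZ r (s + 1 - d) * E2 + qZ r (s + 1 - d) * qZ r (x + 1 - s) * E3)
  · rw [invFac_of_neg r (show ((0 : ℕ) : ℤ) - a - 1 < 0 by push_cast; omega)]; simp
  · rw [qFactorial_eq_zero hr (by omega)]; simp

theorem racahSum_contiguous_add_sub {r : ℕ} (hr : 0 < r) {d a b c x y z : ℤ}
    (hsum : d + a + b + c = x + y + z) (hd : 0 ≤ d) (ha : 0 ≤ a) (hb : 0 ≤ b) (hc : 0 ≤ c)
    (hx : x - a < r) (hy : y - a < r) (hz : z - a + 1 < r) :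
    qZ r (z - d + 1) * qZ r (z - c + 1) * racahSum r (a + 1) b c d x y (z + 1) +
      qZ r (x - b + 1) * qZ r (b + 1) * racahSum r a (b - 1) c d x (y - 1) z =
    qZ r (a + b - x + 1) * qZ r (y - a) * racahSum r a b c d x y z := by
  rw [← sub_eq_zero]
  simp only [racahSum]
  rw [Finset.mul_sum, Finset.mul_sum, Finset.mul_sum, ← Finset.sum_add_distrib,
    ← Finset.sum_sub_distrib]
  apply sum_range_telescope_zero (G := fun s : ℕ => -((-1) ^ s * qFactorial r (s + 1) *
    (invFac r (s - a - 1) * invFac r (s - b) * invFac r (s - c - 1) * invFac r (s - d - 1) *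
      (invFac r (x - s) * invFac r (y - s) * invFac r (z + 1 - s)))))
  · intro s hs
    by_cases has : (s : ℤ) < a
    · simp only [racahTerm]
      rw [invFac_of_neg r (show (s : ℤ) - a < 0 by omega),
        invFac_of_neg r (show (s : ℤ) - a - 1 < 0 by omega),
        invFac_of_neg r (show (s : ℤ) - (a + 1) < 0 by omega),
        invFac_of_neg r (show ((s + 1 : ℕ) : ℤ) - a - 1 < 0 by push_cast; omega)]
      ring
    by_cases hs1 : s + 1 = r
    · simp only [racahTerm]
      rw [qFactorial_eq_zero (n := s + 1) hr (by omega),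
        qFactorial_eq_zero (n := s + 1 + 1) hr (by omega)]
      ring
    have e1 := invFac_pred (r := r) (n := s - a) (by omega)
    have e2 := invFac_pred (r := r) (n := s + 1 - b) (by omega)
    have e3 := invFac_pred (r := r) (n := s - c) (by omega)
    have e4 := invFac_pred (r := r) (n := s - d) (by omega)
    have e5 := invFac_pred (r := r) (n := x - s) (by omega)
    have e6 := invFac_pred (r := r) (n := y - s) (by omega)
    have e7 := invFac_pred (r := r) (n := z + 1 - s) (by omega)
    have e8 := qFactorial_succ r (s + 1)
    rw [← qZ_natCast, show ((s + 1 + 1 : ℕ) : ℤ) = s + 2 by push_cast; ring] at e8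
    have E1 : qZ r (z - d + 1) * qZ r (z - c + 1) - qZ r (s - d) * qZ r (s - c) =
        qZ r (z + 1 - s) * qZ r (s - c - d + z + 1) := by
      have := qZ_mul_sub_mul r (show (z - d + 1) + (z - c + 1) =
        (z + 1 - s) + (s - c - d + z + 1) by ring)
      rw [show z - d + 1 - (s - c - d + z + 1) = -(s - c) by ring,
        show z + 1 - s - (z - d + 1) = -(s - d) by ring, qZ_neg, qZ_neg] at this
      linear_combination this
    have E2 : qZ r (x - b + 1) * qZ r (b + 1) - qZ r (s + 2) * qZ r (x - s) =
        qZ r (s + 1 - b) * qZ r (s + 1 + b - x) := by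
      have := qZ_mul_sub_mul r (show (b + 1) + (x - b + 1) = ((s : ℤ) + 2) + (x - s) by ring)
      rw [show b + 1 - (x - (s : ℤ)) = s + 1 + b - x by ring,
        show (s : ℤ) + 2 - (b + 1) = s + 1 - b by ring] at this
      linear_combination this
    have E3 : qZ r (s - a) * qZ r (s - c - d + z + 1) + qZ r (y - s) * qZ r (s + 1 + b - x) =
        qZ r (a + b - x + 1) * qZ r (y - a) := by
      have := qZ_mul_sub_mul r (show (a + b - x + 1) + (y - a) =
        (y - s) + (s + 1 + b - x) by omega)
      rw [show a + b - x + 1 - (s + 1 + b - x) = -(s - a) by ring,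
        show y - s - (a + b - x + 1) = -(s - c - d + z + 1) by omega, qZ_neg, qZ_neg] at this
      linear_combination -this
    simp only [racahTerm]
    push_cast
    rw [show (s : ℤ) - (a + 1) = s - a - 1 by ring, show (s : ℤ) - (b - 1) = s + 1 - b by ring,
      show y - 1 - (s : ℤ) = y - s - 1 by ring,
      show (s : ℤ) - b = s + 1 - b - 1 by ring,
      show z - (s : ℤ) = z + 1 - s - 1 by ring,
      show (s : ℤ) + 1 - a - 1 = s - a by ring, show (s : ℤ) + 1 - d - 1 = s - d by ring,
      show (s : ℤ) + 1 - c - 1 = s - c by ring,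
      show x - ((s : ℤ) + 1) = x - s - 1 by ring,
      show y - ((s : ℤ) + 1) = y - s - 1 by ring,
      show z + 1 - ((s : ℤ) + 1) = z + 1 - s - 1 by ring,
      e1, e2, e3, e4, e5, e6, e7, e8, pow_succ]
    linear_combination ((-1) ^ s * qFactorial r (s + 1) * (invFac r (s - a) *
      invFac r (s + 1 - b) * invFac r (s - c) * invFac r (s - d) * (invFac r (x - s) *
      invFac r (y - s) * invFac r (z + 1 - s)))) * (qZ r (s - a) * qZ r (s + 1 - b) * E1 +
        qZ r (y - s) * qZ r (z + 1 - s) * E2 + qZ r (s + 1 - b) * qZ r (z + 1 - s) * E3)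
  · rw [invFac_of_neg r (show ((0 : ℕ) : ℤ) - a - 1 < 0 by push_cast; omega)]; simp
  · rw [qFactorial_eq_zero hr (by omega)]; simp

theorem racahSum_contiguous_sub_sub {r : ℕ} (hr : 0 < r) {d a b c x y z : ℤ}
    (hsum : d + a + b + c = x + y + z) (hd : 0 ≤ d) (ha : 0 ≤ a) (hb : 0 ≤ b) (hc : 1 ≤ c)
    (hx : x - a < r) (hy : y - a < r) (hz : z - a < r) :
    qZ r (y - c + 1) * qZ r (z - c + 1) * racahSum r a b (c - 1) d (x - 1) y z -
      qZ r (a + 1) * qZ r (b + 1) *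
        racahSum r (a - 1) (b - 1) (c - 1) d (x - 1) (y - 1) (z - 1) =
    qZ r (a + b - x + 1) * qZ r (x - d) * racahSum r a b c d x y z := by
  have hshift : racahSum r (a - 1) (b - 1) (c - 1) d (x - 1) (y - 1) (z - 1) =
      ∑ s ∈ Finset.range r, -((-1) ^ s * qFactorial r s *
        (invFac r (s - a) * invFac r (s - b) * invFac r (s - c) * invFac r (s - d - 1) *
          (invFac r (x - s) * invFac r (y - s) * invFac r (z - s)))) := by
    symm
    rw [sum_range_shift]
    · refine Finset.sum_congr rfl fun s _ => ?_
      rw [racahTerm]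
      push_cast
      rw [show (s : ℤ) - (a - 1) = s + 1 - a by ring, show (s : ℤ) - (b - 1) = s + 1 - b by ring,
        show (s : ℤ) - (c - 1) = s + 1 - c by ring, show (s : ℤ) - d = s + 1 - d - 1 by ring,
        show x - 1 - (s : ℤ) = x - (s + 1) by ring, show y - 1 - (s : ℤ) = y - (s + 1) by ring,
        show z - 1 - (s : ℤ) = z - (s + 1) by ring]
      ring
    · rw [invFac_of_neg r (show ((0 : ℕ) : ℤ) - d - 1 < 0 by push_cast; omega)]; simp
    · rw [qFactorial_eq_zero hr le_rfl]; simp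
  rw [hshift, ← sub_eq_zero]
  simp only [racahSum]
  rw [Finset.mul_sum, Finset.mul_sum, Finset.mul_sum, ← Finset.sum_sub_distrib,
    ← Finset.sum_sub_distrib]
  apply sum_range_telescope_zero (G := fun s : ℕ => -((-1) ^ s * qFactorial r s *
    (invFac r (s - a - 1) * invFac r (s - b - 1) * invFac r (s - c) * invFac r (s - d - 1) *
      (invFac r (x - s) * invFac r (y - s) * invFac r (z - s)))))
  · intro s hs
    by_cases has : (s : ℤ) < a
    · simp only [racahTerm]
      rw [invFac_of_neg r (show (s : ℤ) - a < 0 by omega),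
        invFac_of_neg r (show (s : ℤ) - a - 1 < 0 by omega),
        invFac_of_neg r (show ((s + 1 : ℕ) : ℤ) - a - 1 < 0 by push_cast; omega)]
      ring
    have e1 := invFac_pred (r := r) (n := s - a) (by omega)
    have e2 := invFac_pred (r := r) (n := s - b) (by omega)
    have e3 := invFac_pred (r := r) (n := s + 1 - c) (by omega)
    have e4 := invFac_pred (r := r) (n := s - d) (by omega)
    have e5 := invFac_pred (r := r) (n := x - s) (by omega)
    have e6 := invFac_pred (r := r) (n := y - s) (by omega)
    have e7 := invFac_pred (r := r) (n := z - s) (by omega)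
    have e8 := qFactorial_succ r s
    rw [← qZ_natCast, show ((s + 1 : ℕ) : ℤ) = s + 1 by push_cast; ring] at e8
    have E1 : qZ r (y - c + 1) * qZ r (z - c + 1) - qZ r (y - s) * qZ r (z - s) =
        qZ r (s + 1 - c) * qZ r (y + z - s - c + 1) := by
      have := qZ_mul_sub_mul r (show (z - c + 1) + (y - c + 1) =
        (y + z - s - c + 1) + (s + 1 - c) by ring)
      rw [show z - c + 1 - (s + 1 - c) = z - s by ring,
        show y + z - s - c + 1 - (z - c + 1) = y - s by ring] at this
      linear_combination this
    have E2 : qZ r (a + 1) * qZ r (b + 1) - qZ r (s - a) * qZ r (s - b) =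
        qZ r (s + 1) * qZ r (a + b + 1 - s) := by
      have := qZ_mul_sub_mul r (show (a + 1) + (b + 1) = ((s : ℤ) + 1) + (a + b + 1 - s) by ring)
      rw [show a + 1 - (a + b + 1 - (s : ℤ)) = s - b by ring,
        show (s : ℤ) + 1 - (a + 1) = s - a by ring] at this
      linear_combination this
    have E3 : qZ r (x - s) * qZ r (y + z - s - c + 1) + qZ r (s - d) * qZ r (a + b + 1 - s) =
        qZ r (a + b - x + 1) * qZ r (x - d) := by
      have := qZ_mul_sub_mul r (show (a + b - x + 1) + (x - d) =
        (s - d) + (a + b + 1 - s) by ring)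
      rw [show a + b - x + 1 - (a + b + 1 - s) = -(x - s) by ring,
        show s - d - (a + b - x + 1) = -(y + z - s - c + 1) by omega, qZ_neg, qZ_neg] at this
      linear_combination -this
    simp only [racahTerm]
    push_cast
    rw [show (s : ℤ) - (c - 1) = s + 1 - c by ring,
      show x - 1 - (s : ℤ) = x - s - 1 by ring,
      show (s : ℤ) - c = s + 1 - c - 1 by ring,
      show (s : ℤ) + 1 - a - 1 = s - a by ring, show (s : ℤ) + 1 - b - 1 = s - b by ring,
      show (s : ℤ) + 1 - d - 1 = s - d by ring,
      show x - ((s : ℤ) + 1) = x - s - 1 by ring,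
      show y - ((s : ℤ) + 1) = y - s - 1 by ring,
      show z - ((s : ℤ) + 1) = z - s - 1 by ring,
      e1, e2, e3, e4, e5, e6, e7, e8, pow_succ]
    linear_combination ((-1) ^ s * qFactorial r s * (invFac r (s - a) * invFac r (s - b) *
      invFac r (s + 1 - c) * invFac r (s - d) * (invFac r (x - s) * invFac r (y - s) *
      invFac r (z - s)))) * (qZ r (s + 1) * qZ r (x - s) * E1 +
        qZ r (s + 1 - c) * qZ r (s - d) * E2 + qZ r (s + 1) * qZ r (s + 1 - c) * E3)
  · rw [invFac_of_neg r (show ((0 : ℕ) : ℤ) - a - 1 < 0 by push_cast; omega)]; simp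
  · rw [qFactorial_eq_zero hr le_rfl]; simp

theorem racahSum_eq_zero {r : ℕ} {a b c d x y z : ℤ}
    (h : ∀ s : ℕ, s < r → (s < a ∨ s < b ∨ s < c ∨ s < d ∨ x < s ∨ y < s ∨ z < s ∨ r ≤ s + 1)) :
    racahSum r a b c d x y z = 0 := by
  refine Finset.sum_eq_zero fun s hs => ?_
  have hs := Finset.mem_range.1 hs
  rw [racahTerm]
  rcases h s hs with h | h | h | h | h | h | h | h
  · rw [invFac_of_neg r (n := s - a) (by omega)]; ring
  · rw [invFac_of_neg r (n := s - b) (by omega)]; ring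
  · rw [invFac_of_neg r (n := s - c) (by omega)]; ring
  · rw [invFac_of_neg r (n := s - d) (by omega)]; ring
  · rw [invFac_of_neg r (n := x - s) (by omega)]; ring
  · rw [invFac_of_neg r (n := y - s) (by omega)]; ring
  · rw [invFac_of_neg r (n := z - s) (by omega)]; ring
  · rw [qFactorial_eq_zero (by omega) h]; ring

theorem racahSum_eq_single {r s : ℕ} {a b c d x y z : ℤ} {a' b' c' d' x' y' z' : ℕ} (hs : s < r)
    (ha : s - a = a') (hb : s - b = b') (hc : s - c = c') (hd : s - d = d')
    (hx : x - s = x') (hy : y - s = y') (hz : z - s = z')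
    (h : (a' = 0 ∨ b' = 0 ∨ c' = 0 ∨ d' = 0) ∧ (x' = 0 ∨ y' = 0 ∨ z' = 0)) :
    racahSum r a b c d x y z = (-1) ^ s * qFactorial r (s + 1) *
      ((qFactorial r a')⁻¹ * (qFactorial r b')⁻¹ * (qFactorial r c')⁻¹ * (qFactorial r d')⁻¹ *
        ((qFactorial r x')⁻¹ * (qFactorial r y')⁻¹ * (qFactorial r z')⁻¹)) := by
  rw [racahSum, Finset.sum_eq_single s]
  · rw [racahTerm, ha, hb, hc, hd, hx, hy, hz]; simp only [invFac_natCast]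
  · intro t ht hts
    have ht := Finset.mem_range.1 ht
    rw [racahTerm]
    rcases lt_or_gt_of_ne hts with hlt | hlt
    · rcases h.1 with h | h | h | h
      · rw [invFac_of_neg r (n := t - a) (by omega)]; ring
      · rw [invFac_of_neg r (n := t - b) (by omega)]; ring
      · rw [invFac_of_neg r (n := t - c) (by omega)]; ring
      · rw [invFac_of_neg r (n := t - d) (by omega)]; ring
    · rcases h.2 with h | h | h
      · rw [invFac_of_neg r (n := x - t) (by omega)]; ring
      · rw [invFac_of_neg r (n := y - t) (by omega)]; ring
      · rw [invFac_of_neg r (n := z - t) (by omega)]; ring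
  · intro h; exact absurd (Finset.mem_range.2 hs) h

/-! ### Labels -/

/-- Admissibility of three doubled spins. -/
def Adm (r a b c : ℕ) : Prop :=
  Even (a + b + c) ∧ a ≤ b + c ∧ b ≤ a + c ∧ c ≤ a + b ∧ a + b + c ≤ 2 * (r - 2)

instance (r a b c : ℕ) : Decidable (Adm r a b c) := by unfold Adm; infer_instance

theorem Adm.exists_split {r a b c : ℕ} (hr : 2 ≤ r) (h : Adm r a b c) :
    ∃ i j k : ℕ, a = i + j ∧ b = i + k ∧ c = j + k ∧ i + j + k + 2 ≤ r := by
  obtain ⟨⟨m, hm⟩, h1, h2, h3, h4⟩ := h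
  exact ⟨m - c, m - b, m - a, by omega, by omega, by omega, by omega⟩

theorem adm_split {r i j k : ℕ} (h : i + j + k + 2 ≤ r) : Adm r (i + j) (i + k) (j + k) :=
  ⟨⟨i + j + k, by ring⟩, by omega, by omega, by omega, by omega⟩

theorem adm_of {r a b c : ℕ} (i j k : ℕ) (ha : a = i + j) (hb : b = i + k) (hc : c = j + k)
    (h : i + j + k + 2 ≤ r) : Adm r a b c := by
  subst ha hb hc; exact adm_split h

theorem adm_comm₁₂ {r a b c : ℕ} : Adm r a b c ↔ Adm r b a c := by
  unfold Adm; rw [add_comm a b]; tauto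

theorem adm_comm₂₃ {r a b c : ℕ} : Adm r a b c ↔ Adm r a c b := by
  unfold Adm; rw [add_right_comm a b c, add_comm b c]; tauto

/-- The theta network divided out by the factorials of its triangles and edges, inverted:
`(-1)^h [h-a]! [h-b]! [h-c]! / [h+1]!`, and zero for inadmissible labels. -/
def triad (r a b c : ℕ) : ℂ :=
  if Adm r a b c then
    (-1) ^ ((a + b + c) / 2) * (qFactorial r ((a + b + c) / 2 - a) *
      qFactorial r ((a + b + c) / 2 - b) * qFactorial r ((a + b + c) / 2 - c)) /
        qFactorial r ((a + b + c) / 2 + 1)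
  else 0

/-- The Racah sum of the tetrahedron with labels `A, B, C` on the edges at a vertex and
`X, Y, Z` on the respective opposite edges; zero for inadmissible labels. -/
def racah (r A B C X Y Z : ℕ) : ℂ :=
  if Adm r A B Z ∧ Adm r A C Y ∧ Adm r B C X ∧ Adm r X Y Z then
    racahSum r ((A + B + Z : ℤ) / 2) ((A + C + Y : ℤ) / 2) ((B + C + X : ℤ) / 2)
      ((X + Y + Z : ℤ) / 2) ((B + C + Y + Z : ℤ) / 2) ((A + C + X + Z : ℤ) / 2)
      ((A + B + X + Y : ℤ) / 2)
  else 0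

theorem triad_of_not_adm {r a b c : ℕ} (h : ¬Adm r a b c) : triad r a b c = 0 := if_neg h

theorem triad_split {r i j k : ℕ} (h : i + j + k + 2 ≤ r) :
    triad r (i + j) (i + k) (j + k) = (-1) ^ (i + j + k) *
      (qFactorial r i * qFactorial r j * qFactorial r k) / qFactorial r (i + j + k + 1) := by
  rw [triad, if_pos (adm_split h)]
  have e : (i + j + (i + k) + (j + k)) / 2 = i + j + k := by omega
  rw [e, show i + j + k - (i + j) = k by omega, show i + j + k - (i + k) = j by omega,
    show i + j + k - (j + k) = i by omega]
  ring

theorem triad_of {r a b c : ℕ} (i j k : ℕ) (ha : a = i + j) (hb : b = i + k) (hc : c = j + k)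
    (h : i + j + k + 2 ≤ r) : triad r a b c = (-1) ^ (i + j + k) *
      (qFactorial r i * qFactorial r j * qFactorial r k) / qFactorial r (i + j + k + 1) := by
  subst ha hb hc; exact triad_split h

theorem triad_comm₁₂ (r a b c : ℕ) : triad r a b c = triad r b a c := by
  unfold triad
  rw [add_comm a b, mul_comm (qFactorial r ((b + a + c) / 2 - a))]
  simp only [adm_comm₁₂ (a := a)]

theorem triad_comm₂₃ (r a b c : ℕ) : triad r a b c = triad r a c b := by
  unfold triad
  rw [add_right_comm a b c, mul_right_comm (qFactorial r ((a + c + b) / 2 - a))]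
  simp only [adm_comm₂₃ (b := b)]

theorem racah_eq {r A B C X Y Z : ℕ} {a b c d x y z : ℤ} (h1 : Adm r A B Z) (h2 : Adm r A C Y)
    (h3 : Adm r B C X) (h4 : Adm r X Y Z) (ha : (A + B + Z : ℤ) = 2 * a)
    (hb : (A + C + Y : ℤ) = 2 * b) (hc : (B + C + X : ℤ) = 2 * c) (hd : (X + Y + Z : ℤ) = 2 * d)
    (hx : (B + C + Y + Z : ℤ) = 2 * x) (hy : (A + C + X + Z : ℤ) = 2 * y)
    (hz : (A + B + X + Y : ℤ) = 2 * z) :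
    racah r A B C X Y Z = racahSum r a b c d x y z := by
  rw [racah, if_pos ⟨h1, h2, h3, h4⟩, ha, hb, hc, hd, hx, hy, hz]
  simp only [ne_eq, OfNat.ofNat_ne_zero, not_false_eq_true, Int.mul_ediv_cancel_left]

theorem racah_of_not {r A B C X Y Z : ℕ}
    (h : ¬(Adm r A B Z ∧ Adm r A C Y ∧ Adm r B C X ∧ Adm r X Y Z)) :
    racah r A B C X Y Z = 0 := if_neg h

theorem racah_swap₁₂ (r A B C X Y Z : ℕ) : racah r A B C X Y Z = racah r B A C Y X Z := by
  by_cases h : Adm r A B Z ∧ Adm r A C Y ∧ Adm r B C X ∧ Adm r X Y Z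
  · have h' : Adm r B A Z ∧ Adm r B C X ∧ Adm r A C Y ∧ Adm r Y X Z :=
      ⟨adm_comm₁₂.1 h.1, h.2.2.1, h.2.1, adm_comm₁₂.1 h.2.2.2⟩
    rw [racah, racah, if_pos h, if_pos h']
    simp only [racahSum]
    refine Finset.sum_congr rfl fun s _ => ?_
    simp only [racahTerm]
    rw [show (B + A + Z : ℤ) = A + B + Z by ring, show (Y + X + Z : ℤ) = X + Y + Z by ring,
      show (B + A + Y + X : ℤ) = A + B + X + Y by ring]
    ring
  · rw [racah_of_not h, racah_of_not]
    contrapose h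
    exact ⟨adm_comm₁₂.1 h.1, h.2.2.1, h.2.1, adm_comm₁₂.1 h.2.2.2⟩

theorem racah_swap₂₃ (r A B C X Y Z : ℕ) : racah r A B C X Y Z = racah r A C B X Z Y := by
  by_cases h : Adm r A B Z ∧ Adm r A C Y ∧ Adm r B C X ∧ Adm r X Y Z
  · have h' : Adm r A C Y ∧ Adm r A B Z ∧ Adm r C B X ∧ Adm r X Z Y :=
      ⟨h.2.1, h.1, adm_comm₁₂.1 h.2.2.1, adm_comm₂₃.1 h.2.2.2⟩
    rw [racah, racah, if_pos h, if_pos h']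
    simp only [racahSum]
    refine Finset.sum_congr rfl fun s _ => ?_
    simp only [racahTerm]
    rw [show (C + B + X : ℤ) = B + C + X by ring, show (X + Z + Y : ℤ) = X + Y + Z by ring,
      show (C + B + Z + Y : ℤ) = B + C + Y + Z by ring]
    ring
  · rw [racah_of_not h, racah_of_not]
    contrapose h
    exact ⟨h.2.1, h.1, adm_comm₁₂.1 h.2.2.1, adm_comm₂₃.1 h.2.2.2⟩

theorem racah_swap₀₁ (r A B C X Y Z : ℕ) : racah r A B C X Y Z = racah r A Z Y X C B := by
  by_cases h : Adm r A B Z ∧ Adm r A C Y ∧ Adm r B C X ∧ Adm r X Y Z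
  · have h' : Adm r A Z B ∧ Adm r A Y C ∧ Adm r Z Y X ∧ Adm r X C B :=
      ⟨adm_comm₂₃.1 h.1, adm_comm₂₃.1 h.2.1, adm_comm₁₂.1 (adm_comm₂₃.1 (adm_comm₁₂.1 h.2.2.2)),
        adm_comm₁₂.1 (adm_comm₂₃.1 (adm_comm₁₂.1 h.2.2.1))⟩
    rw [racah, racah, if_pos h, if_pos h']
    simp only [racahSum]
    refine Finset.sum_congr rfl fun s _ => ?_
    simp only [racahTerm]
    rw [show (A + Z + B : ℤ) = A + B + Z by ring, show (A + Y + C : ℤ) = A + C + Y by ring,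
      show (Z + Y + X : ℤ) = X + Y + Z by ring, show (X + C + B : ℤ) = B + C + X by ring,
      show (Z + Y + C + B : ℤ) = B + C + Y + Z by ring,
      show (A + Y + X + B : ℤ) = A + B + X + Y by ring,
      show (A + Z + X + C : ℤ) = A + C + X + Z by ring]
    ring
  · rw [racah_of_not h, racah_of_not]
    contrapose h
    exact ⟨adm_comm₂₃.1 h.1, adm_comm₂₃.1 h.2.1, adm_comm₁₂.1 (adm_comm₂₃.1 (adm_comm₁₂.1 h.2.2.2)),
      adm_comm₁₂.1 (adm_comm₂₃.1 (adm_comm₁₂.1 h.2.2.1))⟩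

/-! ### Tetrahedra with an edge of spin one half -/

/-- For points `p, q` joined by an edge labelled `1`, and an edge of label `z` whose ends are joined
to `q` by edges labelled `a, b` and to `p` by edges labelled `a', b'`: the tetrahedron spanned by
these four points, divided by the theta network of its triangle at `p`. -/
def halfStep (r a a' b b' z : ℕ) : ℂ := triad r a' b' z * racah r a' 1 b' b z a

theorem halfStep_symm (r a a' b b' z : ℕ) : halfStep r a a' b b' z = halfStep r b b' a a' z := by
  rw [halfStep, halfStep, triad_comm₁₂, racah_swap₁₂, racah_swap₂₃, racah_swap₁₂]

theorem halfStep_succ_succ {r a b z : ℕ} {n : ℤ} (hr : 2 ≤ r) (h : Adm r a b z)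
    (h' : Adm r (a + 1) (b + 1) z) (hn : (a + b + z : ℤ) = 2 * n) :
    halfStep r a (a + 1) b (b + 1) z = qZ r (n - z + 1) := by
  obtain ⟨i, j, k, rfl, rfl, rfl, hi⟩ := h.exists_split hr
  have hi : i + j + k + 3 ≤ r := by have := h'.2.2.2.2; omega
  push_cast at hn
  rw [halfStep, triad_of (i + 1) j k (by omega) (by omega) (by omega) (by omega),
    racah_eq (a := i + j + 1) (b := i + j + k + 1) (c := i + k + 1) (d := i + j + k)
      (x := i + j + k + 1) (y := 2 * i + j + k + 1) (z := i + j + k + 1)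
      (adm_of 1 (i + j) 0 (by omega) (by omega) (by omega) (by omega)) h'
      (adm_of 1 0 (i + k) (by omega) (by omega) (by omega) (by omega))
      (adm_of k i j (by omega) (by omega) (by omega) (by omega))
      (by push_cast; ring) (by push_cast; ring) (by push_cast; ring) (by push_cast; ring)
      (by push_cast; ring) (by push_cast; ring) (by push_cast; ring),
    racahSum_eq_single (s := i + j + k + 1) (a' := k) (b' := 0) (c' := j) (d' := 1) (x' := 0)
      (y' := i) (z' := 0) (by omega) (by push_cast; ring) (by push_cast; ring)
      (by push_cast; ring) (by push_cast; ring) (by push_cast; ring) (by push_cast; ring)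
      (by push_cast; ring) (by simp)]
  rw [show n - ((j + k : ℕ) : ℤ) + 1 = ((i + 1 : ℕ) : ℤ) by push_cast; omega, qZ_natCast,
    show i + 1 + j + k = i + j + k + 1 by ring, qFactorial_succ r i]
  have f1 := qFactorial_ne_zero (r := r) (n := i) (by omega)
  have f2 := qFactorial_ne_zero (r := r) (n := j) (by omega)
  have f3 := qFactorial_ne_zero (r := r) (n := k) (by omega)
  have f4 := qFactorial_ne_zero (r := r) (n := i + j + k + 1 + 1) (by omega)
  rw [show qFactorial r 1 = 1 by rw [qFactorial_succ, qInt_one hr, qFactorial_zero, one_mul],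
    qFactorial_zero]
  field_simp
  rw [← pow_mul, pow_mul']; simp

theorem halfStep_pred_succ {r a b z : ℕ} {n : ℤ} (hr : 2 ≤ r) (h : Adm r (a + 1) b z)
    (h' : Adm r a (b + 1) z) (hn : ((a + 1 : ℕ) + b + z : ℤ) = 2 * n) :
    halfStep r (a + 1) a b (b + 1) z = qZ r (n - (a + 1 : ℕ) + 1) := by
  obtain ⟨i, j, k, rfl, hb, rfl, hi⟩ := h'.exists_split hr
  obtain ⟨i, rfl⟩ : ∃ i', i = i' := ⟨i, rfl⟩
  obtain ⟨k, rfl⟩ : ∃ k', k = k' + 1 := ⟨k - 1, by have := h.2.1; omega⟩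
  obtain rfl : b = i + k := by omega
  push_cast at hn
  rw [halfStep, triad_of i j (k + 1) (by omega) (by omega) (by omega) (by omega),
    racah_eq (a := i + j + 1) (b := i + j + k + 1) (c := i + k + 1) (d := i + j + k + 1)
      (x := i + j + k + 2) (y := 2 * i + j + k + 1) (z := i + j + k + 1)
      (adm_of 0 (i + j) 1 (by omega) (by omega) (by omega) (by omega)) h'
      (adm_of 1 0 (i + k) (by omega) (by omega) (by omega) (by omega))
      (adm_of k i (j + 1) (by omega) (by omega) (by omega) (by omega))
      (by push_cast; ring) (by push_cast; ring) (by push_cast; ring) (by push_cast; ring)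
      (by push_cast; ring) (by push_cast; ring) (by push_cast; ring),
    racahSum_eq_single (s := i + j + k + 1) (a' := k) (b' := 0) (c' := j) (d' := 0) (x' := 1)
      (y' := i) (z' := 0) (by omega) (by push_cast; ring) (by push_cast; ring)
      (by push_cast; ring) (by push_cast; ring) (by push_cast; ring) (by push_cast; ring)
      (by push_cast; ring) (by simp)]
  rw [show n - ((i + j + 1 : ℕ) : ℤ) + 1 = ((k + 1 : ℕ) : ℤ) by push_cast; omega, qZ_natCast,
    show i + j + (k + 1) = i + j + k + 1 by ring, qFactorial_succ r k]
  have f1 := qFactorial_ne_zero (r := r) (n := i) (by omega)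
  have f2 := qFactorial_ne_zero (r := r) (n := j) (by omega)
  have f3 := qFactorial_ne_zero (r := r) (n := k) (by omega)
  have f4 := qFactorial_ne_zero (r := r) (n := i + j + k + 1 + 1) (by omega)
  rw [show qFactorial r 1 = 1 by rw [qFactorial_succ, qInt_one hr, qFactorial_zero, one_mul],
    qFactorial_zero]
  field_simp
  rw [← pow_mul, pow_mul']; simp

theorem halfStep_succ_pred {r a b z : ℕ} {n : ℤ} (hr : 2 ≤ r) (h : Adm r a (b + 1) z)
    (h' : Adm r (a + 1) b z) (hn : (a + (b + 1 : ℕ) + z : ℤ) = 2 * n) :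
    halfStep r a (a + 1) (b + 1) b z = qZ r (n - (b + 1 : ℕ) + 1) := by
  rw [halfStep_symm]
  exact halfStep_pred_succ hr (adm_comm₁₂.1 h) (adm_comm₁₂.1 h') (by push_cast at *; omega)

theorem halfStep_pred_pred {r a b z : ℕ} {n : ℤ} (hr : 2 ≤ r) (h : Adm r (a + 1) (b + 1) z)
    (h' : Adm r a b z) (hn : ((a + 1 : ℕ) + (b + 1 : ℕ) + z : ℤ) = 2 * n) :
    halfStep r (a + 1) a (b + 1) b z = -qZ r (n + 1) := by
  obtain ⟨i, j, k, rfl, rfl, rfl, hi⟩ := h'.exists_split hr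
  have hi : i + j + k + 3 ≤ r := by have := h.2.2.2.2; omega
  push_cast at hn
  rw [halfStep, triad_of i j k (by omega) (by omega) (by omega) (by omega),
    racah_eq (a := i + j + 1) (b := i + j + k) (c := i + k + 1) (d := i + j + k + 1)
      (x := i + j + k + 1) (y := 2 * i + j + k + 1) (z := i + j + k + 1)
      (adm_of 0 (i + j) 1 (by omega) (by omega) (by omega) (by omega)) h'
      (adm_of 0 1 (i + k) (by omega) (by omega) (by omega) (by omega))
      (adm_of k (i + 1) j (by omega) (by omega) (by omega) (by omega))
      (by push_cast; ring) (by push_cast; ring) (by push_cast; ring) (by push_cast; ring)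
      (by push_cast; ring) (by push_cast; ring) (by push_cast; ring),
    racahSum_eq_single (s := i + j + k + 1) (a' := k) (b' := 1) (c' := j) (d' := 0) (x' := 0)
      (y' := i) (z' := 0) (by omega) (by push_cast; ring) (by push_cast; ring)
      (by push_cast; ring) (by push_cast; ring) (by push_cast; ring) (by push_cast; ring)
      (by push_cast; ring) (by simp)]
  rw [show n + 1 = ((i + j + k + 1 + 1 : ℕ) : ℤ) by push_cast; omega, qZ_natCast,
    qFactorial_succ r (i + j + k + 1)]
  have f1 := qFactorial_ne_zero (r := r) (n := i) (by omega)
  have f2 := qFactorial_ne_zero (r := r) (n := j) (by omega)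
  have f3 := qFactorial_ne_zero (r := r) (n := k) (by omega)
  have f4 := qFactorial_ne_zero (r := r) (n := i + j + k + 1) (by omega)
  rw [show qFactorial r 1 = 1 by rw [qFactorial_succ, qInt_one hr, qFactorial_zero, one_mul],
    qFactorial_zero]
  field_simp
  rw [pow_succ, ← mul_assoc, ← pow_add, ← two_mul, pow_mul]; simp

theorem dimq_mul_triad_one_succ {r a : ℕ} (h : a + 3 ≤ r) :
    dimq r (a + 1) * triad r 1 a (a + 1) = (qInt r (a + 1))⁻¹ := by
  rw [triad_of 0 1 a (by omega) (by omega) (by omega) (by omega), dimq,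
    show 0 + 1 + a = a + 1 by ring, qFactorial_zero,
    show qFactorial r 1 = 1 by
      rw [qFactorial_succ, qInt_one (by omega), qFactorial_zero, one_mul],
    qFactorial_succ r (a + 1), qFactorial_succ r a]
  have f1 := qFactorial_ne_zero (r := r) (n := a) (by omega)
  have f2 := qInt_ne_zero (r := r) (n := a + 1) (by omega) (by omega)
  have f3 := qInt_ne_zero (r := r) (n := a + 1 + 1) (by omega) (by omega)
  field_simp
  rw [← pow_mul, pow_mul']; simp

theorem dimq_mul_triad_one_pred {r a : ℕ} (h : a + 3 ≤ r) :
    dimq r a * triad r 1 (a + 1) a = -(qInt r (a + 1 + 1))⁻¹ := by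
  rw [triad_of 1 0 a (by omega) (by omega) (by omega) (by omega), dimq,
    show 1 + 0 + a = a + 1 by ring, qFactorial_zero,
    show qFactorial r 1 = 1 by
      rw [qFactorial_succ, qInt_one (by omega), qFactorial_zero, one_mul],
    qFactorial_succ r (a + 1), qFactorial_succ r a]
  have f1 := qFactorial_ne_zero (r := r) (n := a) (by omega)
  have f2 := qInt_ne_zero (r := r) (n := a + 1) (by omega) (by omega)
  have f3 := qInt_ne_zero (r := r) (n := a + 1 + 1) (by omega) (by omega)
  field_simp
  rw [pow_succ, ← mul_assoc, ← pow_add, ← two_mul, pow_mul]; simp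

theorem adm_of_racah_ne_zero {r A B C X Y Z : ℕ} (h : racah r A B C X Y Z ≠ 0) :
    Adm r A B Z ∧ Adm r A C Y ∧ Adm r B C X ∧ Adm r X Y Z := by
  by_contra h'; exact h (racah_of_not h')

theorem adm_of_triad_ne_zero {r a b c : ℕ} (h : triad r a b c ≠ 0) : Adm r a b c := by
  by_contra h'; exact h (triad_of_not_adm h')

theorem adm_of_halfStep_ne_zero {r a a' b b' z : ℕ} (h : halfStep r a a' b b' z ≠ 0) :
    Adm r a' b' z ∧ Adm r a b z ∧ Adm r 1 a a' ∧ Adm r 1 b b' := by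
  obtain ⟨h1, h2⟩ := mul_ne_zero_iff.1 h
  obtain ⟨h3, h4, h5, h6⟩ := adm_of_racah_ne_zero h2
  refine ⟨adm_of_triad_ne_zero h1, ?_, ?_, ?_⟩ <;> simp only [Adm, Nat.even_iff] at * <;> omega

theorem halfStep_reverse (r a a' b b' z : ℕ) :
    triad r a b z * halfStep r a a' b b' z = triad r a' b' z * halfStep r a' a b' b z := by
  have : racah r a' 1 b' b z a = racah r a 1 b b' z a' := by
    rw [racah_swap₁₂, racah_swap₀₁, racah_swap₁₂]
  rw [halfStep, halfStep, this]; ring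

theorem racahSum_eq_zero_of_not_adm {r A B C X Y Z : ℕ} {a b c d x y z : ℤ} (hr : 2 ≤ r)
    (h : ¬(Adm r A B Z ∧ Adm r A C Y ∧ Adm r B C X ∧ Adm r X Y Z)) (ha : (A + B + Z : ℤ) = 2 * a)
    (hb : (A + C + Y : ℤ) = 2 * b) (hc : (B + C + X : ℤ) = 2 * c) (hd : (X + Y + Z : ℤ) = 2 * d)
    (hx : (B + C + Y + Z : ℤ) = 2 * x) (hy : (A + C + X + Z : ℤ) = 2 * y)
    (hz : (A + B + X + Y : ℤ) = 2 * z) :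
    racahSum r a b c d x y z = 0 := by
  apply racahSum_eq_zero
  intro s hs
  by_contra! H
  obtain ⟨H1, H2, H3, H4, H5, H6, H7, H8⟩ := H
  apply h
  simp only [Adm, Nat.even_iff]
  refine ⟨⟨?_, ?_, ?_, ?_, ?_⟩, ⟨?_, ?_, ?_, ?_, ?_⟩, ⟨?_, ?_, ?_, ?_, ?_⟩, ⟨?_, ?_, ?_, ?_, ?_⟩⟩ <;>
    omega

theorem halfStep_mul_racah {r A B C X Y Z B' C' : ℕ} {a b c d x y z : ℤ} {e : ℂ} (hr : 2 ≤ r)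
    (h1 : Adm r A B Z) (h2 : Adm r A C Y) (h4 : Adm r X Y Z) (ha : (A + B + Z : ℤ) = 2 * a)
    (hb : (A + C + Y : ℤ) = 2 * b) (hc : (B + C + X : ℤ) = 2 * c) (hd : (X + Y + Z : ℤ) = 2 * d)
    (hx : (B + C + Y + Z : ℤ) = 2 * x) (hy : (A + C + X + Z : ℤ) = 2 * y)
    (hz : (A + B + X + Y : ℤ) = 2 * z) (he : Adm r B C X → halfStep r B' B C' C X = e) :
    halfStep r B' B C' C X * racah r A B C X Y Z = e * racahSum r a b c d x y z := by
  by_cases h : Adm r B C X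
  · rw [he h, racah_eq h1 h2 h h4 ha hb hc hd hx hy hz]
  · have h' : ¬(Adm r A B Z ∧ Adm r A C Y ∧ Adm r B C X ∧ Adm r X Y Z) := fun k => h k.2.2.1
    rw [racah_of_not h', racahSum_eq_zero_of_not_adm hr h' ha hb hc hd hx hy hz, mul_zero, mul_zero]

theorem halfStep_mul_halfStep_mul_racah {r A A' B B' C C' X Y Z : ℕ} {a b c d x y z : ℤ}
    {δ e f : ℂ} (hr : 2 ≤ r) (h3 : Adm r B' C' X) (h4 : Adm r X Y Z)
    (ha : (A' + B' + Z : ℤ) = 2 * a) (hb : (A' + C' + Y : ℤ) = 2 * b)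
    (hc : (B' + C' + X : ℤ) = 2 * c) (hd : (X + Y + Z : ℤ) = 2 * d)
    (hx : (B' + C' + Y + Z : ℤ) = 2 * x) (hy : (A' + C' + X + Z : ℤ) = 2 * y)
    (hz : (A' + B' + X + Y : ℤ) = 2 * z)
    (hδ : Adm r A' B' Z → dimq r A' * triad r 1 A A' = δ)
    (he : Adm r A' B' Z → halfStep r A A' B B' Z = e)
    (hf : Adm r A' C' Y → halfStep r A A' C C' Y = f) :
    dimq r A' * triad r 1 A A' * halfStep r A A' B B' Z * halfStep r A A' C C' Y *
      racah r A' B' C' X Y Z = δ * (e * f * racahSum r a b c d x y z) := by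
  by_cases h : Adm r A' B' Z ∧ Adm r A' C' Y
  · rw [hδ h.1, he h.1, hf h.2, racah_eq h.1 h.2 h3 h4 ha hb hc hd hx hy hz]; ring
  · have h' : ¬(Adm r A' B' Z ∧ Adm r A' C' Y ∧ Adm r B' C' X ∧ Adm r X Y Z) :=
      fun k => h ⟨k.1, k.2.1⟩
    rw [racah_of_not h', racahSum_eq_zero_of_not_adm hr h' ha hb hc hd hx hy hz]; ring

theorem sum_range_neighbours {n a : ℕ} (ha : a < n) {F : ℕ → ℂ} (hn : F n = 0)
    (h : ∀ k < n, F k ≠ 0 → k = a + 1 ∨ a = k + 1) :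
    ∑ k ∈ Finset.range n, F k = F (a + 1) + if a = 0 then 0 else F (a - 1) := by
  have h1 : ∑ k ∈ Finset.range n, F k = ∑ k ∈ Finset.range (n + 1), F k := by
    rw [Finset.sum_range_succ, hn, add_zero]
  rw [h1]
  split_ifs with h0
  · rw [add_zero, Finset.sum_eq_single (a + 1)]
    · intro k hk hka
      by_contra hF
      rcases Nat.lt_or_ge k n with hk' | hk'
      · rcases h k hk' hF with h | h <;> omega
      · have := Finset.mem_range.1 hk
        obtain rfl : k = n := by omega
        exact hF hn
    · intro hk; exact absurd (Finset.mem_range.2 (by omega)) hk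
  · rw [← Finset.sum_pair (f := F) (show a + 1 ≠ a - 1 by omega)]
    symm
    apply Finset.sum_subset
    · intro k hk
      simp only [Finset.mem_insert, Finset.mem_singleton] at hk
      exact Finset.mem_range.2 (by omega)
    · intro k hk hka
      simp only [Finset.mem_insert, Finset.mem_singleton] at hka
      by_contra hF
      rcases Nat.lt_or_ge k n with hk' | hk'
      · rcases h k hk' hF with h | h <;> omega
      · have := Finset.mem_range.1 hk
        obtain rfl : k = n := by omega
        exact hF hn

theorem eq_of_adm_one {r a b : ℕ} (h : Adm r 1 a b) : b = a + 1 ∨ a = b + 1 := by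
  simp only [Adm, Nat.even_iff] at h; omega

section HalfPentagon

variable {r A B C X Y Z : ℕ}

theorem sum_halfStep_eq (hr : 2 ≤ r) (h1 : Adm r A B Z) (B' C' : ℕ) :
    (∑ A' ∈ Finset.range (r - 1), dimq r A' * triad r 1 A A' * halfStep r A A' B B' Z *
      halfStep r A A' C C' Y * racah r A' B' C' X Y Z) =
    (dimq r (A + 1) * triad r 1 A (A + 1) * halfStep r A (A + 1) B B' Z *
      halfStep r A (A + 1) C C' Y * racah r (A + 1) B' C' X Y Z) +
    if A = 0 then 0 else (dimq r (A - 1) * triad r 1 A (A - 1) * halfStep r A (A - 1) B B' Z *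
      halfStep r A (A - 1) C C' Y * racah r (A - 1) B' C' X Y Z) := by
  apply sum_range_neighbours (F := fun A' => dimq r A' * triad r 1 A A' *
    halfStep r A A' B B' Z * halfStep r A A' C C' Y * racah r A' B' C' X Y Z)
  · simp only [Adm] at h1; omega
  · rw [triad_of_not_adm]; · ring
    simp only [Adm, Nat.even_iff]; omega
  · intro k _ hk
    by_contra h
    apply hk
    rw [triad_of_not_adm]; · ring
    exact fun h' => h (by rcases eq_of_adm_one h' with h | h <;> omega)

theorem dimq_mul_triad_succ_of_adm {b z : ℕ} (h : Adm r (A + 1) b z) :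
    dimq r (A + 1) * triad r 1 A (A + 1) = (qZ r (A + 1))⁻¹ := by
  rw [dimq_mul_triad_one_succ, ← qZ_natCast]; · push_cast; rfl
  simp only [Adm] at h; omega

theorem dimq_mul_triad_pred_of_adm {b z : ℕ} (h : Adm r (A + 1) b z) :
    dimq r A * triad r 1 (A + 1) A = -(qZ r (A + 1 + 1))⁻¹ := by
  rw [dimq_mul_triad_one_pred, ← qZ_natCast]; · push_cast; rfl
  simp only [Adm] at h; omega

theorem sum_halfStep_succ_succ (hr : 2 ≤ r) (h1 : Adm r A B Z) (h2 : Adm r A C Y)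
    (h3 : Adm r (B + 1) (C + 1) X) (h4 : Adm r X Y Z) :
    (∑ A' ∈ Finset.range (r - 1), dimq r A' * triad r 1 A A' * halfStep r A A' B (B + 1) Z *
      halfStep r A A' C (C + 1) Y * racah r A' (B + 1) (C + 1) X Y Z) =
    halfStep r (B + 1) B (C + 1) C X * racah r A B C X Y Z := by
  obtain ⟨⟨a, ha⟩, ga⟩ := id h1
  obtain ⟨⟨b, hb⟩, gb⟩ := id h2
  obtain ⟨⟨c, hc⟩, gc⟩ := id h3
  obtain ⟨⟨d, hd⟩, gd⟩ := id h4
  rw [sum_halfStep_eq hr h1, halfStep_mul_racah (a := a) (b := b) (c := c - 1) (d := d)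
    (x := a + b - A) (y := a + c - 1 - B) (z := b + c - 1 - C) (e := -qZ r (c - 1 + 1 + 1)) hr h1 h2 h4
    (by omega) (by omega) (by omega) (by omega) (by omega) (by omega) (by omega)
    fun h => halfStep_pred_pred hr h3 h (by push_cast; omega)]
  rw [halfStep_mul_halfStep_mul_racah (a := a + 1) (b := b + 1) (c := c) (d := d)
    (x := a + b - A + 1) (y := a + c - B) (z := b + c - C) (δ := (qZ r (A + 1))⁻¹)
    (e := qZ r (a - Z + 1)) (f := qZ r (b - Y + 1)) hr h3 h4
    (by push_cast; omega) (by push_cast; omega) (by push_cast; omega) (by omega)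
    (by push_cast; omega) (by push_cast; omega) (by push_cast; omega)
    (fun h => dimq_mul_triad_succ_of_adm h)
    (fun h => halfStep_succ_succ hr h1 h (by omega))
    (fun h => halfStep_succ_succ hr h2 h (by omega))]
  have key : (if A = 0 then 0 else dimq r (A - 1) * triad r 1 A (A - 1) *
      halfStep r A (A - 1) B (B + 1) Z * halfStep r A (A - 1) C (C + 1) Y *
      racah r (A - 1) (B + 1) (C + 1) X Y Z) =
      -(qZ r (A + 1))⁻¹ * (qZ r (a - A + 1) * qZ r (b - A + 1) *
        racahSum r a b c d (a + b - A + 1) (a + c - 1 - B) (b + c - 1 - C)) := by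
    rcases A with _ | A
    · rw [if_pos rfl, racahSum_eq_zero]; · ring
      intro s _; by_contra! H; push_cast at *; omega
    · rw [if_neg (Nat.succ_ne_zero A)]
      exact halfStep_mul_halfStep_mul_racah hr h3 h4
        (by push_cast; omega) (by push_cast; omega) (by push_cast; omega) (by omega)
        (by push_cast; omega) (by push_cast; omega) (by push_cast; omega)
        (fun _ => by
          rw [Nat.add_sub_cancel, dimq_mul_triad_pred_of_adm h1]; push_cast; rfl)
        (fun h => halfStep_pred_succ hr h1 h (by push_cast at *; omega))
        (fun h => halfStep_pred_succ hr h2 h (by push_cast at *; omega))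
  have main := racahSum_contiguous_add_add (r := r) (d := d) (a := a) (b := b) (c := c - 1)
    (x := a + b - A) (y := a + c - 1 - B) (z := b + c - 1 - C) (by omega) (by omega)
    (by omega) (by omega) (by omega) (by omega) (by omega) (by omega) (by omega)
  rw [key]
  have hA : qZ r (A + 1) ≠ 0 := qZ_ne_zero (by omega) (by omega)
  rw [show (b + c - 1 - C : ℤ) - d + 1 = a - Z + 1 by omega,
    show (a + c - 1 - B : ℤ) - d + 1 = b - Y + 1 by omega,
    show (c - 1 + 1 : ℤ) = c by ring, show (a + c - 1 - B + 1 : ℤ) = a + c - B by ring,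
    show (b + c - 1 - C + 1 : ℤ) = b + c - C by ring,
    show (a + b - A - b + 1 : ℤ) = a - A + 1 by ring,
    show (a + b - A - a + 1 : ℤ) = b - A + 1 by ring,
    show (a + b - (a + b - A) + 1 : ℤ) = A + 1 by ring,
    show (c - 1 + 2 : ℤ) = c + 1 by ring] at main
  rw [show (c - 1 + 1 : ℤ) = c by ring]
  field_simp
  linear_combination main

theorem sum_halfStep_succ_pred (hr : 2 ≤ r) (h1 : Adm r A B Z) (h2 : Adm r A (C + 1) Y)
    (h3 : Adm r (B + 1) C X) (h4 : Adm r X Y Z) :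
    (∑ A' ∈ Finset.range (r - 1), dimq r A' * triad r 1 A A' * halfStep r A A' B (B + 1) Z *
      halfStep r A A' (C + 1) C Y * racah r A' (B + 1) C X Y Z) =
    halfStep r (B + 1) B C (C + 1) X * racah r A B (C + 1) X Y Z := by
  obtain ⟨⟨a, ha⟩, ga⟩ := id h1
  obtain ⟨⟨b, hb⟩, gb⟩ := id h2
  obtain ⟨⟨c, hc⟩, gc⟩ := id h3
  obtain ⟨⟨d, hd⟩, gd⟩ := id h4
  rw [sum_halfStep_eq hr h1, halfStep_mul_racah (a := a) (b := b) (c := c) (d := d)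
    (x := a + b - A) (y := a + c - B) (z := b + c - (C + 1)) (e := qZ r (c - (B + 1 : ℕ) + 1))
    hr h1 h2 h4
    (by omega) (by omega) (by omega) (by omega) (by omega) (by omega) (by omega)
    fun h => halfStep_pred_succ hr h3 h (by push_cast; omega)]
  rw [halfStep_mul_halfStep_mul_racah (a := a + 1) (b := b) (c := c) (d := d)
    (x := a + b - A) (y := a + c - B) (z := b + c - C) (δ := (qZ r (A + 1))⁻¹)
    (e := qZ r (a - Z + 1)) (f := qZ r (b - (C + 1 : ℕ) + 1)) hr h3 h4
    (by push_cast; omega) (by push_cast; omega) (by push_cast; omega) (by omega)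
    (by push_cast; omega) (by push_cast; omega) (by push_cast; omega)
    (fun h => dimq_mul_triad_succ_of_adm h)
    (fun h => halfStep_succ_succ hr h1 h (by omega))
    (fun h => halfStep_succ_pred hr h2 h (by omega))]
  have key : (if A = 0 then 0 else dimq r (A - 1) * triad r 1 A (A - 1) *
      halfStep r A (A - 1) B (B + 1) Z * halfStep r A (A - 1) (C + 1) C Y *
      racah r (A - 1) (B + 1) C X Y Z) =
      -(qZ r (A + 1))⁻¹ * (qZ r (a - A + 1) * -qZ r (b + 1) *
        racahSum r a (b - 1) c d (a + b - A) (a + c - B - 1) (b + c - (C + 1))) := by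
    rcases A with _ | A
    · rw [if_pos rfl, racahSum_eq_zero]; · ring
      intro s _; by_contra! H; push_cast at *; omega
    · rw [if_neg (Nat.succ_ne_zero A)]
      exact halfStep_mul_halfStep_mul_racah hr h3 h4
        (by push_cast; omega) (by push_cast; omega) (by push_cast; omega) (by omega)
        (by push_cast; omega) (by push_cast; omega) (by push_cast; omega)
        (fun _ => by
          rw [Nat.add_sub_cancel, dimq_mul_triad_pred_of_adm h1]; push_cast; rfl)
        (fun h => halfStep_pred_succ hr h1 h (by push_cast at *; omega))
        (fun h => halfStep_pred_pred hr h2 h (by push_cast at *; omega))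
  have main := racahSum_contiguous_add_sub (r := r) (d := d) (a := a) (b := b) (c := c)
    (x := a + b - A) (y := a + c - B) (z := b + c - (C + 1)) (by omega) (by omega)
    (by omega) (by omega) (by omega) (by omega) (by omega) (by omega) (by omega)
  rw [key]
  have hA : qZ r (A + 1) ≠ 0 := qZ_ne_zero (by omega) (by omega)
  rw [show (b + c - (C + 1) : ℤ) - d + 1 = a - Z + 1 by omega,
    show (b + c - (C + 1) : ℤ) - c + 1 = b - (C + 1 : ℕ) + 1 by omega,
    show (b + c - (C + 1) + 1 : ℤ) = b + c - C by ring,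
    show (a + b - A - b + 1 : ℤ) = a - A + 1 by ring,
    show (a + b - (a + b - A) + 1 : ℤ) = A + 1 by ring,
    show (a + c - B - a : ℤ) = c - (B + 1 : ℕ) + 1 by push_cast; ring] at main
  field_simp
  linear_combination main

theorem sum_halfStep_pred_pred (hr : 2 ≤ r) (h1 : Adm r A (B + 1) Z) (h2 : Adm r A (C + 1) Y)
    (h3 : Adm r B C X) (h4 : Adm r X Y Z) :
    (∑ A' ∈ Finset.range (r - 1), dimq r A' * triad r 1 A A' * halfStep r A A' (B + 1) B Z *
      halfStep r A A' (C + 1) C Y * racah r A' B C X Y Z) =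
    halfStep r B (B + 1) C (C + 1) X * racah r A (B + 1) (C + 1) X Y Z := by
  obtain ⟨⟨a, ha⟩, ga⟩ := id h1
  obtain ⟨⟨b, hb⟩, gb⟩ := id h2
  obtain ⟨⟨c, hc⟩, gc⟩ := id h3
  obtain ⟨⟨d, hd⟩, gd⟩ := id h4
  rw [sum_halfStep_eq hr h1, halfStep_mul_racah (a := a) (b := b) (c := c + 1) (d := d)
    (x := a + b - A) (y := a + c - B) (z := b + c - C) (e := qZ r (c - X + 1))
    hr h1 h2 h4
    (by omega) (by omega) (by omega) (by omega) (by omega) (by omega) (by omega)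
    fun h => halfStep_succ_succ hr h3 h (by omega)]
  rw [halfStep_mul_halfStep_mul_racah (a := a) (b := b) (c := c + 1 - 1) (d := d)
    (x := a + b - A - 1) (y := a + c - B) (z := b + c - C) (δ := (qZ r (A + 1))⁻¹)
    (e := qZ r (a - (B + 1 : ℕ) + 1)) (f := qZ r (b - (C + 1 : ℕ) + 1)) hr h3 h4
    (by push_cast; omega) (by push_cast; omega) (by omega) (by omega)
    (by omega) (by push_cast; omega) (by push_cast; omega)
    (fun h => dimq_mul_triad_succ_of_adm h)
    (fun h => halfStep_succ_pred hr h1 h (by omega))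
    (fun h => halfStep_succ_pred hr h2 h (by omega))]
  have key : (if A = 0 then 0 else dimq r (A - 1) * triad r 1 A (A - 1) *
      halfStep r A (A - 1) (B + 1) B Z * halfStep r A (A - 1) (C + 1) C Y *
      racah r (A - 1) B C X Y Z) =
      -(qZ r (A + 1))⁻¹ * (-qZ r (a + 1) * -qZ r (b + 1) *
        racahSum r (a - 1) (b - 1) (c + 1 - 1) d (a + b - A - 1) (a + c - B - 1)
          (b + c - C - 1)) := by
    rcases A with _ | A
    · rw [if_pos rfl, racahSum_eq_zero]; · ring
      intro s _; by_contra! H; push_cast at *; omega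
    · rw [if_neg (Nat.succ_ne_zero A)]
      exact halfStep_mul_halfStep_mul_racah hr h3 h4
        (by push_cast; omega) (by push_cast; omega) (by omega) (by omega)
        (by push_cast; omega) (by push_cast; omega) (by push_cast; omega)
        (fun _ => by
          rw [Nat.add_sub_cancel, dimq_mul_triad_pred_of_adm h1]; push_cast; rfl)
        (fun h => halfStep_pred_pred hr h1 h (by push_cast at *; omega))
        (fun h => halfStep_pred_pred hr h2 h (by push_cast at *; omega))
  have main := racahSum_contiguous_sub_sub (r := r) (d := d) (a := a) (b := b) (c := c + 1)
    (x := a + b - A) (y := a + c - B) (z := b + c - C) (by omega) (by omega)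
    (by omega) (by omega) (by omega) (by omega) (by omega) (by omega) (by omega)
  rw [key]
  have hA : qZ r (A + 1) ≠ 0 := qZ_ne_zero (by omega) (by omega)
  rw [show (a + c - B : ℤ) - (c + 1) + 1 = a - (B + 1 : ℕ) + 1 by push_cast; ring,
    show (b + c - C : ℤ) - (c + 1) + 1 = b - (C + 1 : ℕ) + 1 by push_cast; ring,
    show (a + b - (a + b - A) + 1 : ℤ) = A + 1 by ring,
    show (a + b - A - d : ℤ) = c - X + 1 by omega] at main
  field_simp
  linear_combination main

theorem sum_halfStep (hr : 2 ≤ r) (B' C' : ℕ) :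
    (∑ A' ∈ Finset.range (r - 1), dimq r A' * triad r 1 A A' * halfStep r A A' B B' Z *
      halfStep r A A' C C' Y * racah r A' B' C' X Y Z) =
    halfStep r B' B C' C X * racah r A B C X Y Z := by
  by_cases h : Adm r A B Z ∧ Adm r A C Y ∧ Adm r B' C' X ∧ Adm r X Y Z ∧ Adm r 1 B B' ∧ Adm r 1 C C'
  · obtain ⟨h1, h2, h3, h4, hB, hC⟩ := h
    rcases eq_of_adm_one hB with rfl | rfl <;> rcases eq_of_adm_one hC with rfl | rfl
    · exact sum_halfStep_succ_succ hr h1 h2 h3 h4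
    · exact sum_halfStep_succ_pred hr h1 h2 h3 h4
    · have := sum_halfStep_succ_pred hr h2 h1 (adm_comm₁₂.1 h3)
        (adm_comm₂₃.1 h4)
      rw [halfStep_symm, racah_swap₂₃, ← this]
      refine Finset.sum_congr rfl fun A' _ => ?_
      rw [racah_swap₂₃]; ring
    · exact sum_halfStep_pred_pred hr h1 h2 h3 h4
  · trans 0
    · refine Finset.sum_eq_zero fun A' _ => ?_
      by_contra hne
      simp only [mul_ne_zero_iff] at hne
      obtain ⟨⟨⟨_, h1⟩, h2⟩, h3⟩ := hne
      have h1 := adm_of_halfStep_ne_zero h1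
      have h2 := adm_of_halfStep_ne_zero h2
      have h3 := adm_of_racah_ne_zero h3
      exact h ⟨h1.2.1, h2.2.1, h3.2.2.1, h3.2.2.2, h1.2.2.2, h2.2.2.2⟩
    · by_contra hne
      obtain ⟨h1, h2⟩ := mul_ne_zero_iff.1 (Ne.symm hne)
      have h1 := adm_of_halfStep_ne_zero h1
      have h2 := adm_of_racah_ne_zero h2
      refine h ⟨h2.1, h2.2.1, h1.2.1, h2.2.2.2, ?_, ?_⟩
      · have := h1.2.2.1; rwa [adm_comm₂₃] at this
      · have := h1.2.2.2; rwa [adm_comm₂₃] at this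

end HalfPentagon

/-! ### The pentagon identity -/

theorem triad_mul_racah_zero {r b c x : ℕ} (hr : 2 ≤ r) (h : Adm r b c x) :
    triad r b c x * racah r 0 b c x c b = 1 := by
  obtain ⟨i, j, k, rfl, rfl, rfl, hi⟩ := h.exists_split hr
  rw [triad_split hi, racah_eq (a := i + j) (b := i + k) (c := i + j + k) (d := i + j + k)
      (x := 2 * i + j + k) (y := i + j + k) (z := i + j + k)
      (adm_of 0 0 (i + j) (by omega) (by omega) (by omega) (by omega))
      (adm_of 0 0 (i + k) (by omega) (by omega) (by omega) (by omega)) h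
      (adm_of k j i (by omega) (by omega) (by omega) (by omega))
      (by push_cast; ring) (by push_cast; ring) (by push_cast; ring) (by push_cast; ring)
      (by push_cast; ring) (by push_cast; ring) (by push_cast; ring),
    racahSum_eq_single (s := i + j + k) (a' := k) (b' := j) (c' := 0) (d' := 0) (x' := i)
      (y' := 0) (z' := 0) (by omega) (by push_cast; ring) (by push_cast; ring)
      (by push_cast; ring) (by push_cast; ring) (by push_cast; ring) (by push_cast; ring)
      (by push_cast; ring) (by simp)]
  have f1 := qFactorial_ne_zero (r := r) (n := i) (by omega)
  have f2 := qFactorial_ne_zero (r := r) (n := j) (by omega)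
  have f3 := qFactorial_ne_zero (r := r) (n := k) (by omega)
  have f4 := qFactorial_ne_zero (r := r) (n := i + j + k + 1) (by omega)
  rw [qFactorial_zero]
  field_simp
  rw [← pow_mul, pow_mul']; simp

theorem dimq_mul_triad_zero {r a : ℕ} (h : a + 2 ≤ r) : dimq r a * triad r a 0 a = 1 := by
  rw [triad_of 0 a 0 (by omega) (by omega) (by omega) (by omega), dimq,
    show 0 + a + 0 = a by ring, qFactorial_zero, qFactorial_succ r a]
  have f1 := qFactorial_ne_zero (r := r) (n := a) (by omega)
  have f2 := qInt_ne_zero (r := r) (n := a + 1) (by omega) (by omega)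
  field_simp
  rw [← pow_mul, pow_mul']; simp

theorem eq_of_adm_zero {r a b : ℕ} (h : Adm r 0 a b) : a = b := by
  simp only [Adm] at h; omega

theorem exists_halfStep_ne_zero {r a b z : ℕ} (hr : 2 ≤ r) (h : Adm r (a + 1) b z) :
    ∃ b', halfStep r a (a + 1) b' b z ≠ 0 := by
  obtain ⟨⟨n, hn⟩, h1, h2, h3, h4⟩ := id h
  by_cases hz : z = a + 1 + b
  · refine ⟨b + 1, ?_⟩
    rw [halfStep_succ_pred (n := n) hr ⟨⟨n, by omega⟩, by omega, by omega, by omega, by omega⟩ h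
      (by push_cast; omega)]
    exact qZ_ne_zero (by push_cast; omega) (by push_cast; omega)
  · obtain ⟨b, rfl⟩ : ∃ k, b = k + 1 := ⟨b - 1, by omega⟩
    refine ⟨b, ?_⟩
    rw [halfStep_succ_succ (n := n - 1) hr
      ⟨⟨n - 1, by omega⟩, by omega, by omega, by omega, by omega⟩ h (by omega)]
    exact qZ_ne_zero (by omega) (by omega)

/-- The pentagon (Biedenharn–Elliott) identity for five points `i, j, a, b, c`; the argument
names record the edges. -/
theorem sum_racah_mul_racah_mul_racah {r : ℕ} (hr : 2 ≤ r) (ia ib ic ja jb jc ab bc ac : ℕ) :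
    (∑ x ∈ Finset.range (r - 1), dimq r x * triad r x ia ja * triad r x ib jb * triad r x ic jc *
      racah r x ia ib ab jb ja * racah r x ib ic bc jc jb * racah r x ia ic ac jc ja) =
    triad r ab bc ac * racah r ia ib ic bc ac ab * racah r ja jb jc bc ac ab := by
  induction ia generalizing ib ic with
  | zero =>
    by_cases hab : ib = ab ∧ ic = ac
    swap
    · trans 0
      · refine Finset.sum_eq_zero fun x _ => ?_
        by_contra hne
        simp only [mul_ne_zero_iff] at hne
        have h1 := adm_of_racah_ne_zero hne.1.1.2
        have h2 := adm_of_racah_ne_zero hne.2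
        exact hab ⟨eq_of_adm_zero h1.2.2.1, eq_of_adm_zero h2.2.2.1⟩
      · by_contra hne
        have hne := Ne.symm hne
        simp only [mul_ne_zero_iff] at hne
        have h1 := adm_of_racah_ne_zero hne.1.2
        exact hab ⟨eq_of_adm_zero h1.1, eq_of_adm_zero h1.2.1⟩
    obtain ⟨rfl, rfl⟩ := hab
    have hR : racah r ja ib ic bc jc jb = racah r ja jb jc bc ic ib := racah_swap₀₁ ..
    by_cases h : Adm r ja ib jb ∧ Adm r ja ic jc ∧ Adm r ib bc ic
    · have hja : ja < r - 1 := by have := h.1; simp only [Adm] at this; omega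
      rw [Finset.sum_eq_single ja, hR, dimq_mul_triad_zero (by omega)]
      · have e1 : triad r ja ib jb * racah r ja 0 ib ib jb ja = 1 := by
          rw [racah_swap₁₂]; exact triad_mul_racah_zero hr h.1
        have e2 : triad r ja ic jc * racah r ja 0 ic ic jc ja = 1 := by
          rw [racah_swap₁₂]; exact triad_mul_racah_zero hr h.2.1
        have e3 : triad r ib bc ic * racah r 0 ib ic bc ic ib = 1 := by
          rw [triad_comm₂₃]; exact triad_mul_racah_zero hr (adm_comm₂₃.1 h.2.2)
        linear_combination (racah r ja jb jc bc ic ib) * (triad r ja ic jc * racah r ja 0 ic ic jc ja * e1 + e2 - e3)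
      · intro x _ hx
        rw [triad_of_not_adm (a := x) (b := 0)]; · ring
        exact fun h => hx (eq_of_adm_zero (adm_comm₁₂.1 h))
      · intro h; exact absurd (Finset.mem_range.2 hja) h
    · trans 0
      · refine Finset.sum_eq_zero fun x _ => ?_
        by_contra hne
        simp only [mul_ne_zero_iff] at hne
        obtain ⟨⟨⟨⟨⟨⟨_, h1⟩, h2⟩, h3⟩, _⟩, h4⟩, _⟩ := hne
        obtain rfl := eq_of_adm_zero (adm_comm₁₂.1 (adm_of_triad_ne_zero h1))
        exact h ⟨adm_of_triad_ne_zero h2, adm_of_triad_ne_zero h3,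
          adm_comm₂₃.1 (adm_of_racah_ne_zero h4).2.2.1⟩
      · by_contra hne
        have hne := Ne.symm hne
        simp only [mul_ne_zero_iff] at hne
        obtain ⟨⟨h1, _⟩, h4⟩ := hne
        rw [← hR] at h4
        have h4 := adm_of_racah_ne_zero h4
        exact h ⟨h4.1, h4.2.1, adm_of_triad_ne_zero h1⟩
  | succ pa ih =>
    by_cases hadm : Adm r (pa + 1) ic ac
    swap
    · rw [racah_of_not fun h => hadm h.2.1, mul_zero, zero_mul]
      refine Finset.sum_eq_zero fun x _ => ?_
      rw [racah_of_not (C := ic) (B := pa + 1) fun h => hadm h.2.2.1, mul_zero]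
    obtain ⟨pc, hK⟩ := exists_halfStep_ne_zero hr hadm
    generalize pa + 1 = ia at *
    apply mul_left_cancel₀ hK
    let f : ℕ → ℕ → ℕ → ℂ := fun z y x =>
      dimq r z * dimq r y * dimq r x * triad r 1 ib z * triad r 1 y x * triad r y pa ja *
        triad r y z jb * triad r y pc jc * halfStep r ib z ic pc bc * halfStep r y x pa ia ja *
        halfStep r y x z ib jb * racah r y z pc bc jc jb * racah r y pa pc ac jc ja *
        racah r x ia ib ab jb ja
    trans ∑ x ∈ Finset.range (r - 1), ∑ y ∈ Finset.range (r - 1),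
      ∑ z ∈ Finset.range (r - 1), f z y x
    · rw [Finset.mul_sum]
      refine Finset.sum_congr rfl fun x _ => ?_
      have e4 := sum_halfStep (r := r) (A := x) (B := ia) (C := ic) (X := ac) (Y := jc) (Z := ja)
        hr pa pc
      trans dimq r x * triad r x ib jb * racah r x ia ib ab jb ja * racah r x ib ic bc jc jb *
        triad r x ia ja * triad r x ic jc * (halfStep r pa ia pc ic ac * racah r x ia ic ac jc ja)
      · ring
      rw [← e4, Finset.mul_sum]
      refine Finset.sum_congr rfl fun y _ => ?_
      have e3 := sum_halfStep (r := r) (A := ib) (B := x) (C := ic) (X := jc) (Y := bc) (Z := jb)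
        hr y pc
      have e5 := halfStep_reverse r x y ia pa ja
      have e6 := halfStep_reverse r x y ic pc jc
      trans dimq r x * triad r x ib jb * racah r x ia ib ab jb ja * dimq r y * triad r 1 x y *
        racah r y pa pc ac jc ja * racah r x ib ic bc jc jb *
        (triad r x ia ja * halfStep r x y ia pa ja) * (triad r x ic jc * halfStep r x y ic pc jc)
      · ring
      rw [e5, e6]
      trans dimq r x * triad r x ib jb * racah r x ia ib ab jb ja * dimq r y * triad r 1 x y *
        racah r y pa pc ac jc ja * triad r y pa ja * halfStep r y x pa ia ja * triad r y pc jc *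
        (halfStep r y x pc ic jc * racah r x ib ic bc jc jb)
      · ring
      rw [racah_swap₁₂ r x ib, ← e3, Finset.mul_sum]
      refine Finset.sum_congr rfl fun z _ => ?_
      have e7 := halfStep_reverse r x y ib z jb
      rw [halfStep_symm r y x z] at e7
      rw [racah_swap₁₂ r z y, halfStep_symm r ib z x y, triad_comm₂₃ r 1 x y]
      simp only [f]
      rw [halfStep_symm r y x z]
      linear_combination dimq r x * racah r x ia ib ab jb ja * dimq r y * triad r 1 y x *
        racah r y pa pc ac jc ja * triad r y pa ja * halfStep r y x pa ia ja * triad r y pc jc *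
        dimq r z * triad r 1 ib z * halfStep r ib z ic pc bc * racah r y z pc bc jc jb * e7
    · have e1 := sum_halfStep (r := r) (A := ib) (B := ia) (C := ic) (X := ac) (Y := bc) (Z := ab)
        hr pa pc
      symm
      trans triad r ab bc ac * racah r ja jb jc bc ac ab *
        (halfStep r pa ia pc ic ac * racah r ia ib ic bc ac ab)
      · ring
      rw [racah_swap₁₂ r ia, ← e1, Finset.mul_sum]
      trans ∑ z ∈ Finset.range (r - 1), ∑ y ∈ Finset.range (r - 1),
        ∑ x ∈ Finset.range (r - 1), f z y x
      · refine Finset.sum_congr rfl fun z _ => ?_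
        trans dimq r z * triad r 1 ib z * halfStep r ib z ia pa ab * halfStep r ib z ic pc bc *
          (triad r ab bc ac * racah r pa z pc bc ac ab * racah r ja jb jc bc ac ab)
        · rw [racah_swap₁₂ r z pa]; ring
        rw [← ih, Finset.mul_sum]
        refine Finset.sum_congr rfl fun y _ => ?_
        have e2 := sum_halfStep (r := r) (A := y) (B := pa) (C := z) (X := ab) (Y := jb)
          (Z := ja) hr ia ib
        trans dimq r z * triad r 1 ib z * halfStep r ib z ic pc bc * dimq r y * triad r y pa ja *
          triad r y z jb * triad r y pc jc * racah r y z pc bc jc jb * racah r y pa pc ac jc ja *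
          (halfStep r ia pa ib z ab * racah r y pa z ab jb ja)
        · rw [halfStep_symm r ia]; ring
        rw [← e2, Finset.mul_sum]
        refine Finset.sum_congr rfl fun x _ => ?_
        simp only [f]; ring
      · rw [Finset.sum_comm]
        trans ∑ y ∈ Finset.range (r - 1), ∑ x ∈ Finset.range (r - 1),
          ∑ z ∈ Finset.range (r - 1), f z y x
        · exact Finset.sum_congr rfl fun y _ => Finset.sum_comm
        · exact Finset.sum_comm

/-! ### Theta and tetrahedral networks -/

/-- The factorial of an edge label. -/
def edgeFac (r n : ℕ) : ℂ := if n < r then qFactorial r n else 1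

/-- The product of factorials attached to a triangle. -/
def faceFac (r a b c : ℕ) : ℂ :=
  if Adm r a b c then qFactorial r ((a + b + c) / 2 - a) * qFactorial r ((a + b + c) / 2 - b) *
    qFactorial r ((a + b + c) / 2 - c) else 1

/-- The inverse theta network, zero for inadmissible labels. -/
def thetaInv (r a b c : ℕ) : ℂ :=
  triad r a b c * (edgeFac r a * edgeFac r b * edgeFac r c) / faceFac r a b c ^ 2

/-- The tetrahedral network, zero for inadmissible labels; the arguments are as for `racah`. -/
def tetra (r A B C X Y Z : ℕ) : ℂ :=
  faceFac r A B Z * faceFac r A C Y * faceFac r B C X * faceFac r X Y Z /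
    (edgeFac r A * edgeFac r B * edgeFac r C * edgeFac r X * edgeFac r Y * edgeFac r Z) *
      racah r A B C X Y Z

theorem edgeFac_ne_zero (r n : ℕ) : edgeFac r n ≠ 0 := by
  unfold edgeFac; split_ifs with h
  · exact qFactorial_ne_zero h
  · exact one_ne_zero

theorem faceFac_ne_zero {r : ℕ} (hr : 2 ≤ r) (a b c : ℕ) : faceFac r a b c ≠ 0 := by
  unfold faceFac; split_ifs with h
  · obtain ⟨-, h1, h2, h3, h4⟩ := h
    exact mul_ne_zero (mul_ne_zero (qFactorial_ne_zero (by omega)) (qFactorial_ne_zero (by omega)))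
      (qFactorial_ne_zero (by omega))
  · exact one_ne_zero

theorem faceFac_comm₁₂ (r a b c : ℕ) : faceFac r a b c = faceFac r b a c := by
  unfold faceFac
  rw [add_comm a b, mul_comm (qFactorial r ((b + a + c) / 2 - a))]
  simp only [adm_comm₁₂ (a := a)]

theorem faceFac_comm₂₃ (r a b c : ℕ) : faceFac r a b c = faceFac r a c b := by
  unfold faceFac
  rw [add_right_comm a b c, mul_right_comm (qFactorial r ((a + c + b) / 2 - a))]
  simp only [adm_comm₂₃ (b := b)]

theorem thetaInv_comm₁₂ (r a b c : ℕ) : thetaInv r a b c = thetaInv r b a c := by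
  unfold thetaInv
  rw [triad_comm₁₂, faceFac_comm₁₂]; ring

theorem thetaInv_comm₂₃ (r a b c : ℕ) : thetaInv r a b c = thetaInv r a c b := by
  unfold thetaInv
  rw [triad_comm₂₃, faceFac_comm₂₃]; ring

theorem tetra_swap₁₂ (r A B C X Y Z : ℕ) : tetra r A B C X Y Z = tetra r B A C Y X Z := by
  unfold tetra
  rw [racah_swap₁₂, faceFac_comm₁₂ r A B, faceFac_comm₁₂ r X Y]; ring

theorem tetra_swap₂₃ (r A B C X Y Z : ℕ) : tetra r A B C X Y Z = tetra r A C B X Z Y := by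
  unfold tetra
  rw [racah_swap₂₃, faceFac_comm₁₂ r B C, faceFac_comm₂₃ r X Y]; ring

theorem tetra_swap₀₁ (r A B C X Y Z : ℕ) : tetra r A B C X Y Z = tetra r A Z Y X C B := by
  unfold tetra
  rw [racah_swap₀₁, faceFac_comm₂₃ r A B, faceFac_comm₂₃ r A C,
    show faceFac r B C X = faceFac r X C B by
      rw [faceFac_comm₁₂, faceFac_comm₂₃, faceFac_comm₁₂],
    show faceFac r X Y Z = faceFac r Z Y X by
      rw [faceFac_comm₁₂, faceFac_comm₂₃, faceFac_comm₁₂]]; ring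

theorem thetaInv_of_not_adm {r a b c : ℕ} (h : ¬Adm r a b c) : thetaInv r a b c = 0 := by
  rw [thetaInv, triad_of_not_adm h]; ring

theorem tetra_of_not {r A B C X Y Z : ℕ}
    (h : ¬(Adm r A B Z ∧ Adm r A C Y ∧ Adm r B C X ∧ Adm r X Y Z)) :
    tetra r A B C X Y Z = 0 := by rw [tetra, racah_of_not h, mul_zero]

theorem adm_of_tetra_ne_zero {r A B C X Y Z : ℕ} (h : tetra r A B C X Y Z ≠ 0) :
    Adm r A B Z ∧ Adm r A C Y ∧ Adm r B C X ∧ Adm r X Y Z := by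
  by_contra h'; exact h (tetra_of_not h')

theorem thetaInv_ne_zero {r a b c : ℕ} (hr : 2 ≤ r) (h : Adm r a b c) : thetaInv r a b c ≠ 0 := by
  have h1 := triad_mul_racah_zero hr h
  have h2 : triad r a b c ≠ 0 := left_ne_zero_of_mul (h1 ▸ one_ne_zero)
  unfold thetaInv
  have := edgeFac_ne_zero r
  have := faceFac_ne_zero hr a b c
  simp [*]

/-- The pentagon (Biedenharn–Elliott) identity for five points `i, j, a, b, c`; the argument
names record the edges. -/
theorem pentagon {r : ℕ} (hr : 2 ≤ r) (ia ib ic ja jb jc ab bc ac : ℕ) :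
    (∑ x ∈ Finset.range (r - 1), dimq r x * thetaInv r x ia ja * thetaInv r x ib jb *
      thetaInv r x ic jc * tetra r x ia ib ab jb ja * tetra r x ib ic bc jc jb *
      tetra r x ia ic ac jc ja) =
    thetaInv r ab bc ac * tetra r ia ib ic bc ac ab * tetra r ja jb jc bc ac ab := by
  have hE := fun n => mul_inv_cancel₀ (edgeFac_ne_zero r n)
  have hF := fun a b c => mul_inv_cancel₀ (faceFac_ne_zero hr a b c)
  have hsc : thetaInv r ab bc ac * tetra r ia ib ic bc ac ab * tetra r ja jb jc bc ac ab =
      (faceFac r ia ib ab * faceFac r ib ic bc * faceFac r ia ic ac * faceFac r ja jb ab *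
        faceFac r jb jc bc * faceFac r ja jc ac * ((edgeFac r ia)⁻¹ * (edgeFac r ib)⁻¹ *
        (edgeFac r ic)⁻¹ * (edgeFac r ja)⁻¹ * (edgeFac r jb)⁻¹ * (edgeFac r jc)⁻¹ *
        (edgeFac r ab)⁻¹ * (edgeFac r bc)⁻¹ * (edgeFac r ac)⁻¹)) *
          (triad r ab bc ac * racah r ia ib ic bc ac ab * racah r ja jb jc bc ac ab) := by
    have e : faceFac r bc ac ab = faceFac r ab bc ac := by rw [faceFac_comm₂₃, faceFac_comm₁₂]
    have h1 := hE ab; have h2 := hE bc; have h3 := hE ac; have h4 := hF ab bc ac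
    unfold thetaInv tetra
    rw [e]
    simp only [div_eq_mul_inv, mul_inv, ← inv_pow]
    generalize faceFac r ab bc ac = F at *
    generalize F⁻¹ = F' at *
    generalize (edgeFac r ab)⁻¹ = E1' at *
    generalize (edgeFac r bc)⁻¹ = E2' at *
    generalize (edgeFac r ac)⁻¹ = E3' at *
    trans faceFac r ia ib ab * faceFac r ib ic bc * faceFac r ia ic ac * faceFac r ja jb ab *
        faceFac r jb jc bc * faceFac r ja jc ac * ((edgeFac r ia)⁻¹ * (edgeFac r ib)⁻¹ *
        (edgeFac r ic)⁻¹ * (edgeFac r ja)⁻¹ * (edgeFac r jb)⁻¹ * (edgeFac r jc)⁻¹ *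
        E1' * E2' * E3') *
          (triad r ab bc ac * racah r ia ib ic bc ac ab * racah r ja jb jc bc ac ab) *
        ((F * F') ^ 2 * (edgeFac r ab * E1') * (edgeFac r bc * E2') * (edgeFac r ac * E3'))
    · ring
    · rw [h1, h2, h3, h4]; ring
  rw [hsc, ← sum_racah_mul_racah_mul_racah hr, Finset.mul_sum]
  refine Finset.sum_congr rfl fun x _ => ?_
  have e1 : faceFac r ab jb ja = faceFac r ja jb ab := by
    rw [faceFac_comm₁₂, faceFac_comm₂₃, faceFac_comm₁₂]
  have e2 : faceFac r bc jc jb = faceFac r jb jc bc := by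
    rw [faceFac_comm₁₂, faceFac_comm₂₃, faceFac_comm₁₂]
  have e3 : faceFac r ac jc ja = faceFac r ja jc ac := by
    rw [faceFac_comm₁₂, faceFac_comm₂₃, faceFac_comm₁₂]
  have h1 := hE ia; have h2 := hE ib; have h3 := hE ic; have h4 := hE ja; have h5 := hE jb
  have h6 := hE jc; have h7 := hE x
  have k1 := hF x ia ja; have k2 := hF x ib jb; have k3 := hF x ic jc
  unfold thetaInv tetra
  rw [e1, e2, e3]
  simp only [div_eq_mul_inv, mul_inv, ← inv_pow]
  generalize (edgeFac r ia)⁻¹ = E1 at *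
  generalize (edgeFac r ib)⁻¹ = E2 at *
  generalize (edgeFac r ic)⁻¹ = E3 at *
  generalize (edgeFac r ja)⁻¹ = E4 at *
  generalize (edgeFac r jb)⁻¹ = E5 at *
  generalize (edgeFac r jc)⁻¹ = E6 at *
  generalize (edgeFac r x)⁻¹ = E7 at *
  generalize (faceFac r x ia ja)⁻¹ = F1 at *
  generalize (faceFac r x ib jb)⁻¹ = F2 at *
  generalize (faceFac r x ic jc)⁻¹ = F3 at *
  trans faceFac r ia ib ab * faceFac r ib ic bc * faceFac r ia ic ac * faceFac r ja jb ab *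
        faceFac r jb jc bc * faceFac r ja jc ac * (E1 * E2 * E3 * E4 * E5 * E6 *
        (edgeFac r ab)⁻¹ * (edgeFac r bc)⁻¹ * (edgeFac r ac)⁻¹) *
      (dimq r x * triad r x ia ja * triad r x ib jb * triad r x ic jc * racah r x ia ib ab jb ja *
        racah r x ib ic bc jc jb * racah r x ia ic ac jc ja) *
      ((edgeFac r ia * E1) * (edgeFac r ib * E2) * (edgeFac r ic * E3) * (edgeFac r ja * E4) *
        (edgeFac r jb * E5) * (edgeFac r jc * E6) * (edgeFac r x * E7) ^ 3 *
        (faceFac r x ia ja * F1) ^ 2 * (faceFac r x ib jb * F2) ^ 2 *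
        (faceFac r x ic jc * F3) ^ 2)
  · ring
  · rw [h1, h2, h3, h4, h5, h6, h7, k1, k2, k3]; ring

theorem dimq_mul_thetaInv_zero {r a : ℕ} (h : a + 2 ≤ r) : dimq r a * thetaInv r a 0 a = 1 := by
  have hA : Adm r a 0 a := adm_of 0 a 0 (by omega) (by omega) (by omega) (by omega)
  have h1 := dimq_mul_triad_zero h
  rw [thetaInv, faceFac, if_pos hA, edgeFac, if_pos (by omega), edgeFac, if_pos (by omega),
    show (a + 0 + a) / 2 = a by omega, Nat.sub_self, Nat.sub_zero, qFactorial_zero]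
  have := qFactorial_ne_zero (r := r) (n := a) (by omega)
  field_simp
  exact h1

theorem thetaInv_mul_tetra_zero {r b c x : ℕ} (hr : 2 ≤ r) (h : Adm r b c x) :
    thetaInv r b c x * tetra r 0 b c x c b = 1 := by
  have h1 := triad_mul_racah_zero hr h
  obtain ⟨⟨n, hn⟩, g⟩ := id h
  have hb : Adm r 0 b b := adm_of 0 0 b (by omega) (by omega) (by omega) (by omega)
  have hc : Adm r 0 c c := adm_of 0 0 c (by omega) (by omega) (by omega) (by omega)
  have e3 : faceFac r x c b = faceFac r b c x := by
    rw [faceFac_comm₁₂, faceFac_comm₂₃, faceFac_comm₁₂]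
  have e4 : ∀ k, k + 2 ≤ r → Adm r 0 k k → faceFac r 0 k k = edgeFac r k := fun k hk h => by
    rw [faceFac, if_pos h, edgeFac, if_pos (by omega), show (0 + k + k) / 2 = k by omega,
      Nat.sub_self, Nat.sub_zero, qFactorial_zero]; ring
  rw [thetaInv, tetra, e3, e4 b (by omega) hb, e4 c (by omega) hc,
    show edgeFac r 0 = 1 by rw [edgeFac, if_pos (by omega), qFactorial_zero]]
  have := edgeFac_ne_zero r b; have := edgeFac_ne_zero r c; have := edgeFac_ne_zero r x
  have := faceFac_ne_zero hr b c x
  field_simp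
  exact h1

theorem dimq_ne_zero {r n : ℕ} (h : n + 2 ≤ r) : dimq r n ≠ 0 :=
  mul_ne_zero (pow_ne_zero _ (by norm_num)) (qInt_ne_zero (by omega) (by omega))

/-! ### Comparison with the networks on simplices -/

section Simplices

variable {V : Type*} [DecidableEq V]

@[to_additive]
theorem prod_powersetCard_two_map_three {M : Type*} [CommMonoid M] (g : Fin 3 ↪ V)
    (f : Finset V → M) : ∏ e ∈ (Finset.univ.map g).powersetCard 2, f e =
      f {g 0, g 1} * f {g 0, g 2} * f {g 1, g 2} := by
  rw [Finset.powersetCard_map, Finset.prod_map,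
    show Finset.powersetCard 2 (Finset.univ : Finset (Fin 3)) = {{0, 1}, {0, 2}, {1, 2}} by decide,
    Finset.prod_insert (by decide), Finset.prod_insert (by decide), Finset.prod_singleton,
    mul_assoc]
  simp [Finset.mapEmbedding_apply]

@[to_additive]
theorem prod_powersetCard_two_map_four {M : Type*} [CommMonoid M] (g : Fin 4 ↪ V)
    (f : Finset V → M) : ∏ e ∈ (Finset.univ.map g).powersetCard 2, f e =
      f {g 0, g 1} * f {g 0, g 2} * f {g 0, g 3} * f {g 1, g 2} * f {g 1, g 3} * f {g 2, g 3} := by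
  rw [Finset.powersetCard_map, Finset.prod_map,
    show Finset.powersetCard 2 (Finset.univ : Finset (Fin 4)) =
      {{0, 1}, {0, 2}, {0, 3}, {1, 2}, {1, 3}, {2, 3}} by decide,
    Finset.prod_insert (by decide), Finset.prod_insert (by decide), Finset.prod_insert (by decide),
    Finset.prod_insert (by decide), Finset.prod_insert (by decide), Finset.prod_singleton]
  simp [Finset.mapEmbedding_apply, mul_assoc]

theorem powersetCard_three_map_four {V : Type*} (g : Fin 4 ↪ V) : (Finset.univ.map g).powersetCard 3 =
    ({{0, 1, 2}, {0, 1, 3}, {0, 2, 3}, {1, 2, 3}} : Finset (Finset (Fin 4))).map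
      (Finset.mapEmbedding g).toEmbedding := by
  rw [Finset.powersetCard_map, show Finset.powersetCard 3 (Finset.univ : Finset (Fin 4)) =
    {{0, 1, 2}, {0, 1, 3}, {0, 2, 3}, {1, 2, 3}} by decide]

theorem oppositePairs_map_four [Fintype V] (g : Fin 4 ↪ V) : oppositePairs (Finset.univ.map g) =
    ({{{0, 1}, {2, 3}}, {{0, 2}, {1, 3}}, {{0, 3}, {1, 2}}} : Finset (Finset (Finset (Fin 4)))).map
      (Finset.mapEmbedding (Finset.mapEmbedding g).toEmbedding).toEmbedding := by
  have h : ({{{0, 1}, {2, 3}}, {{0, 2}, {1, 3}}, {{0, 3}, {1, 2}}} :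
      Finset (Finset (Finset (Fin 4)))) =
      (Finset.univ.powersetCard 2).image fun e => {e, Finset.univ \ e} := by decide
  rw [h, oppositePairs, Finset.powersetCard_map]
  ext p
  simp only [Finset.mem_image, Finset.mem_map, RelEmbedding.coe_toEmbedding, exists_exists_and_eq_and]
  refine exists_congr fun e => and_congr_right fun _ => ?_
  rw [Finset.mapEmbedding_apply, Finset.mapEmbedding_apply, Finset.map_insert,
    Finset.map_singleton, ← Finset.map_sdiff]
  rfl

end Simplices

section Simplices

variable {V : Type*} [DecidableEq V]

theorem map_univ_three (g : Fin 3 ↪ V) : Finset.univ.map g = {g 0, g 1, g 2} := by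
  rw [show (Finset.univ : Finset (Fin 3)) = {0, 1, 2} by decide]; simp

theorem map_univ_four (g : Fin 4 ↪ V) : Finset.univ.map g = {g 0, g 1, g 2, g 3} := by
  rw [show (Finset.univ : Finset (Fin 4)) = {0, 1, 2, 3} by decide]; simp

theorem exists_embedding_three {V : Type*} {a b c : V} (hab : a ≠ b) (hac : a ≠ c) (hbc : b ≠ c) :
    ∃ g : Fin 3 ↪ V, g 0 = a ∧ g 1 = b ∧ g 2 = c := by
  refine ⟨⟨![a, b, c], fun i j h => ?_⟩, rfl, rfl, rfl⟩
  fin_cases i <;> fin_cases j <;> simp_all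

theorem exists_embedding_four {V : Type*} {a b c d : V} (hab : a ≠ b) (hac : a ≠ c) (had : a ≠ d)
    (hbc : b ≠ c) (hbd : b ≠ d) (hcd : c ≠ d) :
    ∃ g : Fin 4 ↪ V, g 0 = a ∧ g 1 = b ∧ g 2 = c ∧ g 3 = d := by
  refine ⟨⟨![a, b, c, d], fun i j h => ?_⟩, rfl, rfl, rfl, rfl⟩
  fin_cases i <;> fin_cases j <;> simp_all

theorem labelSum_triple (l : Finset V → ℕ) {a b c : V} (hab : a ≠ b) (hac : a ≠ c) (hbc : b ≠ c) :
    labelSum l {a, b, c} = l {a, b} + l {a, c} + l {b, c} := by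
  obtain ⟨g, rfl, rfl, rfl⟩ := exists_embedding_three hab hac hbc
  rw [labelSum, ← map_univ_three, sum_powersetCard_two_map_three]

theorem isAdmissibleTriangle_triple {r : ℕ} {l : Finset V → ℕ} {a b c : V} (hab : a ≠ b)
    (hac : a ≠ c) (hbc : b ≠ c) :
    IsAdmissibleTriangle r l {a, b, c} ↔ Adm r (l {a, b}) (l {a, c}) (l {b, c}) := by
  rw [IsAdmissibleTriangle, labelSum_triple l hab hac hbc]
  obtain ⟨g, rfl, rfl, rfl⟩ := exists_embedding_three hab hac hbc
  have hp : (Finset.univ.map g).powersetCard 2 = {{g 0, g 1}, {g 0, g 2}, {g 1, g 2}} := by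
    rw [Finset.powersetCard_map,
      show Finset.powersetCard 2 (Finset.univ : Finset (Fin 3)) = {{0, 1}, {0, 2}, {1, 2}} by decide]
    simp [Finset.mapEmbedding_apply]
  rw [← map_univ_three, hp, Adm]
  simp only [Finset.mem_insert, Finset.mem_singleton, forall_eq_or_imp, forall_eq]
  constructor
  · rintro ⟨h1, ⟨h2, h3, h4⟩, h5⟩; exact ⟨h1, by omega, by omega, by omega, h5⟩
  · rintro ⟨h1, h2, h3, h4, h5⟩; exact ⟨h1, ⟨by omega, by omega, by omega⟩, h5⟩

theorem theta_triple {r : ℕ} {l : Finset V → ℕ} {a b c : V} (hr : 2 ≤ r) (hab : a ≠ b)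
    (hac : a ≠ c) (hbc : b ≠ c) (h : Adm r (l {a, b}) (l {a, c}) (l {b, c})) :
    (theta r l {a, b, c})⁻¹ = thetaInv r (l {a, b}) (l {a, c}) (l {b, c}) := by
  rw [theta, labelSum_triple l hab hac hbc]
  obtain ⟨g, rfl, rfl, rfl⟩ := exists_embedding_three hab hac hbc
  rw [← map_univ_three, prod_powersetCard_two_map_three, prod_powersetCard_two_map_three,
    thetaInv, triad, faceFac, if_pos h, if_pos h]
  obtain ⟨h1, h2, h3, h4, h5⟩ := h
  rw [edgeFac, if_pos (by omega), edgeFac, if_pos (by omega), edgeFac, if_pos (by omega)]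
  generalize l {g 0, g 1} = A at *
  generalize l {g 0, g 2} = B at *
  generalize l {g 1, g 2} = C at *
  have f1 := qFactorial_ne_zero (r := r) (n := (A + B + C) / 2 - A) (by omega)
  have f2 := qFactorial_ne_zero (r := r) (n := (A + B + C) / 2 - B) (by omega)
  have f3 := qFactorial_ne_zero (r := r) (n := (A + B + C) / 2 - C) (by omega)
  have f4 := qFactorial_ne_zero (r := r) (n := (A + B + C) / 2 + 1) (by omega)
  have f5 := qFactorial_ne_zero (r := r) (n := A) (by omega)
  have f6 := qFactorial_ne_zero (r := r) (n := B) (by omega)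
  have f7 := qFactorial_ne_zero (r := r) (n := C) (by omega)
  have f8 : ((-1 : ℂ)) ^ ((A + B + C) / 2) ≠ 0 := pow_ne_zero _ (by norm_num)
  have f9 : (((-1 : ℂ)) ^ ((A + B + C) / 2)) ^ 2 = 1 := by rw [← pow_mul, pow_mul']; simp
  generalize (-1 : ℂ) ^ ((A + B + C) / 2) = ε at *
  field_simp
  exact f9.symm

theorem sum_filter_eq_racahSum {r M : ℕ} (hr : 0 < r) {a b c d x y z : ℕ} (P : ℕ → Prop)
    [DecidablePred P] (hP : ∀ s, P s ↔ (a ≤ s ∧ b ≤ s ∧ c ≤ s ∧ d ≤ s) ∧ s ≤ x ∧ s ≤ y ∧ s ≤ z)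
    (hM : x < M) (F : ℕ → ℂ)
    (hF : ∀ s, P s → F s = (-1) ^ s * qFactorial r (s + 1) /
      ((qFactorial r (s - a) * qFactorial r (s - b) * qFactorial r (s - c) *
        qFactorial r (s - d)) * (qFactorial r (x - s) * qFactorial r (y - s) *
          qFactorial r (z - s)))) :
    ∑ s ∈ (Finset.range M).filter P, F s = racahSum r a b c d x y z := by
  have h1 : ∑ s ∈ (Finset.range M).filter P, F s =
      ∑ s ∈ Finset.range (max M r), racahTerm r a b c d x y z s := by
    trans ∑ s ∈ (Finset.range M).filter P, racahTerm r a b c d x y z s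
    · refine Finset.sum_congr rfl fun s hs => ?_
      have hs := (Finset.mem_filter.1 hs).2
      rw [hF s hs]
      obtain ⟨⟨h1, h2, h3, h4⟩, h5, h6, h7⟩ := (hP s).1 hs
      rw [racahTerm, ← Nat.cast_sub h1, ← Nat.cast_sub h2, ← Nat.cast_sub h3, ← Nat.cast_sub h4,
        ← Nat.cast_sub h5, ← Nat.cast_sub h6, ← Nat.cast_sub h7]
      simp only [invFac_natCast, div_eq_mul_inv, mul_inv]
    apply Finset.sum_subset
    · intro s hs
      have := Finset.mem_range.1 (Finset.mem_filter.1 hs).1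
      exact Finset.mem_range.2 (lt_of_lt_of_le this (le_max_left _ _))
    · intro s _ hs
      have hs : ¬P s := fun h => hs (Finset.mem_filter.2 ⟨Finset.mem_range.2 (by
        have := ((hP s).1 h).2.1; omega), h⟩)
      rw [hP] at hs
      rw [racahTerm]
      by_cases h1 : s < a
      · rw [invFac_of_neg r (n := s - a) (by omega)]; ring
      by_cases h2 : s < b
      · rw [invFac_of_neg r (n := s - b) (by omega)]; ring
      by_cases h3 : s < c
      · rw [invFac_of_neg r (n := s - c) (by omega)]; ring
      by_cases h4 : s < d
      · rw [invFac_of_neg r (n := s - d) (by omega)]; ring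
      by_cases h5 : x < s
      · rw [invFac_of_neg r (n := x - s) (by omega)]; ring
      by_cases h6 : y < s
      · rw [invFac_of_neg r (n := y - s) (by omega)]; ring
      · rw [invFac_of_neg r (n := z - s) (by omega)]; ring
  rw [h1, racahSum]
  symm
  apply Finset.sum_subset
  · exact fun s hs => Finset.mem_range.2 (lt_of_lt_of_le (Finset.mem_range.1 hs) (le_max_right _ _))
  · intro s _ hs
    rw [racahTerm, qFactorial_eq_zero hr (by rw [Finset.mem_range] at hs; omega)]; ring

theorem half_sums {A B C X Y Z n0 n1 n2 n3 : ℕ} (e1 : A + B + Z = n1 + n1)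
    (e2 : A + C + Y = n2 + n2) (e3 : B + C + X = n3 + n3) (e0 : Z + Y + X = n0 + n0) :
    (A + B + Z) / 2 = n1 ∧ (A + C + Y) / 2 = n2 ∧ (B + C + X) / 2 = n3 ∧ (Z + Y + X) / 2 = n0 ∧
    (A + B + C + Z + Y + X - (A + X)) / 2 = n1 + n2 - A ∧
    (A + B + C + Z + Y + X - (B + Y)) / 2 = n1 + n3 - B ∧
    (A + B + C + Z + Y + X - (C + Z)) / 2 = n2 + n3 - C := by
  omega

theorem tetra_eq_of_half_sums {r A B C X Y Z n0 n1 n2 n3 M : ℕ} (hr : 2 ≤ r)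
    (h1 : Adm r A B Z) (h2 : Adm r A C Y) (h3 : Adm r B C X) (h4 : Adm r X Y Z)
    (e1 : A + B + Z = n1 + n1)
    (e2 : A + C + Y = n2 + n2) (e3 : B + C + X = n3 + n3) (e0 : Z + Y + X = n0 + n0)
    (hM : n1 + n2 - A < M) (P : ℕ → Prop) [DecidablePred P]
    (hP : ∀ s, P s ↔ (n1 ≤ s ∧ n2 ≤ s ∧ n3 ≤ s ∧ n0 ≤ s) ∧
      s ≤ n1 + n2 - A ∧ s ≤ n1 + n3 - B ∧ s ≤ n2 + n3 - C) :
    tetra r A B C X Y Z =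
      qFactorial r (n1 + n2 - A - n1) * qFactorial r (n1 + n3 - B - n1) *
          qFactorial r (n2 + n3 - C - n1) *
        (qFactorial r (n1 + n2 - A - n2) * qFactorial r (n1 + n3 - B - n2) *
          qFactorial r (n2 + n3 - C - n2)) *
        (qFactorial r (n1 + n2 - A - n3) * qFactorial r (n1 + n3 - B - n3) *
          qFactorial r (n2 + n3 - C - n3)) *
        (qFactorial r (n1 + n2 - A - n0) * qFactorial r (n1 + n3 - B - n0) *
          qFactorial r (n2 + n3 - C - n0)) /
      (qFactorial r A * qFactorial r B * qFactorial r C * qFactorial r Z * qFactorial r Y *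
        qFactorial r X) *
      ∑ s ∈ (Finset.range M).filter P, (-1) ^ s * qFactorial r (s + 1) /
        (qFactorial r (s - n1) * qFactorial r (s - n2) * qFactorial r (s - n3) *
          qFactorial r (s - n0) * (qFactorial r (n1 + n2 - A - s) *
          qFactorial r (n1 + n3 - B - s) * qFactorial r (n2 + n3 - C - s))) := by
  rw [sum_filter_eq_racahSum (by omega) P hP hM _ (fun _ _ => rfl)]
  obtain ⟨-, g1⟩ := id h1
  obtain ⟨-, g2⟩ := id h2
  obtain ⟨-, g3⟩ := id h3
  obtain ⟨-, g4⟩ := id h4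
  rw [tetra, racah_eq h1 h2 h3 h4 (a := n1) (b := n2) (c := n3) (d := n0)
    (x := (n1 + n2 - A : ℕ)) (y := (n1 + n3 - B : ℕ)) (z := (n2 + n3 - C : ℕ)) (by omega)
    (by omega) (by omega) (by omega) (by omega) (by omega) (by omega)]
  congr 1
  rw [faceFac, if_pos h1, faceFac, if_pos h2, faceFac, if_pos h3, faceFac, if_pos h4,
    show (A + B + Z) / 2 = n1 by omega, show (A + C + Y) / 2 = n2 by omega,
    show (B + C + X) / 2 = n3 by omega, show (X + Y + Z) / 2 = n0 by omega]
  rw [edgeFac, if_pos (by omega), edgeFac, if_pos (by omega), edgeFac, if_pos (by omega),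
    edgeFac, if_pos (by omega), edgeFac, if_pos (by omega), edgeFac, if_pos (by omega)]
  rw [show n1 + n2 - A - n1 = n2 - A by omega, show n1 + n3 - B - n1 = n3 - B by omega,
    show n2 + n3 - C - n1 = n0 - Z by omega, show n1 + n2 - A - n2 = n1 - A by omega,
    show n1 + n3 - B - n2 = n0 - Y by omega, show n2 + n3 - C - n2 = n3 - C by omega,
    show n1 + n2 - A - n3 = n0 - X by omega, show n1 + n3 - B - n3 = n1 - B by omega,
    show n2 + n3 - C - n3 = n2 - C by omega, show n1 + n2 - A - n0 = n3 - X by omega,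
    show n1 + n3 - B - n0 = n2 - Y by omega, show n2 + n3 - C - n0 = n1 - Z by omega]
  congr 1
  · ring
  · ring

theorem tet_quadruple [Fintype V] {r : ℕ} {l : Finset V → ℕ} {a b c d : V} (hr : 2 ≤ r)
    (hab : a ≠ b) (hac : a ≠ c) (had : a ≠ d) (hbc : b ≠ c) (hbd : b ≠ d) (hcd : c ≠ d)
    (h1 : Adm r (l {a, b}) (l {a, c}) (l {b, c})) (h2 : Adm r (l {a, b}) (l {a, d}) (l {b, d}))
    (h3 : Adm r (l {a, c}) (l {a, d}) (l {c, d})) (h4 : Adm r (l {b, c}) (l {b, d}) (l {c, d})) :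
    tet r l {a, b, c, d} =
      tetra r (l {a, b}) (l {a, c}) (l {a, d}) (l {c, d}) (l {b, d}) (l {b, c}) := by
  have t1 := labelSum_triple l hab hac hbc
  have t2 := labelSum_triple l hab had hbd
  have t3 := labelSum_triple l hac had hcd
  have t4 := labelSum_triple l hbc hbd hcd
  obtain ⟨g, rfl, rfl, rfl, rfl⟩ := exists_embedding_four hab hac had hbc hbd hcd
  have t0 : labelSum l {g 0, g 1, g 2, g 3} = l {g 0, g 1} + l {g 0, g 2} + l {g 0, g 3} +
      l {g 1, g 2} + l {g 1, g 3} + l {g 2, g 3} := by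
    rw [labelSum, ← map_univ_four, sum_powersetCard_two_map_four]
  have hne : ∀ {e f : Finset (Fin 4)}, e ≠ f → e.map g ≠ f.map g := fun h h' =>
    h (Finset.map_injective g h')
  have hq : ∀ e f : Finset (Fin 4), e ≠ f → ∑ e ∈ ({e.map g, f.map g} : Finset (Finset V)), l e =
      l (e.map g) + l (f.map g) := fun e f h => Finset.sum_pair (hne h)
  have q1 := hq {0, 1} {2, 3} (by decide)
  have q2 := hq {0, 2} {1, 3} (by decide)
  have q3 := hq {0, 3} {1, 2} (by decide)
  simp only [Finset.map_insert, Finset.map_singleton] at q1 q2 q3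
  have hF : ∀ f : Finset V → ℂ, ∏ F ∈ ({g 0, g 1, g 2, g 3} : Finset V).powersetCard 3, f F =
      f {g 0, g 1, g 2} * f {g 0, g 1, g 3} * f {g 0, g 2, g 3} * f {g 1, g 2, g 3} := fun f => by
    rw [← map_univ_four, powersetCard_three_map_four, Finset.prod_map,
      Finset.prod_insert (by decide), Finset.prod_insert (by decide),
      Finset.prod_insert (by decide), Finset.prod_singleton]
    simp [Finset.mapEmbedding_apply, mul_assoc]
  have hO : ∀ f : Finset (Finset V) → ℂ, ∏ p ∈ oppositePairs ({g 0, g 1, g 2, g 3} : Finset V), f p =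
      f {{g 0, g 1}, {g 2, g 3}} * f {{g 0, g 2}, {g 1, g 3}} * f {{g 0, g 3}, {g 1, g 2}} :=
    fun f => by
    rw [← map_univ_four, oppositePairs_map_four, Finset.prod_map,
      Finset.prod_insert (by decide), Finset.prod_insert (by decide), Finset.prod_singleton]
    simp [Finset.mapEmbedding_apply, mul_assoc]
  have hF' : ∀ P : Finset V → Prop, (∀ F ∈ ({g 0, g 1, g 2, g 3} : Finset V).powersetCard 3, P F) ↔
      P {g 0, g 1, g 2} ∧ P {g 0, g 1, g 3} ∧ P {g 0, g 2, g 3} ∧ P {g 1, g 2, g 3} := fun P => by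
    rw [← map_univ_four, powersetCard_three_map_four]
    simp [Finset.mapEmbedding_apply]
  have hO' : ∀ P : Finset (Finset V) → Prop,
      (∀ p ∈ oppositePairs ({g 0, g 1, g 2, g 3} : Finset V), P p) ↔
      P {{g 0, g 1}, {g 2, g 3}} ∧ P {{g 0, g 2}, {g 1, g 3}} ∧ P {{g 0, g 3}, {g 1, g 2}} :=
    fun P => by
    rw [← map_univ_four, oppositePairs_map_four]
    simp [Finset.mapEmbedding_apply]
  have hE : ∏ e ∈ ({g 0, g 1, g 2, g 3} : Finset V).powersetCard 2, qFactorial r (l e) =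
      qFactorial r (l {g 0, g 1}) * qFactorial r (l {g 0, g 2}) * qFactorial r (l {g 0, g 3}) *
      qFactorial r (l {g 1, g 2}) * qFactorial r (l {g 1, g 3}) * qFactorial r (l {g 2, g 3}) := by
    rw [← map_univ_four, prod_powersetCard_two_map_four]
  rw [tet]
  simp only [hF, hO, hF', hO', hE, quadHalf, q1, q2, q3, t0, t1, t2, t3, t4]
  clear hq q1 q2 q3 t0 t1 t2 t3 t4 hF hO hF' hO' hE hne
  generalize l {g 0, g 1} = A at *
  generalize l {g 0, g 2} = B at *
  generalize l {g 0, g 3} = C at *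
  generalize l {g 2, g 3} = X at *
  generalize l {g 1, g 3} = Y at *
  generalize l {g 1, g 2} = Z at *
  clear hab hac had hbc hbd hcd
  obtain ⟨n1, e1⟩ := h1.1
  obtain ⟨n2, e2⟩ := h2.1
  obtain ⟨n3, e3⟩ := h3.1
  obtain ⟨n0, e0⟩ := h4.1
  have h4' : Adm r X Y Z := adm_comm₁₂.1 (adm_comm₂₃.1 (adm_comm₁₂.1 h4))
  obtain ⟨a1, a2, a3, a0, b1, b2, b3⟩ := half_sums e1 e2 e3 e0
  rw [a1, a2, a3, a0, b1, b2, b3]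
  exact (tetra_eq_of_half_sums hr h1 h2 h3 h4' e1 e2 e3 e0 (by omega) _ fun s => Iff.rfl).symm

end Simplices

section Recoupling

variable {r : ℕ}

theorem Adm.lt {a b c : ℕ} (hr : 2 ≤ r) (h : Adm r a b c) : a < r - 1 := by
  simp only [Adm] at h; omega

theorem thetaInv_mul_tetra_of_zero {b c x : ℕ} (hr : 2 ≤ r) (h : Adm r b c x) :
    thetaInv r b c x * tetra r b b c x x 0 = 1 := by
  have e : tetra r b b c x x 0 = tetra r 0 b x c x b := by
    rw [tetra_swap₀₁, tetra_swap₁₂]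
  rw [e, thetaInv_comm₂₃]; exact thetaInv_mul_tetra_zero hr (adm_comm₂₃.1 h)

theorem thetaInv_mul_tetra_opposite_zero {x p s : ℕ} (hr : 2 ≤ r) (h : Adm r x p s) :
    thetaInv r x p s * tetra r x p p 0 s s = 1 := by
  have e : tetra r x p p 0 s s = tetra r 0 p s x s p := by
    rw [tetra_swap₁₂, tetra_swap₂₃, tetra_swap₀₁, tetra_swap₁₂]
  rw [e, thetaInv_comm₁₂, thetaInv_comm₂₃]
  exact thetaInv_mul_tetra_zero hr (adm_comm₂₃.1 (adm_comm₁₂.1 h))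

/-- Orthogonality of the recoupling coefficients. -/
theorem sum_tetra_mul_tetra (hr : 2 ≤ r) (p m n s y z : ℕ) :
    (∑ x ∈ Finset.range (r - 1), dimq r x * thetaInv r x p s * thetaInv r x m n *
      tetra r x p m z n s * tetra r x p m y n s) * (dimq r y * thetaInv r p m y *
      thetaInv r s n y) = if z = y ∧ Adm r p m y ∧ Adm r s n y then 1 else 0 := by
  have hpent := pentagon hr p p m s s n 0 z y
  have hL : (∑ x ∈ Finset.range (r - 1), dimq r x * thetaInv r x p s * thetaInv r x p s *
      thetaInv r x m n * tetra r x p p 0 s s * tetra r x p m z n s * tetra r x p m y n s) =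
      ∑ x ∈ Finset.range (r - 1), dimq r x * thetaInv r x p s * thetaInv r x m n *
      tetra r x p m z n s * tetra r x p m y n s := by
    refine Finset.sum_congr rfl fun x _ => ?_
    by_cases h : Adm r x p s
    · linear_combination (dimq r x * thetaInv r x p s * thetaInv r x m n *
        tetra r x p m z n s * tetra r x p m y n s) * thetaInv_mul_tetra_opposite_zero hr h
    · rw [thetaInv_of_not_adm h]; ring
  rw [hL] at hpent
  rw [hpent]
  split_ifs with h
  · obtain ⟨rfl, h1, h2⟩ := h
    have e1 := thetaInv_mul_tetra_of_zero hr h1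
    have e2 := thetaInv_mul_tetra_of_zero hr h2
    have e3 : dimq r z * thetaInv r 0 z z = 1 := by
      rw [thetaInv_comm₁₂]
      apply dimq_mul_thetaInv_zero
      have := h1; simp only [Adm] at this; omega
    linear_combination (thetaInv r p m z * tetra r p p m z z 0 *
      (thetaInv r s n z * tetra r s s n z z 0)) * e3 +
      (thetaInv r s n z * tetra r s s n z z 0) * e1 + e2
  · by_cases h1 : Adm r p m y
    · by_cases h2 : Adm r s n y
      · rw [thetaInv_of_not_adm (a := 0)]; · ring
        exact fun h3 => h ⟨eq_of_adm_zero h3, h1, h2⟩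
      · rw [thetaInv_of_not_adm h2]; ring
    · rw [thetaInv_of_not_adm h1]; ring

/-- The fusion rules are compatible with quantum dimensions. -/
theorem sum_dimq_of_adm (hr : 2 ≤ r) {p s : ℕ} (hp : p < r - 1) (hs : s < r - 1) :
    (∑ x ∈ Finset.range (r - 1), if Adm r x p s then dimq r x else 0) = dimq r p * dimq r s := by
  have h := sum_tetra_mul_tetra hr p p s s 0 0
  have hp' : Adm r p p 0 := adm_of p 0 0 (by omega) (by omega) (by omega) (by omega)
  have hs' : Adm r s s 0 := adm_of s 0 0 (by omega) (by omega) (by omega) (by omega)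
  rw [if_pos ⟨rfl, hp', hs'⟩] at h
  have hL : (∑ x ∈ Finset.range (r - 1), dimq r x * thetaInv r x p s * thetaInv r x p s *
      tetra r x p p 0 s s * tetra r x p p 0 s s) =
      ∑ x ∈ Finset.range (r - 1), if Adm r x p s then dimq r x else 0 := by
    refine Finset.sum_congr rfl fun x _ => ?_
    split_ifs with hx
    · have := thetaInv_mul_tetra_opposite_zero hr hx
      linear_combination dimq r x * (thetaInv r x p s * tetra r x p p 0 s s + 1) * this
    · rw [thetaInv_of_not_adm hx]; ring
  rw [hL] at h
  have e1 : dimq r p * thetaInv r p p 0 = 1 := by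
    rw [thetaInv_comm₂₃]; exact dimq_mul_thetaInv_zero (by omega)
  have e2 : dimq r s * thetaInv r s s 0 = 1 := by
    rw [thetaInv_comm₂₃]; exact dimq_mul_thetaInv_zero (by omega)
  have e0 : dimq r 0 = 1 := by rw [dimq, zero_add, qInt_one hr]; simp
  rw [e0] at h
  linear_combination (dimq r p * dimq r s) * h - (∑ x ∈ Finset.range (r - 1),
    if Adm r x p s then dimq r x else 0) * ((dimq r s * thetaInv r s s 0) * e1 + e2)

/-- The coefficients of the subdivision of an edge `pq` by a point `a`. -/
def edgeCoeff (r ap aq at' au pt qt pu qu z : ℕ) : ℂ :=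
  dimq r z * thetaInv r z ap aq * thetaInv r z pt qt * thetaInv r z pu qu *
    tetra r ap aq at' qt pt z * tetra r ap aq au qu pu z

/-- Four tetrahedra around the edge from `v` to `a`, where `a` subdivides the edge `pq`. -/
theorem sum_edge_subdivision (hr : 2 ≤ r) (xp xq xt xu ap aq at' au pt qt pu qu : ℕ) :
    (∑ k ∈ Finset.range (r - 1), dimq r k * thetaInv r k xp ap * thetaInv r k xq aq *
      (thetaInv r k xt at' * tetra r k xt xp pt ap at' * tetra r k xt xq qt aq at') *
      (thetaInv r k xu au * tetra r k xu xp pu ap au * tetra r k xu xq qu aq au)) =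
    ∑ z ∈ Finset.range (r - 1), edgeCoeff r ap aq at' au pt qt pu qu z *
      (thetaInv r xp xq z * tetra r xp xq xt qt pt z * tetra r xp xq xu qu pu z) := by
  let f : ℕ → ℕ → ℂ := fun k z => dimq r k * thetaInv r k xp ap * thetaInv r k xq aq *
    thetaInv r k xu au * tetra r k xu xp pu ap au * tetra r k xu xq qu aq au *
    (dimq r z * thetaInv r z xp xq * thetaInv r z ap aq * thetaInv r z pt qt *
      tetra r z xp ap k aq xq * tetra r z ap pt at' qt aq * tetra r z xp pt xt qt xq)
  trans ∑ k ∈ Finset.range (r - 1), ∑ z ∈ Finset.range (r - 1), f k z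
  · refine Finset.sum_congr rfl fun k _ => ?_
    have h := pentagon hr xp ap pt xq aq qt k at' xt
    have e1 : tetra r k xt xp pt ap at' = tetra r xp ap pt at' xt k := by
      rw [tetra_swap₂₃, tetra_swap₁₂, tetra_swap₀₁]
    have e2 : tetra r k xt xq qt aq at' = tetra r xq aq qt at' xt k := by
      rw [tetra_swap₂₃, tetra_swap₁₂, tetra_swap₀₁]
    have e3 : thetaInv r k xt at' = thetaInv r k at' xt := thetaInv_comm₂₃ ..
    rw [e1, e2, e3, ← h, Finset.mul_sum, Finset.sum_mul]
    refine Finset.sum_congr rfl fun z _ => ?_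
    simp only [f]; ring
  · rw [Finset.sum_comm]
    refine Finset.sum_congr rfl fun z _ => ?_
    have h := pentagon hr xp xq xu ap aq au z qu pu
    have e3 : tetra r z ap pt at' qt aq = tetra r ap aq at' qt pt z := by
      rw [tetra_swap₁₂, tetra_swap₀₁]
    have e4 : tetra r z xp pt xt qt xq = tetra r xp xq xt qt pt z := by
      rw [tetra_swap₁₂, tetra_swap₀₁]
    have e5 : thetaInv r xp xq z = thetaInv r z xp xq := by
      rw [thetaInv_comm₂₃, thetaInv_comm₁₂]
    have e6 : thetaInv r z pu qu = thetaInv r z qu pu := thetaInv_comm₂₃ ..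
    simp only [f, e3, e4]
    rw [edgeCoeff, e5, e6]
    trans dimq r z * thetaInv r z xp xq * thetaInv r z ap aq * thetaInv r z pt qt *
      tetra r ap aq at' qt pt z * tetra r xp xq xt qt pt z *
      (thetaInv r z qu pu * tetra r xp xq xu qu pu z * tetra r ap aq au qu pu z)
    · rw [← h, Finset.mul_sum]
      refine Finset.sum_congr rfl fun k _ => ?_
      have e1 : tetra r z xp ap k aq xq = tetra r k xp xq z aq ap := by
        rw [tetra_swap₁₂, tetra_swap₂₃, tetra_swap₀₁, tetra_swap₁₂]
      have e7 : tetra r k xu xp pu ap au = tetra r k xp xu pu au ap := by rw [tetra_swap₂₃]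
      have e8 : tetra r k xu xq qu aq au = tetra r k xq xu qu au aq := by rw [tetra_swap₂₃]
      rw [e1, e7, e8]; ring
    · ring

theorem edgeCoeff_zero (hr : 2 ≤ r) {w pt qt pu qu : ℕ} (h1 : Adm r pt qt w)
    (h2 : Adm r pu qu w) (z : ℕ) :
    edgeCoeff r w 0 qt qu pt qt pu qu z = if z = w then 1 else 0 := by
  split_ifs with hz
  · subst hz
    have e : ∀ a b, Adm r a b z → thetaInv r z a b * tetra r z 0 b b a z = 1 := fun a b h => by
      have h' : Adm r z b a := adm_comm₁₂.1 (adm_comm₂₃.1 (adm_comm₁₂.1 h))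
      have := thetaInv_mul_tetra_zero hr h'
      rw [tetra_swap₁₂, thetaInv_comm₂₃]; exact this
    have e0 := dimq_mul_thetaInv_zero (r := r) (a := z) (by
      have := h1; simp only [Adm] at this; omega)
    have e1 := e pt qt h1
    have e2 := e pu qu h2
    rw [edgeCoeff, thetaInv_comm₂₃ r z z 0]
    linear_combination (thetaInv r z pt qt * tetra r z 0 qt qt pt z * (thetaInv r z pu qu *
      tetra r z 0 qu qu pu z)) * e0 + (thetaInv r z pu qu * tetra r z 0 qu qu pu z) * e1 + e2
  · rw [edgeCoeff, thetaInv_of_not_adm (a := z) (b := w)]; · ring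
    intro h; exact hz (by simp only [Adm] at h; omega)

end Recoupling

/-! ### Partial sums over vertex labels -/

section PartialSum

variable {W : Type*} [DecidableEq W] {m : ℕ}

/-- Sum of `f` over all labels of the vertices in `U`, the other labels being those of `x`. -/
def partialSum (U : Finset W) (f : (W → Fin m) → ℂ) (x : W → Fin m) : ℂ :=
  ∑ y : U → Fin m, f (Function.updateFinset x U y)

theorem partialSum_empty (f : (W → Fin m) → ℂ) (x : W → Fin m) :
    partialSum ∅ f x = f x := by
  simp [partialSum, Function.updateFinset_empty]

theorem partialSum_singleton (d : W) (f : (W → Fin m) → ℂ) (x : W → Fin m) :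
    partialSum {d} f x = ∑ k, f (Function.update x d k) := by
  rw [partialSum]
  refine Fintype.sum_equiv (Equiv.funUnique ({d} : Finset W) (Fin m)) _ _ fun y => ?_
  congr 1
  ext w
  simp only [Function.updateFinset, Function.update_apply]
  by_cases h : w = d
  · subst h; simp [Equiv.funUnique]; rfl
  · simp [h]

theorem partialSum_union {U U' : Finset W} (h : Disjoint U U') (f : (W → Fin m) → ℂ)
    (x : W → Fin m) : partialSum (U ∪ U') f x = partialSum U (partialSum U' f) x := by
  simp only [partialSum]
  rw [← Fintype.sum_prod_type']
  symm
  refine Fintype.sum_equiv (Equiv.piFinsetUnion (fun _ => Fin m) h) _ _ fun y => ?_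
  congr 1
  rw [Function.updateFinset_updateFinset h]

theorem partialSum_insert {d : W} {U : Finset W} (h : d ∉ U) (f : (W → Fin m) → ℂ)
    (x : W → Fin m) :
    partialSum (insert d U) f x = partialSum U (fun x => ∑ k, f (Function.update x d k)) x := by
  rw [← Finset.union_singleton, partialSum_union (by simpa using h)]
  congr 1
  funext x; exact partialSum_singleton d f x

theorem partialSum_insert' {d : W} {U : Finset W} (h : d ∉ U) (f : (W → Fin m) → ℂ)
    (x : W → Fin m) :
    partialSum (insert d U) f x = ∑ k, partialSum U f (Function.update x d k) := by
  rw [Finset.insert_eq, partialSum_union (by simpa using h), partialSum_singleton]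

theorem partialSum_congr {U : Finset W} {f g : (W → Fin m) → ℂ} {x : W → Fin m}
    (h : ∀ x', (∀ w ∉ U, x' w = x w) → f x' = g x') : partialSum U f x = partialSum U g x :=
  Finset.sum_congr rfl fun y _ => h _ fun w hw => by simp [Function.updateFinset, hw]

theorem partialSum_mul_left {U : Finset W} {f g : (W → Fin m) → ℂ} {x : W → Fin m}
    (h : ∀ x', (∀ w ∉ U, x' w = x w) → g x' = g x) :
    partialSum U (fun x => g x * f x) x = g x * partialSum U f x := by
  rw [partialSum, partialSum, Finset.mul_sum]
  refine Finset.sum_congr rfl fun y _ => ?_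
  rw [h _ fun w hw => by simp [Function.updateFinset, hw]]

theorem partialSum_const_mul {U : Finset W} {f : (W → Fin m) → ℂ} {x : W → Fin m} (b : ℂ) :
    partialSum U (fun x => b * f x) x = b * partialSum U f x :=
  partialSum_mul_left (g := fun _ => b) fun _ _ => rfl

theorem partialSum_sum {ι : Type*} {U : Finset W} (I : Finset ι) (f : ι → (W → Fin m) → ℂ)
    (x : W → Fin m) :
    partialSum U (fun x => ∑ i ∈ I, f i x) x = ∑ i ∈ I, partialSum U (f i) x := by
  simp only [partialSum]
  exact Finset.sum_comm

end PartialSum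

/-! ### Weights of cones -/

section ConeWeight

variable {W : Type*} [DecidableEq W]

/-- The weight of the cone over the simplex `s`, for labels `x` of the edges to the cone point and
`c` of the edges of the base. -/
def coneWeight (r : ℕ) (x : W → ℕ) (c : Finset W → ℕ) (s : Finset W) : ℂ :=
  match s.toList with
  | [a] => dimq r (x a)
  | [a, b] => thetaInv r (x a) (x b) (c {a, b})
  | [a, b, d] => tetra r (x a) (x b) (x d) (c {b, d}) (c {a, d}) (c {a, b})
  | _ => 1

theorem coneWeight_congr {r : ℕ} {x x' : W → ℕ} {c c' : Finset W → ℕ} {s : Finset W}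
    (hx : ∀ a ∈ s, x a = x' a) (hc : ∀ e ⊆ s, c e = c' e) :
    coneWeight r x c s = coneWeight r x' c' s := by
  have hm : ∀ a, a ∈ s.toList → a ∈ s := fun a h => Finset.mem_toList.1 h
  have hp : ∀ a b, a ∈ s.toList → b ∈ s.toList → c {a, b} = c' {a, b} := fun a b ha hb =>
    hc _ (by simp [Finset.insert_subset_iff, hm a ha, hm b hb])
  unfold coneWeight
  generalize s.toList = L at *
  split
  · rw [hx _ (hm _ (by simp))]
  · rw [hx _ (hm _ (by simp)), hx _ (hm _ (by simp)), hp _ _ (by simp) (by simp)]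
  · rw [hx _ (hm _ (by simp)), hx _ (hm _ (by simp)), hx _ (hm _ (by simp)),
      hp _ _ (by simp) (by simp), hp _ _ (by simp) (by simp), hp _ _ (by simp) (by simp)]
  · rfl

theorem coneWeight_singleton (r : ℕ) (x : W → ℕ) (c : Finset W → ℕ) (a : W) :
    coneWeight r x c {a} = dimq r (x a) := by
  simp [coneWeight]

theorem coneWeight_pair (r : ℕ) (x : W → ℕ) (c : Finset W → ℕ) {a b : W} (hab : a ≠ b) :
    coneWeight r x c {a, b} = thetaInv r (x a) (x b) (c {a, b}) := by
  have hlen : ({a, b} : Finset W).toList.length = 2 := by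
    rw [Finset.length_toList, Finset.card_pair hab]
  have hnd := ({a, b} : Finset W).nodup_toList
  have hmem : ∀ u, u ∈ ({a, b} : Finset W).toList ↔ u = a ∨ u = b := fun u => by simp
  unfold coneWeight
  obtain ⟨u, v, hL⟩ := List.length_eq_two.1 hlen
  rw [hL] at hnd hmem ⊢
  have hu := (hmem u).1 (by simp)
  have hv := (hmem v).1 (by simp)
  have huv : u ≠ v := by simpa using hnd
  rcases hu with rfl | rfl <;> rcases hv with rfl | rfl
  · exact absurd rfl huv
  · rfl
  · rw [thetaInv_comm₁₂, Finset.pair_comm v u]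
  · exact absurd rfl huv

theorem coneWeight_triple (r : ℕ) (x : W → ℕ) (c : Finset W → ℕ) {a b d : W} (hab : a ≠ b)
    (had : a ≠ d) (hbd : b ≠ d) :
    coneWeight r x c {a, b, d} =
      tetra r (x a) (x b) (x d) (c {b, d}) (c {a, d}) (c {a, b}) := by
  have hlen : ({a, b, d} : Finset W).toList.length = 3 := by
    rw [Finset.length_toList, Finset.card_eq_three]
    exact ⟨a, b, d, hab, had, hbd, rfl⟩
  have hnd := ({a, b, d} : Finset W).nodup_toList
  have hmem : ∀ u, u ∈ ({a, b, d} : Finset W).toList ↔ u = a ∨ u = b ∨ u = d := fun u => by simp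
  unfold coneWeight
  obtain ⟨u, v, w, hL⟩ := List.length_eq_three.1 hlen
  rw [hL] at hnd hmem ⊢
  have hu := (hmem u).1 (by simp)
  have hv := (hmem v).1 (by simp)
  have hw := (hmem w).1 (by simp)
  simp only [List.nodup_cons, List.mem_cons, List.not_mem_nil, or_false, not_or, not_false_eq_true,
    List.nodup_nil, and_true] at hnd
  obtain ⟨⟨h1, h2⟩, h3⟩ := hnd
  let G : W → W → W → ℂ := fun u v w =>
    tetra r (x u) (x v) (x w) (c {v, w}) (c {u, w}) (c {u, v})
  have G₁₂ : ∀ u v w, G u v w = G v u w := fun u v w => by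
    simp only [G]; rw [tetra_swap₁₂, Finset.pair_comm u v]
  have G₂₃ : ∀ u v w, G u v w = G u w v := fun u v w => by
    simp only [G]; rw [tetra_swap₂₃, Finset.pair_comm v w]
  change G u v w = G a b d
  rcases hu with rfl | rfl | rfl <;> rcases hv with rfl | rfl | rfl <;>
    rcases hw with rfl | rfl | rfl <;> first
    | exact absurd rfl h1
    | exact absurd rfl h2
    | exact absurd rfl h3
    | rfl
    | exact G₁₂ _ _ _
    | exact G₂₃ _ _ _
    | exact (G₁₂ _ _ _).trans (G₂₃ _ _ _)
    | exact (G₂₃ _ _ _).trans (G₁₂ _ _ _)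
    | exact ((G₁₂ _ _ _).trans (G₂₃ _ _ _)).trans (G₁₂ _ _ _)

end ConeWeight

/-! ### Starring of finite complexes -/

section Starring

variable {W : Type*} [DecidableEq W]

/-- A finite simplicial complex, as the set of its faces. -/
structure IsComplex (F : Finset (Finset W)) : Prop where
  nonempty : ∀ {s}, s ∈ F → s.Nonempty
  down : ∀ {s t}, s ∈ F → t ⊆ s → t.Nonempty → t ∈ F

/-- `F'` arises from `F` by starring the face `A` at the new vertex `a`. -/
structure IsStarringAt (F F' : Finset (Finset W)) (A : Finset W) (a : W) : Prop where
  complex : IsComplex F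
  complex' : IsComplex F'
  mem_face : A ∈ F
  fresh : {a} ∉ F
  mem_iff : ∀ s, s ∈ F' ↔ (s ∈ F ∧ ¬A ⊆ s) ∨ ∃ σ : Finset W, s = insert a σ ∧ ¬A ⊆ σ ∧ σ ∪ A ∈ F

/-- The vertices completing `e` to a face. -/
def apexes (F : Finset (Finset W)) (e : Finset W) : Set W := {w | w ∉ e ∧ insert w e ∈ F}

/-- A pure two-dimensional complex. -/
structure IsPure (F : Finset (Finset W)) : Prop where
  card_le : ∀ {s}, s ∈ F → s.card ≤ 3
  pure : ∀ {s}, s ∈ F → ∃ t ∈ F, s ⊆ t ∧ t.card = 3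

variable {F F' : Finset (Finset W)} {A : Finset W} {a : W}

namespace IsStarringAt

theorem notMem (h : IsStarringAt F F' A a) {s : Finset W} (hs : s ∈ F) : a ∉ s := fun ha =>
  h.fresh (h.complex.down hs (Finset.singleton_subset_iff.2 ha) (Finset.singleton_nonempty a))

theorem mem_of_notMem (h : IsStarringAt F F' A a) {s : Finset W} (ha : a ∉ s) :
    s ∈ F' ↔ s ∈ F ∧ ¬A ⊆ s := by
  rw [h.mem_iff]
  refine ⟨?_, Or.inl⟩
  rintro (h1 | ⟨σ, rfl, -⟩)
  · exact h1
  · simp at ha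

theorem insert_mem (h : IsStarringAt F F' A a) {σ : Finset W} (ha : a ∉ σ) :
    insert a σ ∈ F' ↔ ¬A ⊆ σ ∧ σ ∪ A ∈ F := by
  rw [h.mem_iff]
  constructor
  · rintro (h1 | ⟨τ, h1, h2, h3⟩)
    · exact absurd (Finset.mem_insert_self a σ) (h.notMem h1.1)
    · have hτ : a ∉ τ := fun h' => h.notMem h3 (Finset.mem_union_left _ h')
      have : σ = τ := by rw [← Finset.erase_insert ha, h1, Finset.erase_insert hτ]
      subst this
      exact ⟨h2, h3⟩
  · exact fun h1 => Or.inr ⟨σ, rfl, h1⟩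

theorem exists_insert (h : IsStarringAt F F' A a) {s : Finset W} (hs : s ∈ F') (ha : a ∈ s) :
    ∃ σ, a ∉ σ ∧ s = insert a σ ∧ ¬A ⊆ σ ∧ σ ∪ A ∈ F :=
  have h1 : insert a (s.erase a) = s := Finset.insert_erase ha
  ⟨s.erase a, Finset.notMem_erase a s, h1.symm,
    (h.insert_mem (Finset.notMem_erase a s)).1 (h1.symm ▸ hs)⟩

theorem insert_erase_mem (h : IsStarringAt F F' A a) {s : Finset W} (hs : s ∈ F) (hA : A ⊆ s)
    {p : W} (hp : p ∈ A) : insert a (s.erase p) ∈ F' := by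
  rw [h.insert_mem fun ha => h.notMem hs (Finset.mem_of_mem_erase ha)]
  refine ⟨fun h' => by simpa using h' hp, ?_⟩
  convert hs using 1
  ext w
  simp only [Finset.mem_union, Finset.mem_erase]
  constructor
  · rintro (h1 | h1)
    · exact h1.2
    · exact hA h1
  · intro hw
    by_cases hwp : w = p
    · exact Or.inr (hwp ▸ hp)
    · exact Or.inl ⟨hwp, hw⟩

theorem card_lt (_h : IsStarringAt F F' A a) {σ : Finset W} (hσ : ¬A ⊆ σ) :
    σ.card < (σ ∪ A).card := by
  refine Finset.card_lt_card ⟨Finset.subset_union_left, fun h' => hσ ?_⟩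
  exact (Finset.subset_union_right).trans h'

theorem card_le (h : IsStarringAt F F' A a) (hF : ∀ s ∈ F, s.card ≤ 3) :
    ∀ s ∈ F', s.card ≤ 3 := by
  intro s hs
  by_cases ha : a ∈ s
  · obtain ⟨σ, hσ, rfl, h1, h2⟩ := h.exists_insert hs ha
    have := h.card_lt h1
    have := hF _ h2
    rw [Finset.card_insert_of_notMem hσ]
    omega
  · exact hF s ((h.mem_of_notMem ha).1 hs).1

theorem card_le' (h : IsStarringAt F F' A a) (hF : ∀ s ∈ F', s.card ≤ 3) :
    ∀ s ∈ F, s.card ≤ 3 := by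
  intro s hs
  by_cases hA : A ⊆ s
  · obtain ⟨p, hp⟩ := h.complex.nonempty h.mem_face
    have h1 := hF _ (h.insert_erase_mem hs hA hp)
    rw [Finset.card_insert_of_notMem fun ha => h.notMem hs (Finset.mem_of_mem_erase ha),
      Finset.card_erase_of_mem (hA hp)] at h1
    omega
  · exact hF s ((h.mem_of_notMem (h.notMem hs)).2 ⟨hs, hA⟩)

theorem isPure (h : IsStarringAt F F' A a) (hF : IsPure F) : IsPure F' := by
  refine ⟨fun hs => h.card_le (fun _ => hF.card_le) _ hs, fun {s} hs => ?_⟩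
  have key : ∀ σ : Finset W, σ ⊆ s → s ⊆ insert a σ → ¬A ⊆ σ → ∀ t ∈ F, σ ⊆ t → A ⊆ t →
      t.card = 3 → ∃ t ∈ F', s ⊆ t ∧ t.card = 3 := by
    intro σ _ hs' hσ t ht hst hAt htc
    obtain ⟨p, hp, hpσ⟩ := Finset.not_subset.1 hσ
    refine ⟨_, h.insert_erase_mem ht hAt hp, hs'.trans ?_, ?_⟩
    · refine Finset.insert_subset_insert _ fun w hw => Finset.mem_erase.2 ⟨?_, hst hw⟩
      rintro rfl; exact hpσ hw
    · rw [Finset.card_insert_of_notMem fun ha => h.notMem ht (Finset.mem_of_mem_erase ha),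
        Finset.card_erase_of_mem (hAt hp), htc]
  by_cases ha : a ∈ s
  · obtain ⟨σ, hσ, rfl, h1, h2⟩ := h.exists_insert hs ha
    obtain ⟨t, ht, hst, htc⟩ := hF.pure h2
    exact key σ (Finset.subset_insert _ _) subset_rfl h1 t ht (Finset.subset_union_left.trans hst)
      (Finset.subset_union_right.trans hst) htc
  · obtain ⟨hsF, hA⟩ := (h.mem_of_notMem ha).1 hs
    obtain ⟨t, ht, hst, htc⟩ := hF.pure hsF
    by_cases hAt : A ⊆ t
    · exact key s subset_rfl (Finset.subset_insert _ _) hA t ht hst hAt htc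
    · exact ⟨t, (h.mem_of_notMem (h.notMem ht)).2 ⟨ht, hAt⟩, hst, htc⟩

theorem isPure' (h : IsStarringAt F F' A a) (hF : IsPure F') : IsPure F := by
  have hle := h.card_le' fun _ => hF.card_le
  refine ⟨fun hs => hle _ hs, fun {s} hs => ?_⟩
  have key : ∀ σ, a ∉ σ → insert a σ ∈ F' → (insert a σ).card = 3 → s ⊆ σ ∪ A →
      ∃ t ∈ F, s ⊆ t ∧ t.card = 3 := by
    intro σ ha h1 h2 h3
    obtain ⟨h4, h5⟩ := (h.insert_mem ha).1 h1
    have h6 := h.card_lt h4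
    have h7 := hle _ h5
    rw [Finset.card_insert_of_notMem ha] at h2
    exact ⟨_, h5, h3, by omega⟩
  by_cases hA : A ⊆ s
  · obtain ⟨p, hp⟩ := h.complex.nonempty h.mem_face
    obtain ⟨t, ht, hst, htc⟩ := hF.pure (h.insert_erase_mem hs hA hp)
    obtain ⟨σ, hσ, rfl, -⟩ := h.exists_insert ht (hst (Finset.mem_insert_self _ _))
    refine key σ hσ ht htc fun w hw => ?_
    by_cases hwp : w = p
    · exact Finset.mem_union_right _ (hwp ▸ hp)
    · have := hst (Finset.mem_insert_of_mem (Finset.mem_erase.2 ⟨hwp, hw⟩))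
      rcases Finset.mem_insert.1 this with rfl | h'
      · exact absurd hw (h.notMem hs)
      · exact Finset.mem_union_left _ h'
  · obtain ⟨t, ht, hst, htc⟩ := hF.pure ((h.mem_of_notMem (h.notMem hs)).2 ⟨hs, hA⟩)
    by_cases ha : a ∈ t
    · obtain ⟨σ, hσ, rfl, -⟩ := h.exists_insert ht ha
      refine key σ hσ ht htc fun w hw => Finset.mem_union_left _ ?_
      rcases Finset.mem_insert.1 (hst hw) with rfl | h'
      · exact absurd hw (h.notMem hs)
      · exact h'
    · exact ⟨t, ((h.mem_of_notMem ha).1 ht).1, hst, htc⟩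

/-- Edges that do not contain the starred face keep their degree. -/
theorem ncard_apexes_of_not_subset (h : IsStarringAt F F' A a) (hF : ∀ s ∈ F, s.card ≤ 3)
    {e : Finset W} (he : e ∈ F) (hec : e.card = 2) (hA : ¬A ⊆ e) :
    (apexes F' e).ncard = (apexes F e).ncard := by
  classical
  have hae := h.notMem he
  let f : W → W := fun w => if A ⊆ insert w e then a else w
  have huniq : ∀ w, A ⊆ insert w e → w ∈ A := fun w hw => by
    by_contra hwA
    refine hA fun z hz => ?_
    rcases Finset.mem_insert.1 (hw hz) with rfl | h'
    · exact absurd hz hwA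
    · exact h'
  have himage : apexes F' e = f '' apexes F e := by
    ext w
    simp only [apexes, Set.mem_ofPred_eq, Set.mem_image]
    constructor
    · rintro ⟨hw, hwF⟩
      by_cases hwa : w = a
      · subst hwa
        obtain ⟨-, h1⟩ := (h.insert_mem hw).1 hwF
        have h2 := h.card_lt hA
        have h3 := hF _ h1
        obtain ⟨z, hz⟩ := Finset.card_eq_one.1
          (show ((e ∪ A) \ e).card = 1 by
            rw [Finset.card_sdiff_of_subset Finset.subset_union_left]; omega)
        have hz1 : z ∈ (e ∪ A) \ e := hz ▸ Finset.mem_singleton_self z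
        have hz2 : insert z e = e ∪ A := by
          rw [Finset.insert_eq, ← hz, Finset.sdiff_union_of_subset Finset.subset_union_left]
        refine ⟨z, ⟨(Finset.mem_sdiff.1 hz1).2, hz2 ▸ h1⟩, ?_⟩
        simp [f, hz2]
      · have hw' : a ∉ insert w e := by simp [Ne.symm hwa, hae]
        obtain ⟨h1, h2⟩ := (h.mem_of_notMem hw').1 hwF
        exact ⟨w, ⟨hw, h1⟩, by simp [f, h2]⟩
    · rintro ⟨z, ⟨hz, hzF⟩, rfl⟩
      by_cases hzA : A ⊆ insert z e
      · simp only [f, hzA, if_true]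
        refine ⟨hae, (h.insert_mem hae).2 ⟨hA, h.complex.down hzF ?_ ?_⟩⟩
        · exact Finset.union_subset (Finset.subset_insert _ _) hzA
        · exact (h.complex.nonempty he).mono Finset.subset_union_left
      · simp only [f, hzA, if_false]
        exact ⟨hz, (h.mem_of_notMem (h.notMem hzF)).2 ⟨hzF, hzA⟩⟩
  rw [himage, Set.InjOn.ncard_image]
  rintro w ⟨hw, hwF⟩ z ⟨hz, hzF⟩ hwz
  have hwa : w ≠ a := fun h' => h.notMem hwF (h' ▸ Finset.mem_insert_self _ _)
  have hza : z ≠ a := fun h' => h.notMem hzF (h' ▸ Finset.mem_insert_self _ _)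
  by_cases h1 : A ⊆ insert w e <;> by_cases h2 : A ⊆ insert z e <;>
    simp only [f, h1, h2, if_true, if_false] at hwz
  · rcases Finset.mem_insert.1 (h2 (huniq w h1)) with h3 | h3
    · exact h3
    · exact absurd h3 hw
  · exact absurd hwz.symm hza
  · exact absurd hwz hwa
  · exact hwz

/-- An edge containing the starred face has the same degree as an edge at the new vertex. -/
theorem apexes_pair (h : IsStarringAt F F' A a) {p u : W} (hpu : p ≠ u) (he : {p, u} ∈ F)
    (hp : p ∈ A) (hA : A ⊆ {p, u}) : apexes F' {a, u} = apexes F {p, u} := by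
  have hau : a ∉ ({p, u} : Finset W) := h.notMem he
  simp only [Finset.mem_insert, Finset.mem_singleton, not_or] at hau
  ext w
  simp only [apexes, Set.mem_ofPred_eq]
  by_cases hwa : w = a
  · subst hwa
    refine ⟨fun h' => absurd (Finset.mem_insert_self _ _) h'.1, fun h' => ?_⟩
    exact absurd (Finset.mem_insert_self _ _) (h.notMem h'.2)
  rw [Finset.insert_comm, h.insert_mem (by simp [Ne.symm hwa, hau.2])]
  have h1 : ({w, u} : Finset W) ∪ A = {w, p, u} := by
    ext z
    have := @hA z
    simp only [Finset.mem_union, Finset.mem_insert, Finset.mem_singleton] at this ⊢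
    constructor
    · rintro ((h | h) | h)
      · exact Or.inl h
      · exact Or.inr (Or.inr h)
      · exact Or.inr (this h)
    · rintro (h | rfl | h)
      · exact Or.inl (Or.inl h)
      · exact Or.inr hp
      · exact Or.inl (Or.inr h)
  rw [h1]
  simp only [Finset.mem_insert, Finset.mem_singleton, not_or]
  constructor
  · rintro ⟨⟨-, h2⟩, h3, h4⟩
    refine ⟨⟨?_, h2⟩, h4⟩
    rintro rfl; exact h3 hA
  · rintro ⟨⟨h2, h3⟩, h4⟩
    refine ⟨⟨hwa, h3⟩, fun h5 => ?_, h4⟩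
    have := h5 hp
    simp only [Finset.mem_insert, Finset.mem_singleton] at this
    rcases this with h6 | h6
    · exact h2 h6.symm
    · exact hpu h6

theorem exists_ncard_apexes_iff (h : IsStarringAt F F' A a) (hF : ∀ s ∈ F, s.card ≤ 3) {n : ℕ}
    (hn : n ≠ 2) : (∃ e ∈ F, e.card = 2 ∧ (apexes F e).ncard = n) ↔
      ∃ e ∈ F', e.card = 2 ∧ (apexes F' e).ncard = n := by
  have key : ∀ e ∈ F, ∀ p u, p ≠ u → e = {p, u} → p ∈ A → A ⊆ e →
      apexes F' {a, u} = apexes F e ∧ {a, u} ∈ F' ∧ ({a, u} : Finset W).card = 2 := by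
    rintro e he p u hpu rfl hp hA
    have hau := h.notMem he
    simp only [Finset.mem_insert, Finset.mem_singleton, not_or] at hau
    refine ⟨h.apexes_pair hpu he hp hA, ?_, Finset.card_pair hau.2⟩
    convert h.insert_erase_mem he hA hp using 2
    rw [Finset.erase_insert (by simpa using hpu)]
  constructor
  · rintro ⟨e, he, hec, hn⟩
    by_cases hA : A ⊆ e
    · obtain ⟨p, hp⟩ := h.complex.nonempty h.mem_face
      obtain ⟨u, hu⟩ := Finset.card_eq_one.1
        (show (e.erase p).card = 1 by rw [Finset.card_erase_of_mem (hA hp), hec])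
      have hpu : p ≠ u := by
        have : u ∈ e.erase p := hu ▸ Finset.mem_singleton_self u
        exact (Finset.ne_of_mem_erase this).symm
      obtain ⟨h1, h2, h3⟩ := key e he p u hpu (by rw [← hu, Finset.insert_erase (hA hp)]) hp hA
      exact ⟨_, h2, h3, by rw [h1, hn]⟩
    · exact ⟨e, (h.mem_of_notMem (h.notMem he)).2 ⟨he, hA⟩, hec, by
        rw [h.ncard_apexes_of_not_subset hF he hec hA, hn]⟩
  · rintro ⟨e, he, hec, hen⟩
    by_cases ha : a ∈ e
    · obtain ⟨σ, hσ, rfl, h1, h2⟩ := h.exists_insert he ha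
      rw [Finset.card_insert_of_notMem hσ] at hec
      obtain ⟨u, rfl⟩ := Finset.card_eq_one.1 (show σ.card = 1 by omega)
      obtain ⟨p, hp, hpu⟩ := Finset.not_subset.1 h1
      have hpu' : p ≠ u := by simpa using hpu
      have h3 := h.card_lt h1
      have h4 := hF _ h2
      rw [Finset.card_singleton] at h3
      rcases (show ({u} ∪ A : Finset W).card = 2 ∨ ({u} ∪ A : Finset W).card = 3 by omega) with
        h5 | h5
      · have h6 : {u} ∪ A = {p, u} := by
          symm
          refine Finset.eq_of_subset_of_card_le ?_ (by rw [h5, Finset.card_pair hpu'])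
          simp [Finset.insert_subset_iff, hp]
        obtain ⟨h7, -⟩ := key _ h2 p u hpu' h6 hp Finset.subset_union_right
        exact ⟨_, h2, h5, by rw [← h7, hen]⟩
      · exfalso
        refine hn ?_
        rw [← hen]
        have hau : a ∉ {u} ∪ A := h.notMem h2
        have : apexes F' {a, u} = ((({u} ∪ A).erase u : Finset W) : Set W) := by
          ext w
          simp only [apexes, Set.mem_ofPred_eq, Finset.mem_coe, Finset.mem_erase]
          by_cases hwa : w = a
          · subst hwa
            exact ⟨fun h' => absurd (Finset.mem_insert_self _ _) h'.1, fun h' => absurd h'.2 hau⟩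
          by_cases hwu : w = u
          · simp [hwu]
          rw [Finset.insert_comm, h.insert_mem (by
            simp only [Finset.mem_insert, not_or]; exact ⟨Ne.symm hwa, hσ⟩)]
          have h6 : insert w {u} ∪ A = insert w ({u} ∪ A) := Finset.insert_union _ _ _
          rw [h6]
          constructor
          · rintro ⟨-, -, h8⟩
            refine ⟨hwu, ?_⟩
            by_contra h9
            have := hF _ h8
            rw [Finset.card_insert_of_notMem h9] at this
            omega
          · rintro ⟨-, h8⟩
            rw [Finset.insert_eq_of_mem h8]
            refine ⟨by simp [hwa, hwu], fun h9 => ?_, h2⟩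
            have h10 : ({u} ∪ A : Finset W) ⊆ {w, u} := Finset.union_subset (by simp) h9
            have := Finset.card_le_card h10
            rw [Finset.card_pair hwu] at this
            omega
        rw [this, Set.ncard_coe_finset, Finset.card_erase_of_mem (by simp), h5]
    · obtain ⟨h1, h2⟩ := (h.mem_of_notMem ha).1 he
      exact ⟨e, h1, hec, by rw [← h.ncard_apexes_of_not_subset hF h1 hec h2, hen]⟩

end IsStarringAt

end Starring

/-! ### Vertex sums over a complex -/

section VertexSums

/-- Orthogonality transports the evaluation of a vertex sum across an edge. -/
theorem sum_adjacent {r : ℕ} (hr : 2 ≤ r) (xa xb ad bd ae be y : ℕ)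
    (ρ : Fin (r - 1) → Fin (r - 1) → ℂ) (κ : ℕ → ℂ)
    (h : ∀ z e, ∑ d : Fin (r - 1), dimq r d * thetaInv r xa d ad * thetaInv r xb d bd *
        tetra r xa xb d bd ad z * ρ d e = tetra r xa xb e be ae z * κ z)
    (h0 : ∀ d e, ρ d e ≠ 0 → Adm r xa d ad ∧ Adm r xb d bd) (d : Fin (r - 1)) :
    ∑ e : Fin (r - 1), dimq r e * thetaInv r xa e ae * thetaInv r xb e be *
        tetra r xa xb e be ae y * ρ d e =
      tetra r xa xb d bd ad y * (thetaInv r ad bd y * κ y / thetaInv r ae be y) := by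
  have hsw : ∀ k ad bd z, tetra r z xa ad k bd xb = tetra r xa xb k bd ad z := by
    intro k ad bd z
    rw [tetra_swap₁₂, tetra_swap₀₁]
  have hsw' : ∀ k ae be z, tetra r k xa xb z be ae = tetra r xa xb k be ae z := by
    intro k ae be z
    rw [tetra_swap₁₂, tetra_swap₂₃]
  have hρ : ∀ e, ρ d e = ∑ z ∈ Finset.range (r - 1), dimq r z * thetaInv r z xa xb *
      thetaInv r z ad bd * tetra r xa xb d bd ad z * (tetra r xa xb e be ae z * κ z) := by
    intro e
    simp only [← h, Finset.mul_sum]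
    rw [Finset.sum_comm]
    have h1 : ∀ k : Fin (r - 1), ∑ z ∈ Finset.range (r - 1), dimq r z * thetaInv r z xa xb *
        thetaInv r z ad bd * tetra r xa xb d bd ad z * (dimq r k * thetaInv r xa k ad *
        thetaInv r xb k bd * tetra r xa xb k bd ad z * ρ k e) = if k = d then ρ d e else 0 := by
      intro k
      have h2 := sum_tetra_mul_tetra hr xa ad bd xb k d
      simp only [hsw] at h2
      by_cases h3 : ρ k e = 0
      · by_cases h4 : k = d
        · subst h4; simp [h3]
        · simp [h3, h4]
      obtain ⟨h4, h5⟩ := h0 k e h3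
      have h6 : (if k = d then ρ d e else 0) = (if (d : ℕ) = k ∧ Adm r xa ad k ∧ Adm r xb bd k
          then 1 else 0) * ρ k e := by
        by_cases h7 : k = d
        · subst h7; simp [adm_comm₂₃.1 h4, adm_comm₂₃.1 h5]
        · simp [h7, Fin.val_inj, Ne.symm h7]
      rw [h6, ← h2, Finset.sum_mul, Finset.sum_mul]
      refine Finset.sum_congr rfl fun z _ => ?_
      rw [thetaInv_comm₂₃ r xa ad, thetaInv_comm₂₃ r xb bd]
      ring
    rw [Finset.sum_congr rfl fun k _ => h1 k]
    simp
  simp only [hρ, Finset.mul_sum]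
  rw [Finset.sum_comm]
  have h1 : ∀ z ∈ Finset.range (r - 1), ∑ k : Fin (r - 1), dimq r k * thetaInv r xa k ae *
      thetaInv r xb k be * tetra r xa xb k be ae y * (dimq r z * thetaInv r z xa xb *
      thetaInv r z ad bd * tetra r xa xb d bd ad z * (tetra r xa xb k be ae z * κ z)) =
      if z = y then tetra r xa xb d bd ad y * (thetaInv r ad bd y * κ y / thetaInv r ae be y)
      else 0 := by
    intro z _
    by_cases h3 : Adm r ae be z
    · have h2 := sum_tetra_mul_tetra hr xa xb be ae z y
      simp only [hsw'] at h2
      rw [Finset.sum_range fun k => dimq r k * thetaInv r k xa ae * thetaInv r k xb be *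
        tetra r xa xb k be ae y * tetra r xa xb k be ae z] at h2
      have h4 := thetaInv_ne_zero hr h3
      have h5 : ∑ k : Fin (r - 1), dimq r k * thetaInv r xa k ae *
          thetaInv r xb k be * tetra r xa xb k be ae y * (dimq r z * thetaInv r z xa xb *
          thetaInv r z ad bd * tetra r xa xb d bd ad z * (tetra r xa xb k be ae z * κ z)) =
          (if y = z ∧ Adm r xa xb z ∧ Adm r ae be z then 1 else 0) *
            (tetra r xa xb d bd ad z * (thetaInv r ad bd z * κ z / thetaInv r ae be z)) := by
        rw [← h2, Finset.sum_mul, Finset.sum_mul]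
        refine Finset.sum_congr rfl fun k _ => ?_
        rw [thetaInv_comm₁₂ r k xa, thetaInv_comm₁₂ r k xb, thetaInv_comm₁₂ r z xa,
          thetaInv_comm₂₃ r xa z, thetaInv_comm₁₂ r z ad, thetaInv_comm₂₃ r ad z]
        field_simp
      rw [h5]
      by_cases h6 : z = y
      · subst h6
        by_cases h7 : Adm r xa xb z
        · simp [h7, h3]
        · rw [tetra_of_not fun h' => h7 h'.1]; simp
      · simp [h6, Ne.symm h6]
    · rw [Finset.sum_eq_zero fun k _ => by
        rw [tetra_of_not (A := xa) (B := xb) (C := k) (Z := z) (X := be)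
          fun h' => h3 (adm_comm₁₂.1 h'.2.2.2)]; ring]
      split_ifs with h6
      · subst h6; rw [thetaInv_of_not_adm h3]; simp
      · rfl
  rw [Finset.sum_congr rfl h1, Finset.sum_ite_eq']
  split_ifs with h3
  · rfl
  · rw [tetra_of_not, zero_mul]
    intro h'
    exact h3 (Finset.mem_range.2 (Adm.lt hr (adm_comm₁₂.1 (adm_comm₂₃.1 h'.1))))

variable {W : Type*} [DecidableEq W] {r : ℕ}

/-- The weight of the cone over `s` as a function of spins on the vertices. -/
abbrev spinWeight (r : ℕ) (c : Finset W → ℕ) (s : Finset W) (x : W → Fin (r - 1)) : ℂ :=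
  coneWeight r (fun w => (x w : ℕ)) c s

/-- The vertices of a complex. -/
def verts (F : Finset (Finset W)) : Finset W := F.biUnion id

theorem mem_verts {F : Finset (Finset W)} {w : W} : w ∈ verts F ↔ ∃ s ∈ F, w ∈ s := by
  simp [verts]

theorem subset_verts {F : Finset (Finset W)} {s : Finset W} (h : s ∈ F) : s ⊆ verts F :=
  fun _ hw => mem_verts.2 ⟨s, h, hw⟩

/-- The sum over the spins of the vertices outside `T` of the weights of the faces of the cone over
`F` not lying over `T`. -/
def vertexSum (r : ℕ) (F : Finset (Finset W)) (T : Finset W) (c : Finset W → ℕ)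
    (x : W → Fin (r - 1)) : ℂ :=
  partialSum (verts F \ T) (fun x => ∏ s ∈ F with ¬s ⊆ T, spinWeight r c s x) x

/-- The vertex sum relative to `T` is the weight of the cone over `T` up to a factor depending only
on the labels of the base. -/
def IsProportional (r : ℕ) (F : Finset (Finset W)) (T : Finset W) : Prop :=
  ∃ κ : (Finset W → ℕ) → ℂ, ∀ c x, vertexSum r F T c x = spinWeight r c T x * κ c

theorem spinWeight_congr {c c' : Finset W → ℕ} {s : Finset W} {x x' : W → Fin (r - 1)}
    (hx : ∀ w ∈ s, x w = x' w) (hc : ∀ e ⊆ s, c e = c' e) :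
    spinWeight r c s x = spinWeight r c' s x' :=
  coneWeight_congr (fun w hw => congrArg Fin.val (hx w hw)) hc

theorem prod_powerset_pair_coneWeight (x : W → ℕ) (c : Finset W → ℕ) {a b d : W} (hab : a ≠ b)
    (had : a ≠ d) (hbd : b ≠ d) : ∏ α ∈ ({a, b} : Finset W).powerset, coneWeight r x c (insert d α) =
      dimq r (x d) * thetaInv r (x a) (x d) (c {a, d}) * thetaInv r (x b) (x d) (c {b, d}) *
        tetra r (x a) (x b) (x d) (c {b, d}) (c {a, d}) (c {a, b}) := by
  have h1 : insert d ({a} : Finset W) = {a, d} := Finset.pair_comm d a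
  have h2 : insert d ({b} : Finset W) = {b, d} := Finset.pair_comm d b
  have h3 : insert d ({a, b} : Finset W) = {a, b, d} := by
    ext w; simp only [Finset.mem_insert, Finset.mem_singleton]; tauto
  have h4 : ∏ α ∈ ({a, b} : Finset W).powerset, coneWeight r x c (insert d α) =
      coneWeight r x c (insert d ∅) * coneWeight r x c (insert d {b}) *
        (coneWeight r x c (insert d {a}) * coneWeight r x c (insert d {a, b})) := by
    rw [Finset.prod_powerset_insert (by simpa using hab), ← insert_empty_eq b,
      Finset.prod_powerset_insert (by simp), Finset.prod_powerset_insert (by simp)]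
    simp
  rw [h4, h1, h2, h3, insert_empty_eq, coneWeight_singleton, coneWeight_pair r x c had,
    coneWeight_pair r x c hbd, coneWeight_triple r x c hab had hbd]
  ring

/-- Part of the vertex sum common to two adjacent triangles. -/
def sharedSum (r : ℕ) (F : Finset (Finset W)) (T T' : Finset W) (c : Finset W → ℕ)
    (x : W → Fin (r - 1)) : ℂ :=
  partialSum (verts F \ (T ∪ T')) (fun x => ∏ s ∈ F with ¬s ⊆ T ∧ ¬s ⊆ T', spinWeight r c s x) x

theorem sharedSum_comm (F : Finset (Finset W)) (T T' : Finset W) (c : Finset W → ℕ)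
    (x : W → Fin (r - 1)) : sharedSum r F T T' c x = sharedSum r F T' T c x := by
  rw [sharedSum, sharedSum, Finset.union_comm]
  simp only [and_comm]

theorem vertexSum_eq_sum_sharedSum {F : Finset (Finset W)} (hF : IsComplex F) {a b d e : W}
    (hab : a ≠ b) (had : a ≠ d) (hbd : b ≠ d) (hde : d ≠ e) (hd : insert d {a, b} ∈ F)
    (c : Finset W → ℕ) (x : W → Fin (r - 1)) :
    vertexSum r F (insert e {a, b}) c x = ∑ k : Fin (r - 1), dimq r k *
      thetaInv r (x a) k (c {a, d}) * thetaInv r (x b) k (c {b, d}) *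
        tetra r (x a) (x b) k (c {b, d}) (c {a, d}) (c {a, b}) *
      sharedSum r F (insert e {a, b}) (insert d {a, b}) c (Function.update x d k) := by
  have hdn : d ∉ (insert e {a, b} : Finset W) := by simp [hde, had.symm, hbd.symm]
  have h1 : verts F \ insert e {a, b} =
      insert d (verts F \ (insert e {a, b} ∪ insert d {a, b})) := by
    have h2 := subset_verts hd (Finset.mem_insert_self _ _)
    ext w
    by_cases hw : w = d
    · subst hw; simp only [Finset.mem_sdiff, Finset.mem_insert_self, h2, hdn]; simp
    · simp only [Finset.mem_sdiff, Finset.mem_insert, Finset.mem_union, hw, false_or]; tauto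
  have h3 : (F.filter fun s => ¬s ⊆ insert e {a, b}) =
      (({a, b} : Finset W).powerset.image (insert d)) ∪
        F.filter fun s => ¬s ⊆ insert e {a, b} ∧ ¬s ⊆ insert d {a, b} := by
    ext s
    simp only [Finset.mem_filter, Finset.mem_union, Finset.mem_image, Finset.mem_powerset]
    constructor
    · rintro ⟨h4, h5⟩
      by_cases h6 : s ⊆ insert d {a, b}
      · refine Or.inl ⟨s.erase d, ?_, Finset.insert_erase ?_⟩
        · exact Finset.subset_insert_iff.1 h6
        · by_contra h7
          refine h5 fun w hw => ?_
          rcases Finset.mem_insert.1 (h6 hw) with rfl | h8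
          · exact absurd hw h7
          · exact Finset.mem_insert_of_mem h8
      · exact Or.inr ⟨h4, h5, h6⟩
    · rintro (⟨α, h4, rfl⟩ | h4)
      · exact ⟨hF.down hd (Finset.insert_subset_insert _ h4) (Finset.insert_nonempty _ _),
          fun h5 => hdn (h5 (Finset.mem_insert_self _ _))⟩
      · exact ⟨h4.1, h4.2.1⟩
  have h4 : Disjoint (({a, b} : Finset W).powerset.image (insert d))
      (F.filter fun s => ¬s ⊆ insert e {a, b} ∧ ¬s ⊆ insert d {a, b}) := by
    rw [Finset.disjoint_left]
    intro s hs hs'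
    simp only [Finset.mem_filter, Finset.mem_image, Finset.mem_powerset] at hs hs'
    obtain ⟨α, h5, rfl⟩ := hs
    exact hs'.2.2 (Finset.insert_subset_insert _ h5)
  rw [vertexSum, h1, partialSum_insert' (by simp)]
  refine Finset.sum_congr rfl fun k _ => ?_
  rw [h3]
  simp only [Finset.prod_union h4]
  rw [partialSum_mul_left (g := fun x => ∏ s ∈ ({a, b} : Finset W).powerset.image (insert d),
    spinWeight r c s x), sharedSum]
  · congr 1
    rw [Finset.prod_image, prod_powerset_pair_coneWeight _ _ hab had hbd]
    · simp [had, hbd]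
    · intro α hα α' hα' h5
      have hn : ∀ α ∈ ((({a, b} : Finset W).powerset : Finset (Finset W)) : Set (Finset W)),
          d ∉ α := fun α hα hd' => by
        have := Finset.mem_powerset.1 hα hd'
        simp [had.symm, hbd.symm] at this
      rw [← Finset.erase_insert (hn α hα), ← Finset.erase_insert (hn α' hα')]
      exact congrArg (fun s => Finset.erase s d) h5
  · intro x' hx'
    refine Finset.prod_congr rfl fun s hs => spinWeight_congr (fun w hw => hx' w ?_) fun _ _ => rfl
    obtain ⟨α, h5, rfl⟩ := Finset.mem_image.1 hs
    have := Finset.insert_subset_insert d (Finset.mem_powerset.1 h5) hw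
    simp only [Finset.mem_sdiff, Finset.mem_union, not_and, not_not]
    exact fun _ => Or.inr this

theorem eq_or_eq_of_mem_apexes {F : Finset (Finset W)} {σ : Finset W}
    (h2 : (apexes F σ).ncard = 2) {d e w : W} (hd : d ∈ apexes F σ) (he : e ∈ apexes F σ)
    (hde : d ≠ e) (hw : w ∈ apexes F σ) : w = d ∨ w = e := by
  have hfin : (apexes F σ).Finite := Set.finite_of_ncard_ne_zero (by rw [h2]; norm_num)
  have h3 : ({d, e} : Set W) = apexes F σ := by
    refine Set.eq_of_subset_of_ncard_le ?_ ?_ hfin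
    · rintro z (rfl | rfl); exacts [hd, he]
    · rw [h2, Set.ncard_pair hde]
  rw [← h3] at hw
  exact hw

theorem exists_ne_mem_apexes {F : Finset (Finset W)} {σ : Finset W}
    (h2 : (apexes F σ).ncard = 2) (d : W) : ∃ e ∈ apexes F σ, e ≠ d :=
  Set.exists_ne_of_one_lt_ncard (by rw [h2]; norm_num) d

theorem adm_of_sharedSum_ne_zero {F : Finset (Finset W)} (hF : IsComplex F)
    (hF2 : ∀ e ∈ F, e.card = 2 → (apexes F e).ncard = 2) {a b d : W} {T : Finset W}
    (had : a ≠ d) (hd : insert d {a, b} ∈ F) (hdT : d ∉ T) {c : Finset W → ℕ}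
    {x : W → Fin (r - 1)} (h : sharedSum r F T (insert d {a, b}) c x ≠ 0) :
    Adm r (x a) (x d) (c {a, d}) := by
  have hE : ({a, d} : Finset W) ∈ F :=
    hF.down hd (by intro z; simp only [Finset.mem_insert, Finset.mem_singleton]; tauto) (by simp)
  obtain ⟨g, ⟨hg, hgF⟩, hgb⟩ := exists_ne_mem_apexes (hF2 _ hE (Finset.card_pair had)) b
  simp only [Finset.mem_insert, Finset.mem_singleton, not_or] at hg
  obtain ⟨y, -, hy⟩ := Finset.exists_ne_zero_of_sum_ne_zero h
  have h1 := Finset.prod_ne_zero_iff.1 hy (insert g {a, d}) (by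
    refine Finset.mem_filter.2 ⟨hgF, fun h' => hdT (h' (by simp)), fun h' => ?_⟩
    have := h' (Finset.mem_insert_self _ _)
    simp only [Finset.mem_insert, Finset.mem_singleton] at this
    tauto)
  rw [spinWeight, coneWeight_triple _ _ _ hg.1 hg.2 had] at h1
  have h2 := (adm_of_tetra_ne_zero h1).2.2.1
  have h3 : ∀ w ∈ insert d ({a, b} : Finset W), Function.updateFinset x
      (verts F \ (T ∪ insert d {a, b})) y w = x w := by
    intro w hw
    have : w ∉ verts F \ (T ∪ insert d {a, b}) := fun h' =>
      (Finset.mem_sdiff.1 h').2 (Finset.mem_union_right _ hw)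
    exact dif_neg this
  rwa [h3 a (by simp), h3 d (by simp)] at h2

theorem IsProportional.of_adjacent (hr : 2 ≤ r) {F : Finset (Finset W)} (hF : IsComplex F)
    (hF3 : ∀ s ∈ F, s.card ≤ 3) (hF2 : ∀ e ∈ F, e.card = 2 → (apexes F e).ncard = 2)
    {σ : Finset W} (hσ : σ.card = 2) {d e : W} (hd : d ∈ apexes F σ) (he : e ∈ apexes F σ)
    (hde : d ≠ e) (h : IsProportional r F (insert e σ)) : IsProportional r F (insert d σ) := by
  obtain ⟨a, b, hab, rfl⟩ := Finset.card_eq_two.1 hσ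
  have hσF : ({a, b} : Finset W) ∈ F := hF.down hd.2 (Finset.subset_insert _ _) (by simp)
  obtain ⟨hdσ, hdF⟩ := id hd
  obtain ⟨heσ, heF⟩ := id he
  simp only [Finset.mem_insert, Finset.mem_singleton, not_or] at hdσ heσ
  have had : a ≠ d := Ne.symm hdσ.1
  have hbd : b ≠ d := Ne.symm hdσ.2
  have hae : a ≠ e := Ne.symm heσ.1
  have hbe : b ≠ e := Ne.symm heσ.2
  obtain ⟨κ, hκ⟩ := h
  have htri : ∀ (f : W), a ≠ f → b ≠ f → ∀ (c : Finset W → ℕ) (x : W → Fin (r - 1)),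
      spinWeight r c (insert f {a, b}) x =
        tetra r (x a) (x b) (x f) (c {b, f}) (c {a, f}) (c {a, b}) := by
    intro f haf hbf c x
    have : insert f ({a, b} : Finset W) = {a, b, f} := by
      ext w; simp only [Finset.mem_insert, Finset.mem_singleton]; tauto
    rw [this, spinWeight, coneWeight_triple _ _ _ hab haf hbf]
  refine ⟨fun c => thetaInv r (c {a, d}) (c {b, d}) (c {a, b}) * κ c /
    thetaInv r (c {a, e}) (c {b, e}) (c {a, b}), fun c x => ?_⟩
  have hshared : ∀ z x, sharedSum r F (insert e {a, b}) (insert d {a, b})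
      (Function.update c {a, b} z) x =
        sharedSum r F (insert e {a, b}) (insert d {a, b}) c x := by
    intro z x
    refine partialSum_congr fun x' _ => Finset.prod_congr rfl fun s hs => ?_
    refine spinWeight_congr (fun _ _ => rfl) fun f hf => Function.update_of_ne ?_ _ _
    rintro rfl
    obtain ⟨h1, h2, h3⟩ := Finset.mem_filter.1 hs
    have h4 : ¬s ⊆ {a, b} := fun h' => h2 (h'.trans (Finset.subset_insert _ _))
    obtain ⟨w, hw, hwσ⟩ := Finset.not_subset.1 h4
    have h5 : insert w {a, b} = s := by
      refine Finset.eq_of_subset_of_card_le (Finset.insert_subset hw hf) ?_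
      rw [Finset.card_insert_of_notMem hwσ, Finset.card_pair hab]
      exact hF3 s h1
    rcases eq_or_eq_of_mem_apexes (hF2 _ hσF hσ) hd he hde (w := w) ⟨hwσ, h5 ▸ h1⟩ with rfl | rfl
    · exact h3 h5.ge
    · exact h2 h5.ge
  have hne : ∀ w f : W, a ≠ f → b ≠ f → ({w, f} : Finset W) ≠ {a, b} := by
    intro w f haf hbf h'
    have : f ∈ ({a, b} : Finset W) := h' ▸ by simp
    simp only [Finset.mem_insert, Finset.mem_singleton] at this
    tauto
  have key := sum_adjacent hr (x a) (x b) (c {a, d}) (c {b, d}) (c {a, e}) (c {b, e}) (c {a, b})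
    (fun k l => sharedSum r F (insert e {a, b}) (insert d {a, b}) c
      (Function.update (Function.update x d k) e l))
    (fun z => κ (Function.update c {a, b} z)) ?_ ?_ (x d)
  · rw [vertexSum_eq_sum_sharedSum hF hab hae hbe hde.symm heF, htri d had hbd]
    simp only [Function.update_eq_self] at key
    simp only [sharedSum_comm F (insert d {a, b})]
    exact key
  · intro z l
    have h1 := hκ (Function.update c {a, b} z) (Function.update x e l)
    rw [vertexSum_eq_sum_sharedSum hF hab had hbd hde hdF, htri e hae hbe] at h1
    simp only [hshared, Function.update_of_ne (hne _ d had hbd),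
      Function.update_of_ne (hne _ e hae hbe), Function.update_self, Function.update_of_ne hae,
      Function.update_of_ne hbe] at h1
    simpa only [Function.update_comm hde] using h1
  · intro k l h1
    have hdT : d ∉ (insert e {a, b} : Finset W) := by
      simp [hde, hdσ.1, hdσ.2]
    have h2 := adm_of_sharedSum_ne_zero hF hF2 had hdF hdT h1
    rw [Finset.pair_comm a b] at h1 hdF hdT
    have h3 := adm_of_sharedSum_ne_zero hF hF2 hbd hdF hdT h1
    simp only [Function.update_of_ne hae, Function.update_of_ne hbe, Function.update_of_ne had,
      Function.update_of_ne hbd, Function.update_of_ne hde, Function.update_self] at h2 h3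
    exact ⟨h2, h3⟩

end VertexSums

/-! ### Local sums -/

section LocalSums

variable {W : Type*} [DecidableEq W] {r : ℕ}

theorem prod_ssubsets_insert {M : Type*} [CommMonoid M] {p : W} {s : Finset W} (hp : p ∉ s)
    (f : Finset W → M) : ∏ α ∈ (insert p s).ssubsets, f α =
      (∏ α ∈ s.powerset, f α) * ∏ α ∈ s.ssubsets, f (insert p α) := by
  have h1 : (insert p s).ssubsets = s.powerset ∪ s.ssubsets.image (insert p) := by
    ext α
    simp only [Finset.mem_ssubsets, Finset.mem_union, Finset.mem_powerset, Finset.mem_image]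
    constructor
    · intro h
      by_cases hpα : p ∈ α
      · refine Or.inr ⟨α.erase p, ?_, Finset.insert_erase hpα⟩
        refine ⟨Finset.subset_insert_iff.1 h.1, fun h' => h.2 ?_⟩
        rw [← Finset.insert_erase hpα]
        exact Finset.insert_subset_insert _ h'
      · exact Or.inl ((Finset.subset_insert_iff_of_notMem hpα).1 h.1)
    · rintro (h | ⟨β, h, rfl⟩)
      · exact ⟨h.trans (Finset.subset_insert _ _), fun h' => hp (h (h' (Finset.mem_insert_self _ _)))⟩
      · refine ⟨Finset.insert_subset_insert _ h.1, fun h' => h.2 ?_⟩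
        exact (Finset.insert_subset_insert_iff hp).1 h'
  have hn : ∀ α ∈ s.ssubsets, p ∉ α := fun α hα hpα => hp ((Finset.mem_ssubsets.1 hα).1 hpα)
  rw [h1, Finset.prod_union, Finset.prod_image]
  · intro α hα α' hα' h
    rw [← Finset.erase_insert (hn α hα), ← Finset.erase_insert (hn α' hα')]
    exact congrArg (fun s => Finset.erase s p) h
  · rw [Finset.disjoint_left]
    intro α hα hα'
    obtain ⟨β, -, rfl⟩ := Finset.mem_image.1 hα'
    exact hp (Finset.mem_powerset.1 hα (Finset.mem_insert_self _ _))

theorem prod_ssubsets_singleton {M : Type*} [CommMonoid M] (p : W) (f : Finset W → M) :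
    ∏ α ∈ ({p} : Finset W).ssubsets, f α = f ∅ := by
  rw [← insert_empty_eq, prod_ssubsets_insert (by simp)]
  simp [Finset.ssubsets]

theorem prod_ssubsets_pair {M : Type*} [CommMonoid M] {p q : W} (h : p ≠ q) (f : Finset W → M) :
    ∏ α ∈ ({p, q} : Finset W).ssubsets, f α = f ∅ * f {p} * f {q} := by
  rw [prod_ssubsets_insert (by simpa using h), prod_ssubsets_singleton, ← insert_empty_eq q,
    Finset.prod_powerset_insert (by simp)]
  simp [mul_right_comm]

theorem prod_ssubsets_triple {M : Type*} [CommMonoid M] {p q t : W} (hpq : p ≠ q) (hpt : p ≠ t)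
    (hqt : q ≠ t) (f : Finset W → M) : ∏ α ∈ ({p, q, t} : Finset W).ssubsets, f α =
      f ∅ * f {p} * f {q} * f {t} * f {p, q} * f {q, t} * f {p, t} := by
  rw [prod_ssubsets_insert (by simp [hpq, hpt]), prod_ssubsets_pair hqt,
    Finset.prod_powerset_insert (by simpa using hqt), ← insert_empty_eq t,
    Finset.prod_powerset_insert (by simp), Finset.prod_powerset_insert (by simp)]
  simp only [Finset.powerset_empty, Finset.prod_singleton, insert_empty_eq]
  ac_rfl

/-- The evaluation of the cone over a triangle with its interior replaced by a cone. -/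
theorem sum_prod_ssubsets_triple (hr : 2 ≤ r) {p q t a : W} (hpq : p ≠ q) (hpt : p ≠ t)
    (hqt : q ≠ t) (ha : a ∉ ({p, q, t} : Finset W)) (c : Finset W → ℕ) (x : W → Fin (r - 1)) :
    ∑ k, ∏ α ∈ ({p, q, t} : Finset W).ssubsets,
        spinWeight r c (insert a α) (Function.update x a k) =
      thetaInv r (c {p, q}) (c {q, t}) (c {p, t}) *
        tetra r (c {a, p}) (c {a, q}) (c {a, t}) (c {q, t}) (c {p, t}) (c {p, q}) *
          spinWeight r c {p, q, t} x := by
  simp only [Finset.mem_insert, Finset.mem_singleton, not_or] at ha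
  obtain ⟨hap, haq, hat⟩ := ha
  simp only [prod_ssubsets_triple hpq hpt hqt, spinWeight, insert_empty_eq, coneWeight_singleton,
    coneWeight_pair r _ c hap, coneWeight_pair r _ c haq, coneWeight_pair r _ c hat,
    coneWeight_triple r _ c hap haq hpq, coneWeight_triple r _ c haq hat hqt,
    coneWeight_triple r _ c hap hat hpt, coneWeight_triple r _ c hpq hpt hqt,
    Function.update_self, Function.update_of_ne (Ne.symm hap),
    Function.update_of_ne (Ne.symm haq), Function.update_of_ne (Ne.symm hat)]
  rw [mul_right_comm, ← pentagon hr, Finset.sum_range]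

/-- The evaluation of the cone over two triangles with a common edge after subdividing this
edge. -/
theorem sum_prod_edge (hr : 2 ≤ r) {p q t u a : W} (hpq : p ≠ q) (hpt : p ≠ t) (hqt : q ≠ t)
    (hpu : p ≠ u) (hqu : q ≠ u) (htu : t ≠ u) (hap : a ≠ p) (haq : a ≠ q) (hat : a ≠ t) (hau : a ≠ u)
    (c : Finset W → ℕ) (x : W → Fin (r - 1)) :
    ∑ k, ∏ τ ∈ {∅, {t}, {u}}, ∏ α ∈ ({p, q} : Finset W).ssubsets,
        spinWeight r c (insert a (τ ∪ α)) (Function.update x a k) =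
      ∑ z ∈ Finset.range (r - 1), edgeCoeff r (c {a, p}) (c {a, q}) (c {a, t}) (c {a, u})
        (c {p, t}) (c {q, t}) (c {p, u}) (c {q, u}) z *
          ∏ τ ∈ {∅, {t}, {u}}, spinWeight r (Function.update c {p, q} z) (τ ∪ {p, q}) x := by
  have h1 : ∀ g : Finset W → ℂ, ∏ τ ∈ {∅, {t}, {u}}, g τ = g ∅ * (g {t} * g {u}) := by
    intro g
    rw [Finset.prod_insert, Finset.prod_insert, Finset.prod_singleton]
    · simpa using htu
    · simp [eq_comm (a := (∅ : Finset W))]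
  have h2 : ∀ w, ({w} ∪ {p, q} : Finset W) = {p, q, w} := fun w => by
    ext z; simp only [Finset.mem_union, Finset.mem_insert, Finset.mem_singleton]; tauto
  have h4 : ∀ w z : W, ({w} ∪ {z} : Finset W) = {w, z} := fun _ _ => rfl
  have h3 : ∀ w, p ≠ w → q ≠ w → ({q, w} : Finset W) ≠ {p, q} ∧ ({p, w} : Finset W) ≠ {p, q} := by
    intro w hp hq
    constructor <;> intro h' <;>
    · have : w ∈ ({p, q} : Finset W) := h' ▸ by simp
      simp only [Finset.mem_insert, Finset.mem_singleton] at this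
      tauto
  simp only [h1, prod_ssubsets_pair hpq, spinWeight, Finset.empty_union, Finset.union_empty,
    insert_empty_eq, h2, h4, coneWeight_singleton, coneWeight_pair r _ _ hap,
    coneWeight_pair r _ _ haq, coneWeight_pair r _ _ hat, coneWeight_pair r _ _ hau,
    coneWeight_pair r _ _ hpq, coneWeight_triple r _ _ hpq hpt hqt,
    coneWeight_triple r _ _ hpq hpu hqu, coneWeight_triple r _ _ hat hap hpt.symm,
    coneWeight_triple r _ _ hat haq hqt.symm, coneWeight_triple r _ _ hau hap hpu.symm,
    coneWeight_triple r _ _ hau haq hqu.symm,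
    Function.update_self, Function.update_of_ne (Ne.symm hap),
    Function.update_of_ne (Ne.symm haq), Function.update_of_ne (Ne.symm hat),
    Function.update_of_ne (Ne.symm hau), Function.update_of_ne (h3 t hpt hqt).1,
    Function.update_of_ne (h3 t hpt hqt).2, Function.update_of_ne (h3 u hpu hqu).1,
    Function.update_of_ne (h3 u hpu hqu).2]
  have key := sum_edge_subdivision hr (x p) (x q) (x t) (x u) (c {a, p}) (c {a, q}) (c {a, t})
    (c {a, u}) (c {p, t}) (c {q, t}) (c {p, u}) (c {q, u})
  rw [Finset.sum_range] at key
  rw [Finset.pair_comm t p, Finset.pair_comm t q, Finset.pair_comm u p, Finset.pair_comm u q]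
  simp only [← mul_assoc] at key ⊢
  exact key

end LocalSums

/-! ### Invariance of proportionality under starring -/

section Transfer

variable {W : Type*} [DecidableEq W] {r : ℕ} {F F' : Finset (Finset W)} {A : Finset W} {a : W}

/-- Two labellings of the base agree on the sets not affected by starring `A` at `a`. -/
def AgreeOff (A : Finset W) (a : W) (c c' : Finset W → ℕ) : Prop :=
  ∀ e, ¬A ⊆ e → a ∉ e → c e = c' e

theorem AgreeOff.refl (A : Finset W) (a : W) (c : Finset W → ℕ) : AgreeOff A a c c :=
  fun _ _ _ => rfl

/-- `Q` is, up to a change of labels near `A` and `a`, a combination of values of `P`. -/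
def Expands (A : Finset W) (a : W) (P Q : (Finset W → ℕ) → (W → Fin (r - 1)) → ℂ) : Prop :=
  ∀ c, ∃ (n : ℕ) (g : ℕ → ℂ) (c' : ℕ → Finset W → ℕ), (∀ i, AgreeOff A a (c' i) c) ∧
    ∀ x, Q c x = ∑ i ∈ Finset.range n, g i * P (c' i) x

theorem Expands.of_single {P Q : (Finset W → ℕ) → (W → Fin (r - 1)) → ℂ}
    (h : ∀ c, ∃ (b : ℂ) (c' : Finset W → ℕ), AgreeOff A a c' c ∧ ∀ x, Q c x = b * P c' x) :
    Expands A a P Q := fun c => by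
  obtain ⟨b, c', h1, h2⟩ := h c
  exact ⟨1, fun _ => b, fun _ => c', fun _ => h1, fun x => by simp [h2]⟩

/-- The faces of the link of `A`, including the empty one. -/
def linkFaces (F : Finset (Finset W)) (A : Finset W) : Finset (Finset W) :=
  (F.filter (A ⊆ ·)).image (· \ A)

theorem mem_linkFaces {τ : Finset W} : τ ∈ linkFaces F A ↔ Disjoint τ A ∧ τ ∪ A ∈ F := by
  simp only [linkFaces, Finset.mem_image, Finset.mem_filter]
  constructor
  · rintro ⟨s, ⟨hs, hA⟩, rfl⟩
    exact ⟨Finset.sdiff_disjoint, by rwa [Finset.sdiff_union_of_subset hA]⟩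
  · rintro ⟨h1, h2⟩
    exact ⟨τ ∪ A, ⟨h2, Finset.subset_union_right⟩, Finset.union_sdiff_cancel_right h1⟩

theorem prod_filter_subset (F : Finset (Finset W)) (A : Finset W) (f : Finset W → ℂ) :
    ∏ s ∈ F with A ⊆ s, f s = ∏ τ ∈ linkFaces F A, f (τ ∪ A) := by
  rw [linkFaces, Finset.prod_image]
  · refine Finset.prod_congr rfl fun s hs => ?_
    rw [Finset.sdiff_union_of_subset (Finset.mem_filter.1 hs).2]
  · intro s hs s' hs' h
    rw [← Finset.sdiff_union_of_subset (Finset.mem_filter.1 hs).2,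
      ← Finset.sdiff_union_of_subset (Finset.mem_filter.1 hs').2]
    exact congrArg (· ∪ A) h

namespace IsStarringAt

theorem prod_filter_mem (h : IsStarringAt F F' A a) (f : Finset W → ℂ) :
    ∏ s ∈ F' with a ∈ s, f s = ∏ τ ∈ linkFaces F A, ∏ α ∈ A.ssubsets, f (insert a (τ ∪ α)) := by
  rw [← Finset.prod_product' (f := fun τ α => f (insert a (τ ∪ α)))]
  have hdis : ∀ {τ α : Finset W}, Disjoint τ A → α ⊂ A → (τ ∪ α) \ A = τ ∧ (τ ∪ α) ∩ A = α := by
    intro τ α h1 h2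
    constructor
    · rw [Finset.union_sdiff_distrib, Finset.sdiff_eq_self_of_disjoint h1,
        Finset.sdiff_eq_empty_iff_subset.2 h2.1, Finset.union_empty]
    · rw [Finset.union_inter_distrib_right, Finset.disjoint_iff_inter_eq_empty.1 h1,
        Finset.inter_eq_left.2 h2.1, Finset.empty_union]
  have haτ : ∀ {τ α : Finset W}, τ ∪ A ∈ F → α ⊂ A → a ∉ τ ∪ α := fun h1 h2 h3 =>
    h.notMem h1 (Finset.union_subset_union_right h2.1 h3)
  symm
  refine Finset.prod_bij' (fun z _ => insert a (z.1 ∪ z.2))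
    (fun s _ => (s.erase a \ A, s.erase a ∩ A)) ?_ ?_ ?_ ?_ ?_
  · rintro ⟨τ, α⟩ hz
    obtain ⟨h1, h2⟩ := Finset.mem_product.1 hz
    rw [mem_linkFaces] at h1
    rw [Finset.mem_ssubsets] at h2
    refine Finset.mem_filter.2 ⟨?_, Finset.mem_insert_self _ _⟩
    rw [h.insert_mem (haτ h1.2 h2)]
    constructor
    · intro h3
      refine h2.2 fun w hw => ?_
      rcases Finset.mem_union.1 (h3 hw) with h4 | h4
      · exact absurd hw (Finset.disjoint_left.1 h1.1 h4)
      · exact h4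
    · rw [Finset.union_assoc, Finset.union_eq_right.2 h2.1]; exact h1.2
  · intro s hs
    obtain ⟨h1, h2⟩ := Finset.mem_filter.1 hs
    obtain ⟨σ, h3, rfl, h4, h5⟩ := h.exists_insert h1 h2
    rw [Finset.erase_insert h3, Finset.mem_product, mem_linkFaces, Finset.mem_ssubsets]
    refine ⟨⟨Finset.sdiff_disjoint, by rwa [Finset.sdiff_union_self_eq_union]⟩,
      Finset.inter_subset_right, fun h6 => h4 (h6.trans Finset.inter_subset_left)⟩
  · rintro ⟨τ, α⟩ hz
    obtain ⟨h1, h2⟩ := Finset.mem_product.1 hz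
    rw [mem_linkFaces] at h1
    rw [Finset.mem_ssubsets] at h2
    simp only [Finset.erase_insert (haτ h1.2 h2), hdis h1.1 h2]
  · intro s hs
    simp only [Finset.sdiff_union_inter]
    exact Finset.insert_erase (Finset.mem_filter.1 hs).2
  · intros; rfl

theorem mem_verts (h : IsStarringAt F F' A a) {w : W} (hw : w ∈ verts F') :
    w = a ∨ w ∈ verts F := by
  obtain ⟨s, hs, hws⟩ := TuraevViro.mem_verts.1 hw
  by_cases ha : a ∈ s
  · obtain ⟨σ, h3, rfl, h4, h5⟩ := h.exists_insert hs ha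
    rcases Finset.mem_insert.1 hws with h6 | h6
    · exact Or.inl h6
    · exact Or.inr (subset_verts h5 (Finset.mem_union_left _ h6))
  · exact Or.inr (subset_verts ((h.mem_of_notMem ha).1 hs).1 hws)

theorem notMem_verts (h : IsStarringAt F F' A a) : a ∉ verts F := fun ha => by
  obtain ⟨s, hs, hws⟩ := TuraevViro.mem_verts.1 ha
  exact h.notMem hs hws

theorem mem_verts' (h : IsStarringAt F F' A a) : a ∈ verts F' := by
  obtain ⟨p, hp⟩ := h.complex.nonempty h.mem_face
  exact subset_verts (h.insert_erase_mem h.mem_face subset_rfl hp) (Finset.mem_insert_self _ _)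

/-- The product over the unaffected faces. -/
def keptProd (r : ℕ) (F : Finset (Finset W)) (A T : Finset W) (c : Finset W → ℕ)
    (x : W → Fin (r - 1)) : ℂ :=
  ∏ s ∈ F with ¬A ⊆ s ∧ ¬s ⊆ T, spinWeight r c s x

/-- The contribution of the faces removed by the starring. -/
def removedSum (r : ℕ) (F F' : Finset (Finset W)) (A : Finset W) (c : Finset W → ℕ)
    (x : W → Fin (r - 1)) : ℂ :=
  partialSum (verts F \ verts F') (fun x => ∏ τ ∈ linkFaces F A, spinWeight r c (τ ∪ A) x) x

/-- The contribution of the faces added by the starring. -/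
def addedSum (r : ℕ) (F : Finset (Finset W)) (A : Finset W) (a : W) (c : Finset W → ℕ)
    (x : W → Fin (r - 1)) : ℂ :=
  ∑ k, ∏ τ ∈ linkFaces F A, ∏ α ∈ A.ssubsets,
    spinWeight r c (insert a (τ ∪ α)) (Function.update x a k)

theorem keptProd_congr (h : IsStarringAt F F' A a) {T : Finset W} {c c' : Finset W → ℕ}
    (hc : AgreeOff A a c c') (x : W → Fin (r - 1)) :
    keptProd r F A T c x = keptProd r F A T c' x := by
  refine Finset.prod_congr rfl fun s hs => spinWeight_congr (fun _ _ => rfl) fun e he => ?_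
  obtain ⟨h1, h2, -⟩ := Finset.mem_filter.1 hs
  exact hc e (fun h' => h2 (h'.trans he)) fun h' => h.notMem h1 (he h')

theorem vertexSum_eq_removedSum (h : IsStarringAt F F' A a) {T : Finset W} (hT : T ∈ F)
    (hAT : ¬A ⊆ T) (c : Finset W → ℕ) (x : W → Fin (r - 1)) :
    vertexSum r F T c x = partialSum ((verts F ∩ verts F') \ T)
      (fun x => keptProd r F A T c x * removedSum r F F' A c x) x := by
  have hT' : T ∈ F' := (h.mem_of_notMem (h.notMem hT)).2 ⟨hT, hAT⟩
  have h1 : verts F \ T = (verts F ∩ verts F') \ T ∪ (verts F \ verts F') := by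
    ext w
    have := @subset_verts _ _ _ _ hT' w
    simp only [Finset.mem_sdiff, Finset.mem_union, Finset.mem_inter]
    tauto
  have h2 : Disjoint ((verts F ∩ verts F') \ T) (verts F \ verts F') := by
    rw [Finset.disjoint_left]
    intro w hw hw'
    simp only [Finset.mem_sdiff, Finset.mem_inter] at hw hw'
    tauto
  rw [vertexSum, h1, partialSum_union h2]
  refine partialSum_congr fun x' _ => ?_
  have h3 : ∀ x : W → Fin (r - 1), ∏ s ∈ F with ¬s ⊆ T, spinWeight r c s x =
      keptProd r F A T c x * ∏ τ ∈ linkFaces F A, spinWeight r c (τ ∪ A) x := by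
    intro x
    rw [← prod_filter_subset F A fun s => spinWeight r c s x, keptProd, ← Finset.prod_union]
    · congr 1
      ext s
      simp only [Finset.mem_filter, Finset.mem_union]
      have : A ⊆ s → ¬s ⊆ T := fun h1 h2 => hAT (h1.trans h2)
      tauto
    · rw [Finset.disjoint_left]
      intro s hs hs'
      exact (Finset.mem_filter.1 hs).2.1 (Finset.mem_filter.1 hs').2
  simp only [h3]
  rw [partialSum_mul_left, removedSum]
  intro x'' hx''
  refine Finset.prod_congr rfl fun s hs => spinWeight_congr (fun w hw => hx'' w ?_) fun _ _ => rfl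
  obtain ⟨h4, h5, -⟩ := Finset.mem_filter.1 hs
  have := subset_verts ((h.mem_of_notMem (h.notMem h4)).2 ⟨h4, h5⟩) hw
  exact fun h' => (Finset.mem_sdiff.1 h').2 this

theorem vertexSum_eq_addedSum (h : IsStarringAt F F' A a) {T : Finset W} (hT : T ∈ F)
    (c : Finset W → ℕ) (x : W → Fin (r - 1)) :
    vertexSum r F' T c x = partialSum ((verts F ∩ verts F') \ T)
      (fun x => keptProd r F A T c x * addedSum r F A a c x) x := by
  have haT := h.notMem hT
  have h1 : verts F' \ T = insert a ((verts F ∩ verts F') \ T) := by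
    ext w
    by_cases hw : w = a
    · subst hw; simp [haT, h.mem_verts']
    · have := @mem_verts _ _ _ _ _ _ h w
      simp only [Finset.mem_sdiff, Finset.mem_insert, Finset.mem_inter]
      tauto
  have h2 : a ∉ (verts F ∩ verts F') \ T := fun h' =>
    h.notMem_verts (Finset.mem_inter.1 (Finset.mem_sdiff.1 h').1).1
  rw [vertexSum, h1, partialSum_insert h2]
  refine partialSum_congr fun x' _ => ?_
  rw [addedSum, Finset.mul_sum]
  refine Finset.sum_congr rfl fun k _ => ?_
  have h3 : keptProd r F A T c x' = keptProd r F A T c (Function.update x' a k) :=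
    Finset.prod_congr rfl fun s hs => spinWeight_congr (fun w hw => by
      rw [Function.update_of_ne]
      rintro rfl
      exact h.notMem (Finset.mem_filter.1 hs).1 hw) fun _ _ => rfl
  rw [h3, ← h.prod_filter_mem fun s => spinWeight r c s (Function.update x' a k), keptProd,
    ← Finset.prod_union]
  · congr 1
    ext s
    simp only [Finset.mem_filter, Finset.mem_union]
    by_cases ha : a ∈ s
    · have h4 : s ∉ F := fun h' => h.notMem h' ha
      have h5 : ¬s ⊆ T := fun h' => haT (h' ha)
      tauto
    · rw [h.mem_of_notMem ha]; tauto
  · rw [Finset.disjoint_left]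
    intro s hs hs'
    exact h.notMem (Finset.mem_filter.1 hs).1 (Finset.mem_filter.1 hs').2

theorem spinWeight_agree (h : IsStarringAt F F' A a) {T : Finset W} (hT : T ∈ F) (hAT : ¬A ⊆ T)
    {c c' : Finset W → ℕ} (hc : AgreeOff A a c c') (x : W → Fin (r - 1)) :
    spinWeight r c T x = spinWeight r c' T x :=
  spinWeight_congr (fun _ _ => rfl) fun e he =>
    hc e (fun h' => hAT (h'.trans he)) fun h' => h.notMem hT (he h')

theorem isProportional_of_expands (h : IsStarringAt F F' A a) {T : Finset W} (hT : T ∈ F)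
    (hAT : ¬A ⊆ T) {G G' : Finset (Finset W)} {P Q : (Finset W → ℕ) → (W → Fin (r - 1)) → ℂ}
    (hP : ∀ c x, vertexSum r G T c x = partialSum ((verts F ∩ verts F') \ T)
      (fun x => keptProd r F A T c x * P c x) x)
    (hQ : ∀ c x, vertexSum r G' T c x = partialSum ((verts F ∩ verts F') \ T)
      (fun x => keptProd r F A T c x * Q c x) x)
    (hPQ : Expands A a P Q) (hG : IsProportional r G T) : IsProportional r G' T := by
  obtain ⟨κ, hκ⟩ := hG
  choose n g c' hc' hE using hPQ
  refine ⟨fun c => ∑ i ∈ Finset.range (n c), g c i * κ (c' c i), fun c x => ?_⟩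
  rw [hQ]
  simp only [hE, Finset.mul_sum]
  rw [partialSum_sum]
  refine Finset.sum_congr rfl fun i _ => ?_
  have h1 := hκ (c' c i) x
  rw [hP, h.spinWeight_agree hT hAT (hc' c i)] at h1
  simp only [h.keptProd_congr (hc' c i)] at h1
  rw [show spinWeight r c T x * (g c i * κ (c' c i)) =
    g c i * (spinWeight r c T x * κ (c' c i)) by ring, ← h1, ← partialSum_const_mul]
  exact partialSum_congr fun x' _ => by ring

end IsStarringAt

end Transfer

section Expansions

variable {W : Type*} [DecidableEq W] {r : ℕ} {F F' : Finset (Finset W)} {A : Finset W} {a : W}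

theorem coneWeight_eq_one {x : W → ℕ} {c : Finset W → ℕ} {s : Finset W} (h1 : s.card ≠ 1)
    (h2 : s.card ≠ 2) (h3 : s.card ≠ 3) : coneWeight r x c s = 1 := by
  unfold coneWeight
  rw [← Finset.length_toList] at h1 h2 h3
  generalize s.toList = L at *
  split <;> simp_all

theorem coneWeight_image {X : Type*} [DecidableEq X] {f : X → W} (hf : Function.Injective f)
    (x : W → ℕ) (c : Finset W → ℕ) (s : Finset X) :
    coneWeight r x c (s.image f) = coneWeight r (fun w => x (f w)) (fun e => c (e.image f)) s := by
  have hcard := Finset.card_image_of_injective s hf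
  by_cases h1 : s.card = 1
  · obtain ⟨p, rfl⟩ := Finset.card_eq_one.1 h1
    rw [Finset.image_singleton, coneWeight_singleton, coneWeight_singleton]
  by_cases h2 : s.card = 2
  · obtain ⟨p, q, hpq, rfl⟩ := Finset.card_eq_two.1 h2
    rw [coneWeight_pair _ _ _ hpq, Finset.image_insert, Finset.image_singleton,
      coneWeight_pair _ _ _ (hf.ne hpq)]
  by_cases h3 : s.card = 3
  · obtain ⟨p, q, t, hpq, hpt, hqt, rfl⟩ := Finset.card_eq_three.1 h3
    rw [coneWeight_triple _ _ _ hpq hpt hqt]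
    simp only [Finset.image_insert, Finset.image_singleton]
    rw [coneWeight_triple _ _ _ (hf.ne hpq) (hf.ne hpt) (hf.ne hqt)]
  · rw [coneWeight_eq_one h1 h2 h3, coneWeight_eq_one] <;> rwa [hcard]

theorem image_swap_eq_self {a p : W} {e : Finset W} (ha : a ∉ e) (hp : p ∉ e) :
    e.image (Equiv.swap a p) = e := by
  rw [Finset.image_congr (g := id), Finset.image_id]
  intro w hw
  exact Equiv.swap_apply_of_ne_of_ne (ne_of_mem_of_not_mem hw ha) (ne_of_mem_of_not_mem hw hp)

namespace IsStarringAt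

theorem verts_sdiff_eq_empty (h : IsStarringAt F F' A a) (hA : A.card ≠ 1) :
    verts F \ verts F' = ∅ := by
  rw [Finset.sdiff_eq_empty_iff_subset]
  intro w hw
  obtain ⟨s, hs, hws⟩ := TuraevViro.mem_verts.1 hw
  have h1 : {w} ∈ F := h.complex.down hs (Finset.singleton_subset_iff.2 hws) (by simp)
  refine subset_verts ((h.mem_of_notMem (h.notMem h1)).2 ⟨h1, fun h2 => ?_⟩)
    (Finset.mem_singleton_self w)
  rcases Finset.subset_singleton_iff.1 h2 with h3 | h3
  · exact (h.complex.nonempty h.mem_face).ne_empty h3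
  · exact hA (by rw [h3, Finset.card_singleton])

theorem verts_sdiff_eq_singleton {p : W} (h : IsStarringAt F F' {p} a) :
    verts F \ verts F' = {p} := by
  ext w
  simp only [Finset.mem_sdiff, Finset.mem_singleton]
  constructor
  · rintro ⟨hw, hw'⟩
    by_contra hwp
    obtain ⟨s, hs, hws⟩ := TuraevViro.mem_verts.1 hw
    have h1 : {w} ∈ F := h.complex.down hs (Finset.singleton_subset_iff.2 hws) (by simp)
    refine hw' (subset_verts ((h.mem_of_notMem (h.notMem h1)).2 ⟨h1, ?_⟩)
      (Finset.mem_singleton_self w))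
    simpa using Ne.symm hwp
  · rintro rfl
    refine ⟨subset_verts h.mem_face (Finset.mem_singleton_self _), fun hw => ?_⟩
    obtain ⟨s, hs, hws⟩ := TuraevViro.mem_verts.1 hw
    have h1 : {w} ∈ F' := h.complex'.down hs (Finset.singleton_subset_iff.2 hws) (by simp)
    exact ((h.mem_of_notMem (h.notMem h.mem_face)).1 h1).2 subset_rfl

theorem removedSum_eq (h : IsStarringAt F F' A a) (hA : A.card ≠ 1) (c : Finset W → ℕ)
    (x : W → Fin (r - 1)) :
    removedSum r F F' A c x = ∏ τ ∈ linkFaces F A, spinWeight r c (τ ∪ A) x := by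
  rw [removedSum, h.verts_sdiff_eq_empty hA, partialSum_empty]

/-- Starring a vertex renames it. -/
theorem addedSum_singleton {p : W} (h : IsStarringAt F F' {p} a) (c : Finset W → ℕ)
    (x : W → Fin (r - 1)) :
    addedSum r F {p} a c x =
      removedSum r F F' {p} (fun e => c (e.image (Equiv.swap a p))) x := by
  rw [removedSum, h.verts_sdiff_eq_singleton, partialSum_singleton, addedSum]
  refine Finset.sum_congr rfl fun k _ => Finset.prod_congr rfl fun τ hτ => ?_
  obtain ⟨h1, h2⟩ := mem_linkFaces.1 hτ
  have hp : p ∉ τ := by simpa using h1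
  have ha : a ∉ τ ∪ {p} := h.notMem h2
  have ha' : a ∉ τ := fun h' => ha (Finset.mem_union_left _ h')
  have hfix : ∀ w ∈ τ, Equiv.swap a p w = w := fun w hw =>
    Equiv.swap_apply_of_ne_of_ne (ne_of_mem_of_not_mem hw ha') (ne_of_mem_of_not_mem hw hp)
  have himg : (τ ∪ {p}).image (Equiv.swap a p) = insert a τ := by
    rw [Finset.image_union, Finset.image_singleton, Equiv.swap_apply_right, Finset.union_comm,
      ← Finset.insert_eq, image_swap_eq_self ha' hp]
  rw [prod_ssubsets_singleton, Finset.union_empty, ← himg, spinWeight,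
    coneWeight_image (Equiv.injective _)]
  refine coneWeight_congr (fun w hw => ?_) fun _ _ => rfl
  rcases Finset.mem_union.1 hw with h3 | h3
  · rw [hfix w h3, Function.update_of_ne (ne_of_mem_of_not_mem h3 ha'),
      Function.update_of_ne (ne_of_mem_of_not_mem h3 hp)]
  · rw [Finset.mem_singleton.1 h3, Equiv.swap_apply_right, Function.update_self,
      Function.update_self]

theorem linkFaces_of_card_three (hF3 : ∀ s ∈ F, s.card ≤ 3) (hAF : A ∈ F) (hA : A.card = 3) :
    linkFaces F A = {∅} := by
  ext τ
  rw [mem_linkFaces, Finset.mem_singleton]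
  constructor
  · rintro ⟨h1, h2⟩
    have := hF3 _ h2
    rw [Finset.card_union_of_disjoint h1] at this
    exact Finset.card_eq_zero.1 (by omega)
  · rintro rfl
    exact ⟨Finset.disjoint_empty_left _, by rwa [Finset.empty_union]⟩

theorem linkFaces_of_card_two (hF3 : ∀ s ∈ F, s.card ≤ 3) (hAF : A ∈ F) (hA : A.card = 2)
    {t u : W} (h : apexes F A = {t, u}) : linkFaces F A = {∅, {t}, {u}} := by
  have hmem : ∀ w, {w} ∈ linkFaces F A ↔ w = t ∨ w = u := fun w => by
    have : w ∈ apexes F A ↔ w = t ∨ w = u := by rw [h]; rfl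
    rw [mem_linkFaces, ← this, Finset.disjoint_singleton_left, ← Finset.insert_eq]
    rfl
  ext τ
  simp only [Finset.mem_insert, Finset.mem_singleton]
  constructor
  · intro hτ
    obtain ⟨h1, h2⟩ := mem_linkFaces.1 hτ
    have := hF3 _ h2
    rw [Finset.card_union_of_disjoint h1] at this
    rcases (show τ.card = 0 ∨ τ.card = 1 by omega) with h3 | h3
    · exact Or.inl (Finset.card_eq_zero.1 h3)
    · obtain ⟨w, rfl⟩ := Finset.card_eq_one.1 h3
      rcases (hmem w).1 hτ with rfl | rfl <;> simp
  · rintro (rfl | rfl | rfl)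
    · exact mem_linkFaces.2 ⟨Finset.disjoint_empty_left _, by rwa [Finset.empty_union]⟩
    · exact (hmem _).2 (Or.inl rfl)
    · exact (hmem _).2 (Or.inr rfl)

/-- The labelling giving the new edge from `a` to `q` the label `0`. -/
def collapse (a q : W) (c : Finset W → ℕ) (e : Finset W) : ℕ :=
  if a ∈ e then if e = {a, q} then 0 else c (insert q (e.erase a)) else c e

theorem agreeOff_collapse (A : Finset W) (a q : W) (c : Finset W → ℕ) :
    AgreeOff A a (collapse a q c) c := fun e _ he => by rw [collapse, if_neg he]

theorem collapse_self (a q : W) (c : Finset W → ℕ) : collapse a q c {a, q} = 0 := by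
  simp [collapse]

theorem collapse_pair {a q w : W} (haw : a ≠ w) (hqw : q ≠ w) (c : Finset W → ℕ) :
    collapse a q c {a, w} = c {q, w} := by
  rw [collapse, if_pos (by simp), if_neg, Finset.erase_insert (by simpa using haw)]
  intro h
  have : w ∈ ({a, q} : Finset W) := h ▸ by simp
  simp only [Finset.mem_insert, Finset.mem_singleton] at this
  tauto

theorem expands_card_one (h : IsStarringAt F F' A a) (hA : A.card = 1) :
    Expands A a (removedSum r F F' A) (addedSum r F A a) ∧
      Expands A a (addedSum r F A a) (removedSum r F F' A) := by
  obtain ⟨p, rfl⟩ := Finset.card_eq_one.1 hA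
  have hagree : ∀ c : Finset W → ℕ,
      AgreeOff {p} a (fun e => c (e.image (Equiv.swap a p))) c := by
    intro c e he hae
    have hpe : p ∉ e := by simpa using he
    simp only [image_swap_eq_self hae hpe]
  refine ⟨Expands.of_single fun c => ⟨1, _, hagree c, fun x => ?_⟩,
    Expands.of_single fun c => ⟨1, _, hagree c, fun x => ?_⟩⟩
  · rw [one_mul, h.addedSum_singleton]
  · rw [one_mul, h.addedSum_singleton]
    have hinv : ∀ e : Finset W, (e.image (Equiv.swap a p)).image (Equiv.swap a p) = e :=
      fun e => by
        rw [Finset.image_image, Finset.image_congr (g := id) fun w _ => by simp, Finset.image_id]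
    simp only [hinv]

theorem expands_card_two (hr : 2 ≤ r) (h : IsStarringAt F F' A a) (hF3 : ∀ s ∈ F, s.card ≤ 3)
    (hF2 : ∀ e ∈ F, e.card = 2 → (apexes F e).ncard = 2) (hA : A.card = 2) :
    Expands A a (removedSum r F F' A) (addedSum r F A a) ∧
      Expands A a (addedSum r F A a) (removedSum r F F' A) := by
  obtain ⟨t, u, htu, hap⟩ := Set.ncard_eq_two.1 (hF2 A h.mem_face hA)
  have hlk := linkFaces_of_card_two hF3 h.mem_face hA hap
  have htA : t ∈ apexes F A := hap ▸ by simp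
  have huA : u ∈ apexes F A := hap ▸ by simp
  have hat := h.notMem htA.2
  have hau := h.notMem huA.2
  obtain ⟨p, q, hpq, rfl⟩ := Finset.card_eq_two.1 hA
  have htA' := htA.1
  have huA' := huA.1
  simp only [Finset.mem_insert, Finset.mem_singleton, not_or] at hat hau htA' huA'
  have hexp : ∀ (c : Finset W → ℕ) (x : W → Fin (r - 1)), addedSum r F {p, q} a c x =
      ∑ z ∈ Finset.range (r - 1), edgeCoeff r (c {a, p}) (c {a, q}) (c {a, t}) (c {a, u})
        (c {p, t}) (c {q, t}) (c {p, u}) (c {q, u}) z *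
          removedSum r F F' {p, q} (Function.update c {p, q} z) x := by
    intro c x
    rw [addedSum, hlk, sum_prod_edge hr hpq (Ne.symm htA'.1) (Ne.symm htA'.2) (Ne.symm huA'.1)
      (Ne.symm huA'.2) htu hat.2.1 hat.2.2 hat.1 hau.1]
    simp only [h.removedSum_eq (by omega : ({p, q} : Finset W).card ≠ 1), hlk]
  refine ⟨fun c => ⟨r - 1, _, fun z => Function.update c {p, q} z, fun z e he _ => ?_, hexp c⟩,
    Expands.of_single fun c => ?_⟩
  · exact Function.update_of_ne (fun h' => he h'.ge) _ _
  by_cases hadm : Adm r (c {p, t}) (c {q, t}) (c {p, q}) ∧ Adm r (c {p, u}) (c {q, u}) (c {p, q})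
  · refine ⟨1, collapse a q c, agreeOff_collapse _ _ _ _, fun x => ?_⟩
    have hne : ∀ w z, a ≠ w → a ≠ z → collapse a q c {w, z} = c {w, z} := by
      intro w z hw hz
      rw [collapse, if_neg (by simp [hw, hz])]
    rw [one_mul, hexp, collapse_self, collapse_pair hat.2.1 hpq.symm,
      collapse_pair hat.1 (Ne.symm htA'.2), collapse_pair hau.1 (Ne.symm huA'.2),
      hne p t hat.2.1 hat.1, hne q t hat.2.2 hat.1, hne p u hat.2.1 hau.1, hne q u hat.2.2 hau.1,
      Finset.pair_comm q p]
    have hlt : c {p, q} ∈ Finset.range (r - 1) :=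
      Finset.mem_range.2 (Adm.lt hr (adm_comm₁₂.1 (adm_comm₂₃.1 hadm.1)))
    simp only [edgeCoeff_zero hr hadm.1 hadm.2, ite_mul, one_mul, zero_mul]
    rw [Finset.sum_ite_eq', if_pos hlt, h.removedSum_eq (by omega), h.removedSum_eq (by omega)]
    refine Finset.prod_congr rfl fun τ hτ => spinWeight_congr (fun _ _ => rfl) fun e he => ?_
    have hae : a ∉ e := fun h' => h.notMem (mem_linkFaces.1 hτ).2 (he h')
    by_cases hepq : e = {p, q}
    · rw [hepq, Function.update_self]
    · rw [Function.update_of_ne hepq, collapse, if_neg hae]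
  · refine ⟨0, c, AgreeOff.refl _ _ _, fun x => ?_⟩
    rw [zero_mul, h.removedSum_eq (by omega), hlk]
    have key : ∀ w, w ≠ p → w ≠ q → ¬Adm r (c {p, w}) (c {q, w}) (c {p, q}) →
        spinWeight r c ({w} ∪ {p, q}) x = 0 := by
      intro w hp hq hw
      have : ({w} ∪ {p, q} : Finset W) = {p, q, w} := by
        ext z; simp only [Finset.mem_union, Finset.mem_insert, Finset.mem_singleton]; tauto
      rw [this, spinWeight, coneWeight_triple _ _ _ hpq hp.symm hq.symm, tetra_of_not]
      exact fun h' => hw (adm_comm₁₂.1 h'.2.2.2)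
    by_cases h1 : Adm r (c {p, t}) (c {q, t}) (c {p, q})
    · exact Finset.prod_eq_zero (i := {u}) (by simp)
        (key u huA'.1 huA'.2 fun h2 => hadm ⟨h1, h2⟩)
    · exact Finset.prod_eq_zero (i := {t}) (by simp) (key t htA'.1 htA'.2 h1)

theorem expands_card_three (hr : 2 ≤ r) (h : IsStarringAt F F' A a)
    (hF3 : ∀ s ∈ F, s.card ≤ 3) (hA : A.card = 3) :
    Expands A a (removedSum r F F' A) (addedSum r F A a) ∧
      Expands A a (addedSum r F A a) (removedSum r F F' A) := by
  have hlk := linkFaces_of_card_three hF3 h.mem_face hA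
  have haA := h.notMem h.mem_face
  obtain ⟨p, q, t, hpq, hpt, hqt, rfl⟩ := Finset.card_eq_three.1 hA
  have hrem : ∀ (c : Finset W → ℕ) (x : W → Fin (r - 1)),
      removedSum r F F' {p, q, t} c x = spinWeight r c {p, q, t} x := by
    intro c x
    rw [h.removedSum_eq (by omega), hlk, Finset.prod_singleton, Finset.empty_union]
  have hadd : ∀ (c : Finset W → ℕ) (x : W → Fin (r - 1)), addedSum r F {p, q, t} a c x =
      thetaInv r (c {p, q}) (c {q, t}) (c {p, t}) *
        tetra r (c {a, p}) (c {a, q}) (c {a, t}) (c {q, t}) (c {p, t}) (c {p, q}) *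
          spinWeight r c {p, q, t} x := by
    intro c x
    rw [← sum_prod_ssubsets_triple hr hpq hpt hqt haA, addedSum, hlk]
    simp only [Finset.prod_singleton, Finset.empty_union]
  refine ⟨Expands.of_single fun c => ⟨_, c, AgreeOff.refl _ _ _, fun x => by rw [hrem]; exact hadd c x⟩,
    Expands.of_single fun c => ?_⟩
  simp only [Finset.mem_insert, Finset.mem_singleton, not_or] at haA
  by_cases hadm : Adm r (c {p, q}) (c {q, t}) (c {p, t})
  · refine ⟨1, collapse a q c, agreeOff_collapse _ _ _ _, fun x => ?_⟩
    have hne : ∀ w z, a ≠ w → a ≠ z → collapse a q c {w, z} = c {w, z} := by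
      intro w z hw hz
      rw [collapse, if_neg (by simp [hw, hz])]
    have h1 := thetaInv_mul_tetra_zero hr hadm
    rw [tetra_swap₁₂] at h1
    rw [one_mul, hadd, collapse_self, collapse_pair haA.1 hpq.symm, collapse_pair haA.2.2 hqt,
      hne p q haA.1 haA.2.1, hne q t haA.2.1 haA.2.2, hne p t haA.1 haA.2.2, Finset.pair_comm q p,
      h1, one_mul, hrem]
    refine spinWeight_congr (fun _ _ => rfl) fun e he => ?_
    rw [collapse, if_neg]
    intro h'
    have := he h'
    simp only [Finset.mem_insert, Finset.mem_singleton] at this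
    tauto
  · refine ⟨0, c, AgreeOff.refl _ _ _, fun x => ?_⟩
    rw [zero_mul, hrem, spinWeight, coneWeight_triple _ _ _ hpq hpt hqt, tetra_of_not]
    exact fun h' => hadm (adm_comm₁₂.1 (adm_comm₂₃.1 h'.2.2.2))

theorem expands (hr : 2 ≤ r) (h : IsStarringAt F F' A a) (hF3 : ∀ s ∈ F, s.card ≤ 3)
    (hF2 : ∀ e ∈ F, e.card = 2 → (apexes F e).ncard = 2) :
    Expands A a (removedSum r F F' A) (addedSum r F A a) ∧
      Expands A a (addedSum r F A a) (removedSum r F F' A) := by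
  have h1 := hF3 A h.mem_face
  have h2 := (h.complex.nonempty h.mem_face).card_pos
  rcases (show A.card = 1 ∨ A.card = 2 ∨ A.card = 3 by omega) with h3 | h3 | h3
  · exact h.expands_card_one h3
  · exact h.expands_card_two hr hF3 hF2 h3
  · exact h.expands_card_three hr hF3 h3

theorem isProportional_iff (hr : 2 ≤ r) (h : IsStarringAt F F' A a) (hF3 : ∀ s ∈ F, s.card ≤ 3)
    (hF2 : ∀ e ∈ F, e.card = 2 → (apexes F e).ncard = 2) {T : Finset W} (hT : T ∈ F)
    (hAT : ¬A ⊆ T) : IsProportional r F T ↔ IsProportional r F' T :=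
  ⟨h.isProportional_of_expands hT hAT (h.vertexSum_eq_removedSum hT hAT)
    (h.vertexSum_eq_addedSum hT) (h.expands hr hF3 hF2).1,
  h.isProportional_of_expands hT hAT (h.vertexSum_eq_addedSum hT)
    (h.vertexSum_eq_removedSum hT hAT) (h.expands hr hF3 hF2).2⟩

end IsStarringAt

end Expansions

/-! ### Spheres and balls -/

section Spheres

variable {W : Type*} [DecidableEq W] {r : ℕ} {F F' : Finset (Finset W)} {A : Finset W} {a : W}

/-- A closed surface with proportional vertex sums relative to all its triangles. -/
structure IsEvaluable (r : ℕ) (F : Finset (Finset W)) : Prop where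
  isPure : IsPure F
  ncard_apexes : ∀ e ∈ F, e.card = 2 → (apexes F e).ncard = 2
  proportional : ∀ T ∈ F, T.card = 3 → IsProportional r F T

/-- A pure surface with an edge in exactly one triangle. -/
def HasBoundaryEdge (F : Finset (Finset W)) : Prop :=
  IsPure F ∧ ∃ e ∈ F, e.card = 2 ∧ (apexes F e).ncard = 1

namespace IsStarringAt

theorem isPure_iff (h : IsStarringAt F F' A a) : IsPure F ↔ IsPure F' := ⟨h.isPure, h.isPure'⟩

theorem hasBoundaryEdge_iff (h : IsStarringAt F F' A a) :
    HasBoundaryEdge F ↔ HasBoundaryEdge F' := by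
  rw [HasBoundaryEdge, HasBoundaryEdge, ← h.isPure_iff]
  exact and_congr_right fun hp => h.exists_ncard_apexes_iff (fun _ => hp.card_le) (by norm_num)

theorem ncard_apexes_iff (h : IsStarringAt F F' A a) (hF3 : ∀ s ∈ F, s.card ≤ 3) :
    (∀ e ∈ F, e.card = 2 → (apexes F e).ncard = 2) ↔
      ∀ e ∈ F', e.card = 2 → (apexes F' e).ncard = 2 := by
  constructor
  · intro h1 e he hec
    by_contra hn
    obtain ⟨e', he', hec', hn'⟩ := (h.exists_ncard_apexes_iff hF3 hn).2 ⟨e, he, hec, rfl⟩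
    exact hn (hn' ▸ h1 e' he' hec')
  · intro h1 e he hec
    by_contra hn
    obtain ⟨e', he', hec', hn'⟩ := (h.exists_ncard_apexes_iff hF3 hn).1 ⟨e, he, hec, rfl⟩
    exact hn (hn' ▸ h1 e' he' hec')

theorem isEvaluable_iff (hr : 2 ≤ r) (h : IsStarringAt F F' A a) :
    IsEvaluable r F ↔ IsEvaluable r F' := by
  suffices h1 : IsPure F → (∀ e ∈ F, e.card = 2 → (apexes F e).ncard = 2) →
      ((∀ T ∈ F, T.card = 3 → IsProportional r F T) ↔
        ∀ T ∈ F', T.card = 3 → IsProportional r F' T) by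
    constructor
    · rintro ⟨h2, h3, h4⟩
      exact ⟨h.isPure h2, (h.ncard_apexes_iff fun _ => h2.card_le).1 h3, (h1 h2 h3).1 h4⟩
    · rintro ⟨h2, h3, h4⟩
      have h5 := h.isPure' h2
      have h6 := (h.ncard_apexes_iff fun _ => h5.card_le).2 h3
      exact ⟨h5, h6, (h1 h5 h6).2 h4⟩
  intro hpure hdeg
  have hF3 : ∀ s ∈ F, s.card ≤ 3 := fun _ => hpure.card_le
  have hdeg' := (h.ncard_apexes_iff hF3).1 hdeg
  have hF3' := h.card_le hF3
  have key : ∀ σ w, σ.card = 2 → w ∉ σ → insert w σ ∈ F → A ⊆ insert w σ → ¬A ⊆ σ →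
      ∃ z ∈ apexes F σ, z ≠ w ∧ ¬A ⊆ insert z σ := by
    intro σ w hσ hw hwF hA hAσ
    have hσF : σ ∈ F := h.complex.down hwF (Finset.subset_insert _ _)
      (Finset.card_pos.1 (by omega))
    obtain ⟨z, hz, hzw⟩ := exists_ne_mem_apexes (hdeg σ hσF hσ) w
    refine ⟨z, hz, hzw, fun h' => hAσ fun y hy => ?_⟩
    rcases Finset.mem_insert.1 (h' hy) with rfl | h1
    · rcases Finset.mem_insert.1 (hA hy) with h2 | h2
      · exact absurd h2 hzw
      · exact h2
    · exact h1
  constructor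
  · intro hall T hT hTc
    by_cases haT : a ∈ T
    · obtain ⟨σ, haσ, rfl, hAσ, hσA⟩ := h.exists_insert hT haT
      rw [Finset.card_insert_of_notMem haσ] at hTc
      have hσ : σ.card = 2 := by omega
      have h1 := h.card_lt hAσ
      have h2 := hF3 _ hσA
      obtain ⟨w, hw⟩ := Finset.card_eq_one.1 (show ((σ ∪ A) \ σ).card = 1 by
        rw [Finset.card_sdiff_of_subset Finset.subset_union_left]; omega)
      have hw1 : w ∈ (σ ∪ A) \ σ := hw ▸ Finset.mem_singleton_self w
      have hw2 : insert w σ = σ ∪ A := by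
        rw [Finset.insert_eq, ← hw, Finset.sdiff_union_of_subset Finset.subset_union_left]
      obtain ⟨z, hz, -, hzA⟩ := key σ w hσ (Finset.mem_sdiff.1 hw1).2 (hw2 ▸ hσA)
        (hw2 ▸ Finset.subset_union_right) hAσ
      have hzF' : insert z σ ∈ F' := (h.mem_of_notMem (h.notMem hz.2)).2 ⟨hz.2, hzA⟩
      refine IsProportional.of_adjacent hr h.complex' hF3' hdeg' hσ (d := a) (e := z) ⟨haσ, hT⟩
        ⟨hz.1, hzF'⟩ (fun h' => h.notMem hz.2 (h' ▸ Finset.mem_insert_self _ _)) ?_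
      refine (h.isProportional_iff hr hF3 hdeg hz.2 hzA).1 (hall _ hz.2 ?_)
      rw [Finset.card_insert_of_notMem hz.1, hσ]
    · obtain ⟨h1, h2⟩ := (h.mem_of_notMem haT).1 hT
      exact (h.isProportional_iff hr hF3 hdeg h1 h2).1 (hall T h1 hTc)
  · intro hall T hT hTc
    have huntouched : ∀ T ∈ F, T.card = 3 → ¬A ⊆ T → IsProportional r F T := fun T hT hTc hA =>
      (h.isProportional_iff hr hF3 hdeg hT hA).2
        (hall T ((h.mem_of_notMem (h.notMem hT)).2 ⟨hT, hA⟩) hTc)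
    by_cases hA : A ⊆ T
    · obtain ⟨p, hp⟩ := h.complex.nonempty h.mem_face
      have hpT := Finset.insert_erase (hA hp)
      have hσ : (T.erase p).card = 2 := by rw [Finset.card_erase_of_mem (hA hp), hTc]
      obtain ⟨z, hz, hzp, hzA⟩ := key (T.erase p) p hσ (Finset.notMem_erase _ _) (by rwa [hpT])
        (by rwa [hpT]) fun h' => Finset.notMem_erase p T (h' hp)
      have := IsProportional.of_adjacent hr h.complex hF3 hdeg hσ (d := p) (e := z)
        ⟨Finset.notMem_erase _ _, by rwa [hpT]⟩ hz hzp.symm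
        (huntouched _ hz.2 (by rw [Finset.card_insert_of_notMem hz.1, hσ]) hzA)
      rwa [hpT] at this
    · exact huntouched T hT hTc hA

end IsStarringAt

theorem isComplex_of_coe_eq {K : PreAbstractSimplicialComplex W} (hF : (F : Set (Finset W)) = K.faces) :
    IsComplex F := by
  have hmem : ∀ s, s ∈ F ↔ s ∈ K.faces := fun s => by rw [← hF, Finset.mem_coe]
  exact ⟨fun hs => (K.isRelLowerSet_faces ((hmem _).1 hs)).1,
    fun hs hts ht => (hmem _).2 ((K.isRelLowerSet_faces ((hmem _).1 hs)).2 hts ht)⟩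

theorem isStarringAt_of_coe_eq {K K' : PreAbstractSimplicialComplex W}
    (hF : (F : Set (Finset W)) = K.faces) (hF' : (F' : Set (Finset W)) = K'.faces)
    (hA : A ∈ K.faces) (ha : {a} ∉ K.faces) (h : K'.faces = {s | s ∈ K.faces ∧ ¬ A ⊆ s} ∪
      {s | ∃ σ : Finset W, s = insert a σ ∧ ¬ A ⊆ σ ∧ σ ∪ A ∈ K.faces}) :
    IsStarringAt F F' A a := by
  have hmem : ∀ s, s ∈ F ↔ s ∈ K.faces := fun s => by rw [← hF, Finset.mem_coe]
  refine ⟨isComplex_of_coe_eq hF, isComplex_of_coe_eq hF', (hmem _).2 hA,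
    fun h' => ha ((hmem _).1 h'), fun s => ?_⟩
  rw [← Finset.mem_coe, hF', h]
  simp only [hmem]
  rfl

theorem finite_faces_iff {K K' : PreAbstractSimplicialComplex W} (h : IsStarring K K') :
    K.faces.Finite ↔ K'.faces.Finite := by
  obtain ⟨A, hA, a, ha, h⟩ := h
  have hdown : ∀ {s t : Finset W}, s ∈ K.faces → t ⊆ s → t.Nonempty → t ∈ K.faces :=
    fun hs hts ht => (K.isRelLowerSet_faces hs).2 hts ht
  constructor
  · intro hfin
    obtain ⟨F, hF⟩ := hfin.exists_finset_coe
    refine Set.Finite.subset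
      (F ∪ (F.biUnion Finset.powerset).image (insert a) : Finset _).finite_toSet ?_
    rw [h]
    have hmem : ∀ s, s ∈ F ↔ s ∈ K.faces := fun s => by rw [← hF, Finset.mem_coe]
    rintro s (⟨hs, -⟩ | ⟨σ, rfl, -, hσ⟩)
    · exact Finset.mem_coe.2 (Finset.mem_union_left _ ((hmem _).2 hs))
    · refine Finset.mem_coe.2 (Finset.mem_union_right _ (Finset.mem_image_of_mem _ ?_))
      exact Finset.mem_biUnion.2
        ⟨_, (hmem _).2 hσ, Finset.mem_powerset.2 Finset.subset_union_left⟩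
  · intro hfin
    obtain ⟨F', hF'⟩ := hfin.exists_finset_coe
    obtain ⟨p, hp⟩ := (K.isRelLowerSet_faces hA).1
    refine Set.Finite.subset
      (F' ∪ F'.image (fun t => insert p (t.erase a)) : Finset _).finite_toSet ?_
    have hmem : ∀ s, s ∈ F' ↔ s ∈ K'.faces := fun s => by rw [← hF', Finset.mem_coe]
    intro s hs
    by_cases hAs : A ⊆ s
    · have has : a ∉ s := fun h' => ha (hdown hs (Finset.singleton_subset_iff.2 h') (by simp))
      refine Finset.mem_coe.2 (Finset.mem_union_right _ (Finset.mem_image.2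
        ⟨insert a (s.erase p), (hmem _).2 ?_, ?_⟩))
      · rw [h]
        refine Or.inr ⟨_, rfl, fun h' => Finset.notMem_erase p s (h' hp), ?_⟩
        convert hs using 1
        ext w
        have := @hAs w
        simp only [Finset.mem_union, Finset.mem_erase]
        by_cases hw : w = p
        · subst hw; tauto
        · tauto
      · rw [Finset.erase_insert fun h' => has (Finset.mem_of_mem_erase h'),
          Finset.insert_erase (hAs hp)]
    · refine Finset.mem_coe.2 (Finset.mem_union_left _ ((hmem _).2 ?_))
      rw [h]
      exact Or.inl ⟨hs, hAs⟩

theorem exists_coe_eq_iff_of_stellarEquiv {P : Finset (Finset W) → Prop}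
    (hP : ∀ {F F' A a}, IsStarringAt F F' A a → (P F ↔ P F'))
    {K K' : PreAbstractSimplicialComplex W} (h : StellarEquiv K K') :
    (∃ F : Finset (Finset W), (F : Set (Finset W)) = K.faces ∧ P F) ↔
      ∃ F : Finset (Finset W), (F : Set (Finset W)) = K'.faces ∧ P F := by
  induction h with
  | rel K K' h =>
    have hfin := finite_faces_iff h
    obtain ⟨A, hA, a, ha, h⟩ := h
    constructor
    · rintro ⟨F, hF, hPF⟩
      obtain ⟨F', hF'⟩ := (hfin.1 (hF ▸ F.finite_toSet)).exists_finset_coe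
      exact ⟨F', hF', (hP (isStarringAt_of_coe_eq hF hF' hA ha h)).1 hPF⟩
    · rintro ⟨F', hF', hPF⟩
      obtain ⟨F, hF⟩ := (hfin.2 (hF' ▸ F'.finite_toSet)).exists_finset_coe
      exact ⟨F, hF, (hP (isStarringAt_of_coe_eq hF hF' hA ha h)).2 hPF⟩
  | refl => rfl
  | symm _ _ _ ih => exact ih.symm
  | trans _ _ _ _ _ ih₁ ih₂ => exact ih₁.trans ih₂

theorem apexes_eq_sdiff {S e : Finset W}
    (h : ∀ w ∈ S, w ∉ e → insert w e ∈ F) (h' : ∀ s ∈ F, s ⊆ S) :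
    apexes F e = ((S \ e : Finset W) : Set W) := by
  ext w
  simp only [apexes, Set.mem_ofPred_eq, Finset.coe_sdiff, Set.mem_sdiff, Finset.mem_coe]
  exact ⟨fun h1 => ⟨h' _ h1.2 (Finset.mem_insert_self _ _), h1.1⟩, fun h1 => ⟨h1.2, h w h1.1 h1.2⟩⟩

theorem isEvaluable_boundary (hr : 2 ≤ r) {S : Finset W} (hS : S.card = 4)
    (hF : ∀ s, s ∈ F ↔ s.Nonempty ∧ s ⊂ S) : IsEvaluable r F := by
  refine ⟨⟨fun hs => ?_, fun {s} hs => ?_⟩, fun e he hec => ?_, fun T hT hTc => ?_⟩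
  · have := Finset.card_lt_card ((hF _).1 hs).2
    omega
  · obtain ⟨h1, h2⟩ := (hF _).1 hs
    obtain ⟨d, hd, hds⟩ := Finset.exists_of_ssubset h2
    refine ⟨S.erase d, (hF _).2 ⟨h1.mono ?_, Finset.erase_ssubset hd⟩, ?_, ?_⟩
    · exact Finset.subset_erase.2 ⟨h2.1, hds⟩
    · exact Finset.subset_erase.2 ⟨h2.1, hds⟩
    · rw [Finset.card_erase_of_mem hd, hS]
  · obtain ⟨-, h2⟩ := (hF _).1 he
    rw [apexes_eq_sdiff (S := S), Set.ncard_coe_finset, Finset.card_sdiff_of_subset h2.1, hS, hec]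
    · intro w hw hwe
      refine (hF _).2 ⟨Finset.insert_nonempty _ _, Finset.insert_subset hw h2.1, fun h3 => ?_⟩
      have := Finset.card_le_card h3
      rw [Finset.card_insert_of_notMem hwe] at this
      omega
    · exact fun s hs => ((hF s).1 hs).2.1
  · obtain ⟨h1, h2⟩ := (hF _).1 hT
    obtain ⟨d, hd, hdT⟩ := Finset.exists_of_ssubset h2
    have hST : S = insert d T := by
      symm
      refine Finset.eq_of_subset_of_card_le (Finset.insert_subset hd h2.1) ?_
      rw [Finset.card_insert_of_notMem hdT, hS, hTc]
    have hverts : verts F \ T = {d} := by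
      ext w
      simp only [Finset.mem_sdiff, Finset.mem_singleton]
      constructor
      · rintro ⟨hw, hwT⟩
        obtain ⟨s, hs, hws⟩ := mem_verts.1 hw
        have := ((hF _).1 hs).2.1 hws
        rw [hST] at this
        rcases Finset.mem_insert.1 this with h3 | h3
        · exact h3
        · exact absurd h3 hwT
      · rintro rfl
        refine ⟨mem_verts.2 ⟨{w}, (hF _).2 ⟨by simp, ?_⟩, by simp⟩, hdT⟩
        refine ⟨Finset.singleton_subset_iff.2 hd, fun h3 => ?_⟩
        have := Finset.card_le_card h3
        rw [hS, Finset.card_singleton] at this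
        omega
    have hfilter : (F.filter fun s => ¬s ⊆ T) = T.ssubsets.image (insert d) := by
      ext s
      simp only [Finset.mem_filter, Finset.mem_image, Finset.mem_ssubsets, hF, hST]
      constructor
      · rintro ⟨⟨h3, h4⟩, h5⟩
        have hds : d ∈ s := by
          by_contra hds
          exact h5 ((Finset.subset_insert_iff_of_notMem hds).1 h4.1)
        refine ⟨s.erase d, ⟨Finset.subset_insert_iff.1 h4.1, fun h6 => h4.2 ?_⟩,
          Finset.insert_erase hds⟩
        rw [← Finset.insert_erase hds]
        exact Finset.insert_subset_insert _ h6
      · rintro ⟨α, h3, rfl⟩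
        refine ⟨⟨Finset.insert_nonempty _ _, Finset.insert_subset_insert _ h3.1, fun h4 => h3.2 ?_⟩,
          fun h4 => hdT (h4 (Finset.mem_insert_self _ _))⟩
        exact (Finset.insert_subset_insert_iff hdT).1 h4
    have hinj : Set.InjOn (insert d) (T.ssubsets : Set (Finset W)) := by
      have hn : ∀ α ∈ (T.ssubsets : Set (Finset W)), d ∉ α := fun α hα hd' =>
        hdT ((Finset.mem_ssubsets.1 hα).1 hd')
      intro α hα α' hα' h5
      rw [← Finset.erase_insert (hn α hα), ← Finset.erase_insert (hn α' hα')]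
      exact congrArg (fun s => Finset.erase s d) h5
    obtain ⟨p, q, t, hpq, hpt, hqt, rfl⟩ := Finset.card_eq_three.1 hTc
    refine ⟨fun c => thetaInv r (c {p, q}) (c {q, t}) (c {p, t}) *
      tetra r (c {d, p}) (c {d, q}) (c {d, t}) (c {q, t}) (c {p, t}) (c {p, q}), fun c x => ?_⟩
    rw [vertexSum, hverts, partialSum_singleton, mul_comm,
      ← sum_prod_ssubsets_triple hr hpq hpt hqt hdT]
    refine Finset.sum_congr rfl fun k _ => ?_
    rw [hfilter, Finset.prod_image hinj]

theorem hasBoundaryEdge_simplex {S : Finset W} (hS : S.card = 3)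
    (hF : ∀ s, s ∈ F ↔ s.Nonempty ∧ s ⊆ S) : HasBoundaryEdge F := by
  have hSF : S ∈ F := (hF _).2 ⟨Finset.card_pos.1 (by omega), subset_rfl⟩
  refine ⟨⟨fun hs => ?_, fun {s} hs => ⟨S, hSF, ((hF _).1 hs).2, hS⟩⟩, ?_⟩
  · have := Finset.card_le_card ((hF _).1 hs).2
    omega
  · obtain ⟨d, hd⟩ := Finset.card_pos.1 (show 0 < S.card by omega)
    have hc : (S.erase d).card = 2 := by rw [Finset.card_erase_of_mem hd, hS]
    refine ⟨S.erase d, (hF _).2 ⟨Finset.card_pos.1 (by omega), Finset.erase_subset _ _⟩, hc, ?_⟩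
    rw [apexes_eq_sdiff (S := S), Set.ncard_coe_finset,
      Finset.card_sdiff_of_subset (Finset.erase_subset _ _), hc, hS]
    · exact fun w hw _ => (hF _).2
        ⟨Finset.insert_nonempty _ _, Finset.insert_subset hw (Finset.erase_subset _ _)⟩
    · exact fun s hs => ((hF s).1 hs).2

end Spheres

section Links

variable {V : Type*} [DecidableEq V]

theorem card_image_inr_range (n : ℕ) :
    ((Finset.range n).image (Sum.inr : ℕ → V ⊕ ℕ)).card = n := by
  rw [Finset.card_image_of_injective _ Sum.inr_injective, Finset.card_range]

theorem IsSphere.exists_isEvaluable {r : ℕ} (hr : 2 ≤ r) {K : PreAbstractSimplicialComplex V}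
    (h : IsSphere 2 K) : ∃ F : Finset (Finset (V ⊕ ℕ)),
      (F : Set (Finset (V ⊕ ℕ))) = (K.map Sum.inl).faces ∧ IsEvaluable r F := by
  rw [exists_coe_eq_iff_of_stellarEquiv (fun h => h.isEvaluable_iff hr) h]
  set S := (Finset.range (2 + 2)).image (Sum.inr : ℕ → V ⊕ ℕ)
  refine ⟨S.ssubsets.filter fun s => s.Nonempty, ?_,
    isEvaluable_boundary hr (card_image_inr_range 4) fun s => ?_⟩
  · ext s
    simp [simplexBoundary, and_comm]
  · rw [Finset.mem_filter, Finset.mem_ssubsets, and_comm]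

theorem IsBall.exists_hasBoundaryEdge {K : PreAbstractSimplicialComplex V}
    (h : IsBall 2 K) : ∃ F : Finset (Finset (V ⊕ ℕ)),
      (F : Set (Finset (V ⊕ ℕ))) = (K.map Sum.inl).faces ∧ HasBoundaryEdge F := by
  rw [exists_coe_eq_iff_of_stellarEquiv (fun h => h.hasBoundaryEdge_iff) h]
  set S := (Finset.range (2 + 1)).image (Sum.inr : ℕ → V ⊕ ℕ)
  refine ⟨S.powerset.filter fun s => s.Nonempty, ?_,
    hasBoundaryEdge_simplex (card_image_inr_range 3) fun s => ?_⟩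
  · ext s
    simp [simplex, and_comm]
  · rw [Finset.mem_filter, Finset.mem_powerset, and_comm]

end Links

/-! ### Evaluation of closed vertex sums -/

section Evaluation

theorem sum_triangle_sq {r : ℕ} (hr : 2 ≤ r) (j : Fin (r - 1)) (t y z : ℕ) :
    ∑ b : Fin (r - 1), ∑ d : Fin (r - 1), dimq r j * dimq r b * dimq r d *
      thetaInv r j b z * thetaInv r j d y * thetaInv r b d t *
        (tetra r j b d t y z * tetra r j b d t y z) = dimq r j ^ 2 * (thetaInv r z t y)⁻¹ := by
  by_cases hadm : Adm r z t y
  swap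
  · rw [thetaInv_of_not_adm hadm, inv_zero, mul_zero]
    refine Finset.sum_eq_zero fun b _ => Finset.sum_eq_zero fun d _ => ?_
    rw [tetra_of_not, mul_zero, mul_zero]
    exact fun h => hadm (adm_comm₁₂.1 (adm_comm₂₃.1 h.2.2.2))
  have hz := Adm.lt hr hadm
  have hθ := thetaInv_ne_zero hr hadm
  have hdz : dimq r z ≠ 0 := dimq_ne_zero (by omega)
  have key : ∀ b : Fin (r - 1), ∑ d : Fin (r - 1), dimq r j * dimq r b * dimq r d *
      thetaInv r j b z * thetaInv r j d y * thetaInv r b d t *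
        (tetra r j b d t y z * tetra r j b d t y z) =
      (if Adm r b j z then dimq r b else 0) * (dimq r j / (dimq r z * thetaInv r z t y)) := by
    intro b
    have h1 := sum_tetra_mul_tetra hr j b t y z z
    rw [Finset.sum_range] at h1
    have hsw : ∀ d, tetra r d j b z t y = tetra r j b d t y z := fun d => by
      rw [tetra_swap₁₂, tetra_swap₂₃]
    simp only [hsw] at h1
    by_cases h2 : Adm r b j z
    · have h3 : Adm r j b z := adm_comm₁₂.1 h2
      have h4 : Adm r y t z := adm_comm₁₂.1 (adm_comm₂₃.1 (adm_comm₁₂.1 hadm))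
      rw [if_pos (by exact ⟨trivial, h3, h4⟩)] at h1
      rw [if_pos h2, mul_div_assoc', eq_div_iff (mul_ne_zero hdz hθ)]
      have h5 : thetaInv r y t z = thetaInv r z t y := by
        rw [thetaInv_comm₁₂, thetaInv_comm₂₃, thetaInv_comm₁₂]
      rw [h5] at h1
      rw [← mul_one (dimq r b * dimq r j), ← h1, Finset.sum_mul, Finset.sum_mul, Finset.mul_sum]
      refine Finset.sum_congr rfl fun d _ => ?_
      rw [thetaInv_comm₁₂ r d j, thetaInv_comm₁₂ r d b]
      ring
    · rw [if_neg h2, zero_mul]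
      refine Finset.sum_eq_zero fun d _ => ?_
      rw [thetaInv_of_not_adm fun h => h2 (adm_comm₁₂.1 h)]
      ring
  rw [Finset.sum_congr rfl fun b _ => key b, ← Finset.sum_mul,
    ← Finset.sum_range fun b => if Adm r b j z then dimq r b else 0,
    sum_dimq_of_adm hr j.2 hz]
  field_simp

variable {W : Type*} [DecidableEq W] {r : ℕ} {F : Finset (Finset W)}

/-- The sum over the spins of all vertices but one is the square of its quantum dimension, up to a
factor depending only on the labels of the base. -/
theorem IsEvaluable.exists_partialSum_eq (hr : 2 ≤ r) (hF : IsComplex F) (h : IsEvaluable r F)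
    {w : W} (hw : {w} ∈ F) : ∃ G : (Finset W → ℕ) → ℂ, ∀ c x,
      partialSum (verts F \ {w}) (fun x => ∏ s ∈ F, spinWeight r c s x) x =
        dimq r (x w) ^ 2 * G c := by
  obtain ⟨T, hT, hwT, hTc⟩ := h.isPure.pure hw
  obtain ⟨κ, hκ⟩ := h.proportional T hT hTc
  rw [Finset.singleton_subset_iff] at hwT
  obtain ⟨b, d, hbd, hbdT⟩ := Finset.card_eq_two.1
    (show (T.erase w).card = 2 by rw [Finset.card_erase_of_mem hwT, hTc])
  have hTe : T = {w, b, d} := by rw [← hbdT, Finset.insert_erase hwT]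
  have hwbd : w ∉ ({b, d} : Finset W) := hbdT ▸ Finset.notMem_erase w T
  simp only [Finset.mem_insert, Finset.mem_singleton, not_or] at hwbd
  obtain ⟨hwb, hwd⟩ := hwbd
  refine ⟨fun c => (thetaInv r (c {w, b}) (c {b, d}) (c {w, d}))⁻¹ * κ c, fun c x => ?_⟩
  have hb : b ∉ insert d (verts F \ T) := by simp [hbd, hTe]
  have hd : d ∉ verts F \ T := by simp [hTe]
  have h1 : verts F \ {w} = insert b (insert d (verts F \ T)) := by
    ext z
    have := @subset_verts _ _ _ _ hT z
    simp only [hTe, Finset.mem_sdiff, Finset.mem_insert, Finset.mem_singleton] at this ⊢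
    by_cases hzb : z = b
    · subst hzb; simp only [true_or, or_true, forall_const] at this; simp [this, Ne.symm hwb]
    by_cases hzd : z = d
    · subst hzd; simp only [or_true, forall_const] at this; simp [this, Ne.symm hwd]
    simp [hzb, hzd]
  have h2 : F.filter (· ⊆ T) = T.powerset.erase ∅ := by
    ext s
    simp only [Finset.mem_filter, Finset.mem_erase, Finset.mem_powerset]
    exact ⟨fun h => ⟨(hF.nonempty h.1).ne_empty, h.2⟩,
      fun h => ⟨hF.down hT h.2 (Finset.nonempty_iff_ne_empty.2 h.1), h.2⟩⟩
  have h3 : ∀ x : W → Fin (r - 1), ∏ s ∈ F with s ⊆ T, spinWeight r c s x =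
      dimq r (x w) * dimq r (x b) * dimq r (x d) *
      thetaInv r (x w) (x b) (c {w, b}) * thetaInv r (x w) (x d) (c {w, d}) *
      thetaInv r (x b) (x d) (c {b, d}) *
        tetra r (x w) (x b) (x d) (c {b, d}) (c {w, d}) (c {w, b}) := by
    intro x
    have h4 : coneWeight r (fun w => (x w : ℕ)) c ∅ = 1 := by simp [coneWeight]
    rw [h2, Finset.prod_erase _ h4, hTe, Finset.prod_powerset_insert (by simp [hwb, hwd]),
      Finset.prod_powerset_insert (by simpa using hbd), Finset.prod_powerset_insert
      (by simpa using hbd), ← insert_empty_eq d, Finset.prod_powerset_insert (by simp),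
      Finset.prod_powerset_insert (by simp), Finset.prod_powerset_insert (by simp),
      Finset.prod_powerset_insert (by simp)]
    simp only [Finset.powerset_empty, Finset.prod_singleton, insert_empty_eq,
      coneWeight_singleton, coneWeight_pair r _ _ hwb, coneWeight_pair r _ _ hwd,
      coneWeight_pair r _ _ hbd, coneWeight_triple r _ _ hwb hwd hbd, h4]
    ring
  rw [h1, partialSum_insert' hb]
  simp only [partialSum_insert' hd]
  have h5 : ∀ x : W → Fin (r - 1), partialSum (verts F \ T)
      (fun x => ∏ s ∈ F, spinWeight r c s x) x =
        (∏ s ∈ F with s ⊆ T, spinWeight r c s x) * (spinWeight r c T x * κ c) := by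
    intro x
    rw [← hκ, vertexSum]
    simp only [← Finset.prod_filter_mul_prod_filter_not F (· ⊆ T)]
    refine partialSum_mul_left (g := fun x => ∏ s ∈ F with s ⊆ T, spinWeight r c s x)
      fun x' hx' => Finset.prod_congr rfl fun s hs => spinWeight_congr (fun z hz => hx' z ?_)
        fun _ _ => rfl
    simp [(Finset.mem_filter.1 hs).2 hz]
  simp only [h5, h3]
  simp only [hTe, spinWeight, coneWeight_triple r _ _ hwb hwd hbd, Function.update_self,
    Function.update_of_ne hwb, Function.update_of_ne hwd, Function.update_of_ne hbd]
  rw [← mul_assoc, ← sum_triangle_sq hr (x w), Finset.sum_mul]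
  refine Finset.sum_congr rfl fun k _ => ?_
  rw [Finset.sum_mul]
  refine Finset.sum_congr rfl fun l _ => ?_
  ring

end Evaluation

/-! ### The link of an interior vertex -/

section VertexLink

variable {V : Type*} [Fintype V] [DecidableEq V] {K : AbstractSimplicialComplex V} {r : ℕ} {v : V}

theorem mem_facesOfCard {n : ℕ} {s : Finset V} : s ∈ facesOfCard K n ↔ s ∈ K.faces ∧ s.card = n := by
  simp [facesOfCard]

variable (K v) in
open Classical in
/-- The faces of the link of `v`. -/
def linkFinset : Finset (Finset V) :=
  Finset.univ.filter fun s => s.Nonempty ∧ v ∉ s ∧ insert v s ∈ K.faces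

theorem mem_linkFinset {s : Finset V} :
    s ∈ linkFinset K v ↔ s.Nonempty ∧ v ∉ s ∧ insert v s ∈ K.faces := by
  simp [linkFinset]

theorem mem_faces_of_subset {s t : Finset V} (hs : s ∈ K.faces) (hts : t ⊆ s) (ht : t.Nonempty) :
    t ∈ K.faces := (K.isRelLowerSet_faces hs).2 hts ht

theorem coe_eq_map_link_iff {F : Finset (Finset (V ⊕ ℕ))} :
    (F : Set (Finset (V ⊕ ℕ))) =
      ((link K.toPreAbstractSimplicialComplex v).map (Sum.inl : V → V ⊕ ℕ)).faces ↔
      F = (linkFinset K v).image (Finset.image Sum.inl) := by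
  rw [← Finset.coe_inj, Finset.coe_image]
  have : (linkFinset K v : Set (Finset V)) = (link K.toPreAbstractSimplicialComplex v).faces := by
    ext s
    rw [Finset.mem_coe, mem_linkFinset]
    rfl
  rw [this]
  rfl

theorem prod_filter_facesOfCard {n : ℕ} (hn : n ≠ 0) (φ : Finset V → ℂ) :
    ∏ f ∈ facesOfCard K (n + 1) with v ∈ f, φ f =
      ∏ s ∈ linkFinset K v with s.card = n, φ (insert v s) := by
  refine Finset.prod_bij' (fun f _ => f.erase v) (fun s _ => insert v s) ?_ ?_ ?_ ?_ ?_
  · intro f hf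
    obtain ⟨hf, hv⟩ := Finset.mem_filter.1 hf
    obtain ⟨h1, h2⟩ := mem_facesOfCard.1 hf
    have h3 : (f.erase v).card = n := by rw [Finset.card_erase_of_mem hv, h2]; rfl
    refine Finset.mem_filter.2 ⟨mem_linkFinset.2 ⟨Finset.card_pos.1 (by omega),
      Finset.notMem_erase _ _, by rwa [Finset.insert_erase hv]⟩, h3⟩
  · intro s hs
    obtain ⟨hs, hc⟩ := Finset.mem_filter.1 hs
    obtain ⟨h1, h2, h3⟩ := mem_linkFinset.1 hs
    exact Finset.mem_filter.2 ⟨mem_facesOfCard.2 ⟨h3, by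
      rw [Finset.card_insert_of_notMem h2, hc]⟩, Finset.mem_insert_self _ _⟩
  · intro f hf
    exact Finset.insert_erase (Finset.mem_filter.1 hf).2
  · intro s hs
    exact Finset.erase_insert (mem_linkFinset.1 (Finset.mem_filter.1 hs).1).2.1
  · intro f hf
    rw [Finset.insert_erase (Finset.mem_filter.1 hf).2]

theorem mem_boundaryVertices_of_isBall
    (h : IsBall 2 (link K.toPreAbstractSimplicialComplex v)) : v ∈ boundaryVertices K := by
  obtain ⟨F, hF, -, e, he, hec, hdeg⟩ := h.exists_hasBoundaryEdge
  rw [coe_eq_map_link_iff] at hF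
  subst hF
  have himage : ∀ s : Finset V, s.image (Sum.inl : V → V ⊕ ℕ) ∈
      (linkFinset K v).image (Finset.image Sum.inl) ↔ s ∈ linkFinset K v := fun s =>
    Finset.mem_image.trans ⟨fun ⟨t, ht, h⟩ => Finset.image_injective Sum.inl_injective h ▸ ht,
      fun h => ⟨s, h, rfl⟩⟩
  obtain ⟨s, hs, rfl⟩ := Finset.mem_image.1 he
  rw [Finset.card_image_of_injective _ Sum.inl_injective] at hec
  obtain ⟨-, hvs, hsK⟩ := mem_linkFinset.1 hs
  obtain ⟨w₀, hw₀⟩ := Set.ncard_eq_one.1 hdeg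
  have happ : ∀ w : V, Sum.inl w ∈
      apexes ((linkFinset K v).image (Finset.image (Sum.inl : V → V ⊕ ℕ))) (s.image Sum.inl) ↔
        w ∉ s ∧ insert w s ∈ linkFinset K v := by
    intro w
    rw [← himage, Finset.image_insert]
    simp [apexes]
  have hw₀' : w₀ ∈ apexes ((linkFinset K v).image (Finset.image (Sum.inl : V → V ⊕ ℕ)))
      (s.image Sum.inl) := hw₀ ▸ rfl
  obtain ⟨t, -, ht⟩ := Finset.mem_image.1 hw₀'.2
  have : w₀ ∈ t.image Sum.inl := ht ▸ Finset.mem_insert_self _ _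
  obtain ⟨w, -, rfl⟩ := Finset.mem_image.1 this
  have hfc : (insert v s).card = 3 := by rw [Finset.card_insert_of_notMem hvs, hec]
  refine Finset.mem_filter.2 ⟨Finset.mem_univ _, insert v s, ?_, Finset.mem_insert_self _ _⟩
  refine Finset.mem_filter.2 ⟨mem_facesOfCard.2 ⟨hsK, hfc⟩, Finset.card_eq_one.2
    ⟨insert w (insert v s), ?_⟩⟩
  obtain ⟨hws, hwL⟩ := (happ w).1 hw₀'
  obtain ⟨-, hvw, hwK⟩ := mem_linkFinset.1 hwL
  simp only [Finset.mem_insert, not_or] at hvw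
  ext τ
  rw [Finset.mem_filter, Finset.mem_singleton, tetrahedra, mem_facesOfCard]
  constructor
  · rintro ⟨⟨h1, h2⟩, h3⟩
    obtain ⟨z, hz⟩ := Finset.card_eq_one.1 (show (τ \ insert v s).card = 1 by
      rw [Finset.card_sdiff_of_subset h3]; omega)
    have hz1 : z ∈ τ \ insert v s := hz ▸ Finset.mem_singleton_self z
    have hz2 : insert z (insert v s) = τ := by
      rw [Finset.insert_eq, ← hz, Finset.sdiff_union_of_subset h3]
    have hz3 := (Finset.mem_sdiff.1 hz1).2
    simp only [Finset.mem_insert, not_or] at hz3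
    have hzL : Sum.inl z ∈ ({Sum.inl w} : Set (V ⊕ ℕ)) := by
      rw [← hw₀, happ]
      refine ⟨hz3.2, mem_linkFinset.2 ⟨Finset.insert_nonempty _ _, ?_, ?_⟩⟩
      · simp [hvs, Ne.symm hz3.1]
      · rwa [Finset.insert_comm, hz2]
    rw [← hz2, Sum.inl_injective hzL]
  · rintro rfl
    refine ⟨⟨by rwa [Finset.insert_comm], ?_⟩, Finset.subset_insert _ _⟩
    rw [Finset.card_insert_of_notMem (by simp [hws, Ne.symm hvw.1]), hfc]

end VertexLink

/-! ### Dependence of the amplitudes on the labels -/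

section Congruence

variable {V : Type*} [DecidableEq V] {r : ℕ} {l l' : Finset V → ℕ} {s : Finset V}

theorem labelSum_congr (h : ∀ e ⊆ s, l e = l' e) : labelSum l s = labelSum l' s :=
  Finset.sum_congr rfl fun _ he => h _ (Finset.mem_powersetCard.1 he).1

theorem isAdmissibleTriangle_congr (h : ∀ e ⊆ s, l e = l' e) :
    IsAdmissibleTriangle r l s ↔ IsAdmissibleTriangle r l' s := by
  rw [IsAdmissibleTriangle, IsAdmissibleTriangle, labelSum_congr h]
  refine and_congr_right fun _ => and_congr_left fun _ => forall₂_congr fun e he => ?_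
  rw [h e (Finset.mem_powersetCard.1 he).1]

theorem theta_congr (h : ∀ e ⊆ s, l e = l' e) : theta r l s = theta r l' s := by
  have h1 : ∀ f : ℕ → ℂ, ∏ e ∈ s.powersetCard 2, f (l e) = ∏ e ∈ s.powersetCard 2, f (l' e) :=
    fun f => Finset.prod_congr rfl fun e he => by rw [h e (Finset.mem_powersetCard.1 he).1]
  rw [theta, theta, labelSum_congr h, h1 (qFactorial r),
    h1 fun n => qFactorial r (labelSum l' s / 2 - n)]

theorem tet_congr [Fintype V] (h : ∀ e ⊆ s, l e = l' e) : tet r l s = tet r l' s := by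
  have h1 : ∀ F ∈ s.powersetCard 3, labelSum l F = labelSum l' F := fun F hF =>
    labelSum_congr fun e he => h e (he.trans (Finset.mem_powersetCard.1 hF).1)
  have h2 : ∀ p ∈ oppositePairs s, quadHalf l s p = quadHalf l' s p := by
    intro p hp
    obtain ⟨e, he, rfl⟩ := Finset.mem_image.1 hp
    have hes := (Finset.mem_powersetCard.1 he).1
    rw [quadHalf, quadHalf, labelSum_congr h]
    congr 2
    refine Finset.sum_congr rfl fun e' he' => h e' ?_
    simp only [Finset.mem_insert, Finset.mem_singleton] at he'
    rcases he' with rfl | rfl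
    · exact hes
    · exact Finset.sdiff_subset
  have h3 : ∏ e ∈ s.powersetCard 2, qFactorial r (l e) =
      ∏ e ∈ s.powersetCard 2, qFactorial r (l' e) :=
    Finset.prod_congr rfl fun e he => by rw [h e (Finset.mem_powersetCard.1 he).1]
  rw [tet, tet, h3, labelSum_congr h]
  congr 1
  · congr 1
    refine Finset.prod_congr rfl fun F hF => Finset.prod_congr rfl fun p hp => ?_
    rw [h1 F hF, h2 p hp]
  · refine Finset.sum_congr (Finset.filter_congr fun n _ => ?_) fun n _ => ?_
    · refine and_congr (forall₂_congr fun F hF => ?_) (forall₂_congr fun p hp => ?_)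
      · rw [h1 F hF]
      · rw [h2 p hp]
    · congr 2
      · exact Finset.prod_congr rfl fun F hF => by rw [h1 F hF]
      · exact Finset.prod_congr rfl fun p hp => by rw [h2 p hp]

end Congruence

/-! ### Splitting off the star of an interior vertex -/

section Star

variable {V : Type*} [Fintype V] [DecidableEq V] {K : AbstractSimplicialComplex V} {r : ℕ} {v : V}

/-- The product of the weights of the cones over the faces of the link of `v`. -/
def coneProd (K : AbstractSimplicialComplex V) (r : ℕ) (v : V) (l : Finset V → ℕ) : ℂ :=
  ∏ s ∈ linkFinset K v, coneWeight r (fun u => l {v, u}) l s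

theorem prod_eq_prod_card {L : Finset (Finset V)} (hL : ∀ s ∈ L, s.Nonempty ∧ s.card ≤ 3)
    (f : Finset V → ℂ) : ∏ s ∈ L, f s = (∏ s ∈ L with s.card = 1, f s) *
      (∏ s ∈ L with s.card = 2, f s) * ∏ s ∈ L with s.card = 3, f s := by
  rw [← Finset.prod_filter_mul_prod_filter_not L (fun s => s.card = 1),
    ← Finset.prod_filter_mul_prod_filter_not (L.filter fun s => ¬s.card = 1) (fun s => s.card = 2),
    Finset.filter_filter, Finset.filter_filter, mul_assoc]
  congr 2
  · refine congrArg (fun t => ∏ s ∈ t, f s) (Finset.filter_congr fun s _ => by omega)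
  · refine congrArg (fun t => ∏ s ∈ t, f s) (Finset.filter_congr fun s hs => ?_)
    have := (hL s hs).1.card_pos
    have := (hL s hs).2
    omega

theorem coneProd_of_admissible (hr : 2 ≤ r) (hL : ∀ s ∈ linkFinset K v, s.card ≤ 3)
    {l : Finset V → ℕ} (h : ∀ f ∈ triangles K, IsAdmissibleTriangle r l f) :
    coneProd K r v l = (∏ e ∈ edges K with v ∈ e, dimq r (l e)) *
      (∏ f ∈ triangles K with v ∈ f, (theta r l f)⁻¹) *
        ∏ t ∈ tetrahedra K with v ∈ t, tet r l t := by
  have hadm : ∀ {p q t : V}, p ≠ q → p ≠ t → q ≠ t → {p, q, t} ∈ K.faces →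
      Adm r (l {p, q}) (l {p, t}) (l {q, t}) := fun hpq hpt hqt hK =>
    (isAdmissibleTriangle_triple hpq hpt hqt).1 (h _ (mem_facesOfCard.2
      ⟨hK, Finset.card_eq_three.2 ⟨_, _, _, hpq, hpt, hqt, rfl⟩⟩))
  rw [edges, triangles, tetrahedra, prod_filter_facesOfCard one_ne_zero,
    prod_filter_facesOfCard two_ne_zero, prod_filter_facesOfCard three_ne_zero, coneProd,
    prod_eq_prod_card fun s hs => ⟨(mem_linkFinset.1 hs).1, hL s hs⟩]
  congr 1
  · congr 1
    · refine Finset.prod_congr rfl fun s hs => ?_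
      obtain ⟨-, hc⟩ := Finset.mem_filter.1 hs
      obtain ⟨p, rfl⟩ := Finset.card_eq_one.1 hc
      rw [coneWeight_singleton]
    · refine Finset.prod_congr rfl fun s hs => ?_
      obtain ⟨hs, hc⟩ := Finset.mem_filter.1 hs
      obtain ⟨p, q, hpq, rfl⟩ := Finset.card_eq_two.1 hc
      obtain ⟨-, hv, hK⟩ := mem_linkFinset.1 hs
      simp only [Finset.mem_insert, Finset.mem_singleton, not_or] at hv
      rw [coneWeight_pair _ _ _ hpq, theta_triple hr hv.1 hv.2 hpq (hadm hv.1 hv.2 hpq hK)]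
  · refine Finset.prod_congr rfl fun s hs => ?_
    obtain ⟨hs, hc⟩ := Finset.mem_filter.1 hs
    obtain ⟨p, q, t, hpq, hpt, hqt, rfl⟩ := Finset.card_eq_three.1 hc
    obtain ⟨-, hv, hK⟩ := mem_linkFinset.1 hs
    simp only [Finset.mem_insert, Finset.mem_singleton, not_or] at hv
    have hsub : ∀ {x y z : V}, x ∈ ({v, p, q, t} : Finset V) → y ∈ ({v, p, q, t} : Finset V) →
        z ∈ ({v, p, q, t} : Finset V) → {x, y, z} ∈ K.faces := fun hx hy hz =>
      mem_faces_of_subset hK (by simp only [Finset.insert_subset_iff, Finset.singleton_subset_iff,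
        hx, hy, hz, and_self]) (Finset.insert_nonempty _ _)
    rw [coneWeight_triple _ _ _ hpq hpt hqt, tet_quadruple hr hv.1 hv.2.1 hv.2.2 hpq hpt hqt
      (hadm hv.1 hv.2.1 hpq (hsub (by simp) (by simp) (by simp)))
      (hadm hv.1 hv.2.2 hpt (hsub (by simp) (by simp) (by simp)))
      (hadm hv.2.1 hv.2.2 hqt (hsub (by simp) (by simp) (by simp)))
      (hadm hpq hpt hqt (hsub (by simp) (by simp) (by simp)))]

theorem coneProd_eq_zero {l : Finset V → ℕ} {f : Finset V} (hf : f ∈ triangles K) (hv : v ∈ f)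
    (h : ¬IsAdmissibleTriangle r l f) : coneProd K r v l = 0 := by
  obtain ⟨hK, hc⟩ := mem_facesOfCard.1 hf
  obtain ⟨p, q, hpq, hf'⟩ := Finset.card_eq_two.1
    (show (f.erase v).card = 2 by rw [Finset.card_erase_of_mem hv, hc])
  have hfe : {v, p, q} = f := by rw [← hf', Finset.insert_erase hv]
  have hvpq : v ∉ ({p, q} : Finset V) := hf' ▸ Finset.notMem_erase v f
  refine Finset.prod_eq_zero (i := {p, q}) (mem_linkFinset.2 ⟨by simp, hvpq, hfe.symm ▸ hK⟩) ?_
  simp only [Finset.mem_insert, Finset.mem_singleton, not_or] at hvpq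
  rw [coneWeight_pair _ _ _ hpq, thetaInv_of_not_adm]
  rwa [← hfe, isAdmissibleTriangle_triple hvpq.1 hvpq.2 hpq] at h

open Classical in
/-- The contribution to the state sum of a labelling. -/
def stateWeight (β : BoundaryLabelling K r) (S : Labelling K r) : ℂ :=
  if IsAdmissible S ∧ ExtendsBoundary β S then weight S else 0

open Classical in
/-- The part of the weight of a labelling away from the vertex `v`. -/
def outerWeight (v : V) (β : BoundaryLabelling K r) (S : Labelling K r) : ℂ :=
  if (∀ f ∈ triangles K, v ∉ f → IsAdmissibleTriangle r (edgeLabel S) f) ∧ ExtendsBoundary β S then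
    (∏ e ∈ edges K with v ∉ e, if e ∈ boundaryEdges K then dimq r (edgeLabel S e) ^ (1 / 2 : ℂ)
      else dimq r (edgeLabel S e)) *
    (∏ f ∈ triangles K with v ∉ f, if f ∈ boundaryTriangles K then
      (theta r (edgeLabel S) f)⁻¹ ^ (1 / 2 : ℂ) else (theta r (edgeLabel S) f)⁻¹) *
    ∏ t ∈ tetrahedra K with v ∉ t, tet r (edgeLabel S) t
  else 0

theorem notMem_boundaryTriangles (hv : v ∉ boundaryVertices K) {f : Finset V} (hf : v ∈ f) :
    f ∉ boundaryTriangles K := fun h =>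
  hv (Finset.mem_filter.2 ⟨Finset.mem_univ _, f, h, hf⟩)

theorem notMem_boundaryEdges (hv : v ∉ boundaryVertices K) {e : Finset V} (he : v ∈ e) :
    e ∉ boundaryEdges K := fun h => by
  obtain ⟨-, f, hf, hef⟩ := Finset.mem_filter.1 h
  exact notMem_boundaryTriangles hv (hef he) hf

theorem stateWeight_eq (hr : 2 ≤ r) (hv : v ∉ boundaryVertices K)
    (hL : ∀ s ∈ linkFinset K v, s.card ≤ 3) (β : BoundaryLabelling K r) (S : Labelling K r) :
    stateWeight β S = outerWeight v β S * coneProd K r v (edgeLabel S) := by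
  by_cases hβ : ExtendsBoundary β S
  swap
  · rw [stateWeight, outerWeight, if_neg fun h => hβ h.2, if_neg fun h => hβ h.2, zero_mul]
  by_cases hS : IsAdmissible S
  · rw [stateWeight, outerWeight, if_pos ⟨hS, hβ⟩, if_pos ⟨fun f hf _ => hS f hf, hβ⟩,
      coneProd_of_admissible hr hL hS, weight,
      ← Finset.prod_filter_mul_prod_filter_not (edges K) (v ∈ ·),
      ← Finset.prod_filter_mul_prod_filter_not (triangles K) (v ∈ ·),
      ← Finset.prod_filter_mul_prod_filter_not (tetrahedra K) (v ∈ ·)]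
    have h1 : (∏ e ∈ edges K with v ∈ e, if e ∈ boundaryEdges K then
        dimq r (edgeLabel S e) ^ (1 / 2 : ℂ) else dimq r (edgeLabel S e)) =
        ∏ e ∈ edges K with v ∈ e, dimq r (edgeLabel S e) := Finset.prod_congr rfl fun e he =>
      if_neg (notMem_boundaryEdges hv (Finset.mem_filter.1 he).2)
    have h2 : (∏ f ∈ triangles K with v ∈ f, if f ∈ boundaryTriangles K then
        (theta r (edgeLabel S) f)⁻¹ ^ (1 / 2 : ℂ) else (theta r (edgeLabel S) f)⁻¹) =
        ∏ f ∈ triangles K with v ∈ f, (theta r (edgeLabel S) f)⁻¹ :=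
      Finset.prod_congr rfl fun f hf =>
        if_neg (notMem_boundaryTriangles hv (Finset.mem_filter.1 hf).2)
    rw [h1, h2]
    ring
  · rw [stateWeight, if_neg fun h => hS h.1]
    simp only [IsAdmissible, not_forall] at hS
    obtain ⟨f, hf, hfS⟩ := hS
    by_cases hvf : v ∈ f
    · rw [coneProd_eq_zero hf hvf hfS, mul_zero]
    · rw [outerWeight, if_neg fun h => hfS (h.1 f hf hvf), zero_mul]

theorem edgeLabel_congr {S S' : Labelling K r} (h : ∀ e : {e // e ∈ edges K}, v ∉ e.1 → S e = S' e)
    {e : Finset V} (he : v ∉ e) : edgeLabel S e = edgeLabel S' e := by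
  rw [edgeLabel, edgeLabel]
  split_ifs with h'
  · rw [h ⟨e, h'⟩ he]
  · rfl

theorem outerWeight_congr (hv : v ∉ boundaryVertices K) {β : BoundaryLabelling K r}
    {S S' : Labelling K r} (h : ∀ e : {e // e ∈ edges K}, v ∉ e.1 → S e = S' e) :
    outerWeight v β S = outerWeight v β S' := by
  have hl : ∀ {s : Finset V}, v ∉ s → ∀ e ⊆ s, edgeLabel S e = edgeLabel S' e := fun hs e he =>
    edgeLabel_congr h fun h' => hs (he h')
  have h1 : (∀ f ∈ triangles K, v ∉ f → IsAdmissibleTriangle r (edgeLabel S) f) ↔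
      ∀ f ∈ triangles K, v ∉ f → IsAdmissibleTriangle r (edgeLabel S') f :=
    forall₃_congr fun f _ hf => isAdmissibleTriangle_congr (hl hf)
  have h2 : ExtendsBoundary β S ↔ ExtendsBoundary β S' :=
    forall₃_congr fun e he hb => by rw [h ⟨e, he⟩ fun h' => notMem_boundaryEdges hv h' hb]
  rw [outerWeight, outerWeight]
  have h3 := and_congr h1 h2
  by_cases h4 : (∀ f ∈ triangles K, v ∉ f → IsAdmissibleTriangle r (edgeLabel S) f) ∧
      ExtendsBoundary β S
  swap
  · rw [if_neg h4, if_neg fun h' => h4 (h3.2 h')]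
  rw [if_pos h4, if_pos (h3.1 h4)]
  refine congrArg₂ (· * ·) (congrArg₂ (· * ·) ?_ ?_) ?_
  · exact Finset.prod_congr rfl fun e he => by rw [hl (Finset.mem_filter.1 he).2 e subset_rfl]
  · exact Finset.prod_congr rfl fun f hf => by rw [theta_congr (hl (Finset.mem_filter.1 hf).2)]
  · exact Finset.prod_congr rfl fun t ht => tet_congr (hl (Finset.mem_filter.1 ht).2)

end Star

/-! ### The one edge observable -/

section Reindexing

variable {E W : Type*} [DecidableEq E] [DecidableEq W] {m : ℕ}

theorem sum_eq_partialSum_univ [Fintype E] (f : (E → Fin m) → ℂ) (x : E → Fin m) :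
    ∑ S, f S = partialSum Finset.univ f x := by
  refine Fintype.sum_equiv
    (Equiv.arrowCongr (Equiv.subtypeUnivEquiv Finset.mem_univ).symm (Equiv.refl (Fin m))) _ _
      fun S => ?_
  congr 1
  funext w
  simp [Function.updateFinset, Equiv.arrowCongr]

theorem partialSum_comp {U : Finset E} {U' : Finset W} {π : W → E}
    (hπ : Set.BijOn π U' U) (hπ' : ∀ w ∉ U', π w ∉ U) (f : (W → Fin m) → ℂ) (S : E → Fin m) :
    partialSum U (fun S => f (S ∘ π)) S = partialSum U' f (S ∘ π) := by
  let ε : U' ≃ U := hπ.equiv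
  refine Fintype.sum_equiv (Equiv.arrowCongr ε.symm (Equiv.refl (Fin m))) _ _ fun y => ?_
  refine congrArg f (funext fun w => ?_)
  by_cases hw : w ∈ U'
  · have : π w ∈ U := hπ.mapsTo hw
    simp only [Function.comp, Function.updateFinset, hw, this, dif_pos]
    rfl
  · simp [Function.updateFinset, hw, hπ' w hw]

end Reindexing

section Observable

variable {V : Type*} [Fintype V] [DecidableEq V] {K : AbstractSimplicialComplex V} {r : ℕ}

/-- The state sum over all states with prescribed spin `j` on an edge with an interior endpoint is
`dim_q(j)²` up to a factor independent of `j`. -/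
theorem exists_ZFixed_eq (hK : IsTriangulated3Manifold K) (hr : 3 ≤ r) (β : BoundaryLabelling K r)
    (e : {e // e ∈ edges K}) (he : IsOneEdgeObservable K e.1) :
    ∃ C : ℂ, ∀ j, ZFixed K r β e j = dimq r j ^ 2 * C := by
  classical
  obtain ⟨-, v, hve, hv⟩ := he
  have hr2 : 2 ≤ r := by omega
  obtain ⟨F, hF, hev⟩ := ((hK v).resolve_right fun h =>
    hv (mem_boundaryVertices_of_isBall h)).exists_isEvaluable (r := r) hr2
  have hFc := isComplex_of_coe_eq hF
  rw [coe_eq_map_link_iff] at hF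
  have hL : ∀ s ∈ linkFinset K v, s.card ≤ 3 := fun s hs => by
    rw [← Finset.card_image_of_injective s (Sum.inl_injective (β := ℕ))]
    exact hev.isPure.card_le (hF ▸ Finset.mem_image_of_mem _ hs)
  obtain ⟨w, hw⟩ := Finset.card_eq_one.1 (show (e.1.erase v).card = 1 by
    rw [Finset.card_erase_of_mem hve, (mem_facesOfCard.1 e.2).2])
  have hvw : {v, w} = e.1 := by rw [← hw, Finset.insert_erase hve]
  have hwv : w ≠ v := fun h => Finset.notMem_erase v e.1 (by rw [hw, h]; simp)
  have hedge : ∀ {u}, u ≠ v → ({v, u} ∈ edges K ↔ {Sum.inl u} ∈ F) := by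
    intro u hu
    have h1 : {Sum.inl u} ∈ F ↔ {u} ∈ linkFinset K v := by
      rw [hF, ← Finset.image_singleton]
      exact Finset.mem_image.trans ⟨fun ⟨t, ht, h⟩ =>
        Finset.image_injective Sum.inl_injective h ▸ ht, fun h => ⟨_, h, rfl⟩⟩
    rw [h1, mem_linkFinset, edges, mem_facesOfCard]
    simp [Finset.card_pair hu.symm, hu.symm]
  obtain ⟨G, hG⟩ := hev.exists_partialSum_eq hr2 hFc ((hedge hwv).1 (hvw ▸ e.2))
  let U : Finset {e // e ∈ edges K} := Finset.univ.filter fun e => v ∈ e.1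
  let π : V ⊕ ℕ → {e // e ∈ edges K} :=
    Sum.elim (fun u => if h : {v, u} ∈ edges K then ⟨_, h⟩ else e) fun _ => e
  let c : Labelling K r → Finset (V ⊕ ℕ) → ℕ := fun S s =>
    if v ∈ s.toLeft then 0 else edgeLabel S s.toLeft
  have hlink : ∀ {u}, {Sum.inl u} ∈ F → u ≠ v := by
    intro u hu
    obtain ⟨s, hs, hsu⟩ := Finset.mem_image.1 (hF ▸ hu)
    rintro rfl
    have : Sum.inl u ∈ s.image (Sum.inl : V → V ⊕ ℕ) := hsu ▸ Finset.mem_singleton_self _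
    exact (mem_linkFinset.1 hs).2.1 (by simpa using this)
  have hverts : ∀ x ∈ verts F, ∃ u, x = Sum.inl u ∧ {Sum.inl u} ∈ F := by
    intro x hx
    obtain ⟨s, hs, hxs⟩ := mem_verts.1 hx
    obtain ⟨t, -, rfl⟩ := Finset.mem_image.1 (hF ▸ hs)
    obtain ⟨u, -, rfl⟩ := Finset.mem_image.1 hxs
    exact ⟨u, rfl, hFc.down hs (Finset.singleton_subset_iff.2 hxs) (by simp)⟩
  have hπ : ∀ {u}, {Sum.inl u} ∈ F → (π (Sum.inl u)).1 = {v, u} := by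
    intro u hu
    simp only [π, Sum.elim_inl, dif_pos ((hedge (hlink hu)).2 hu)]
  have hπw : π (Sum.inl w) = e := Subtype.ext ((hπ ((hedge hwv).1 (hvw ▸ e.2))).trans hvw)
  have hinj : ∀ {u u'}, {Sum.inl u} ∈ F → {Sum.inl u'} ∈ F →
      π (Sum.inl u) = π (Sum.inl u') → u = u' := by
    intro u u' hu hu' h
    have h1 : ({v, u} : Finset V) = {v, u'} := by rw [← hπ hu, ← hπ hu', h]
    have h2 : u ∈ ({v, u'} : Finset V) := h1 ▸ by simp
    simp only [Finset.mem_insert, Finset.mem_singleton] at h2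
    exact h2.resolve_left (hlink hu)
  have hbij : Set.BijOn π (verts F \ {Sum.inl w} : Finset _) (U.erase e : Finset _) := by
    refine ⟨fun x hx => ?_, fun x hx x' hx' h => ?_, fun a ha => ?_⟩
    · obtain ⟨hx1, hx2⟩ := Finset.mem_sdiff.1 (Finset.mem_coe.1 hx)
      obtain ⟨u, rfl, hu⟩ := hverts x hx1
      refine Finset.mem_coe.2 (Finset.mem_erase.2 ⟨fun h => hx2 ?_, ?_⟩)
      · rw [hinj hu ((hedge hwv).1 (hvw ▸ e.2)) (h.trans hπw.symm)]
        exact Finset.mem_singleton_self _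
      · refine Finset.mem_filter.2 ⟨Finset.mem_univ _, ?_⟩
        rw [hπ hu]
        simp
    · obtain ⟨u, rfl, hu⟩ := hverts x (Finset.mem_sdiff.1 (Finset.mem_coe.1 hx)).1
      obtain ⟨u', rfl, hu'⟩ := hverts x' (Finset.mem_sdiff.1 (Finset.mem_coe.1 hx')).1
      rw [hinj hu hu' h]
    · obtain ⟨ha1, ha2⟩ := Finset.mem_erase.1 (Finset.mem_coe.1 ha)
      have hva := (Finset.mem_filter.1 ha2).2
      obtain ⟨u, hu⟩ := Finset.card_eq_one.1 (show (a.1.erase v).card = 1 by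
        rw [Finset.card_erase_of_mem hva, (mem_facesOfCard.1 a.2).2])
      have hau : {v, u} = a.1 := by rw [← hu, Finset.insert_erase hva]
      have huv : u ≠ v := fun h => Finset.notMem_erase v a.1 (by rw [hu, h]; simp)
      have huF := (hedge huv).1 (hau ▸ a.2)
      have hπu : π (Sum.inl u) = a := Subtype.ext ((hπ huF).trans hau)
      refine ⟨Sum.inl u, Finset.mem_coe.2 (Finset.mem_sdiff.2
        ⟨subset_verts huF (Finset.mem_singleton_self _), fun h => ha1 ?_⟩), hπu⟩
      rw [← hπu, Finset.mem_singleton.1 h, hπw]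
  have hπ' : ∀ u ∉ verts F \ {Sum.inl w}, π u ∉ U.erase e := by
    intro x hx h
    obtain ⟨h1, h2⟩ := Finset.mem_erase.1 h
    rcases x with u | n
    · by_cases hu : {v, u} ∈ edges K
      · have huv : u ≠ v := by
          rintro rfl
          have := (mem_facesOfCard.1 hu).2
          simp at this
        refine hx (Finset.mem_sdiff.2 ⟨subset_verts ((hedge huv).1 hu)
          (Finset.mem_singleton_self _), fun h3 => h1 ?_⟩)
        rw [Finset.mem_singleton.1 h3, hπw]
      · exact h1 (by simp only [π, Sum.elim_inl, dif_neg hu])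
    · exact h1 rfl
  have hcone : ∀ S : Labelling K r, coneProd K r v (edgeLabel S) =
      ∏ s ∈ F, spinWeight r (c S) s (S ∘ π) := by
    intro S
    rw [hF, Finset.prod_image (Finset.image_injective Sum.inl_injective).injOn, coneProd]
    refine Finset.prod_congr rfl fun s hs => ?_
    rw [spinWeight, coneWeight_image Sum.inl_injective]
    refine coneWeight_congr (fun u hu => ?_) fun a ha => ?_
    · have huF : {Sum.inl u} ∈ F := hFc.down (hF ▸ Finset.mem_image_of_mem _ hs)
        (Finset.singleton_subset_iff.2 (Finset.mem_image_of_mem _ hu)) (by simp)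
      rw [edgeLabel, dif_pos ((hedge (hlink huF)).2 huF)]
      congr 2
      exact Subtype.ext (hπ huF).symm
    · have h1 : (a.image (Sum.inl : V → V ⊕ ℕ)).toLeft = a := by ext; simp
      simp only [c, h1]
      rw [if_neg fun h' => (mem_linkFinset.1 hs).2.1 (ha h')]
  have hc : ∀ S S' : Labelling K r, (∀ e : {e // e ∈ edges K}, v ∉ e.1 → S e = S' e) →
      c S = c S' := by
    intro S S' h
    funext s
    simp only [c]
    split_ifs with hs
    · rfl
    · exact edgeLabel_congr h hs
  have hinner : ∀ S : Labelling K r, partialSum (U.erase e) (stateWeight β) S =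
      dimq r (S e) ^ 2 * (outerWeight v β S * G (c S)) := by
    intro S
    have hagree : ∀ S' : Labelling K r, (∀ a ∉ U.erase e, S' a = S a) →
        ∀ e : {e // e ∈ edges K}, v ∉ e.1 → S' e = S e := fun S' hS' a ha =>
      hS' a fun h' => ha (Finset.mem_filter.1 (Finset.mem_of_mem_erase h')).2
    have h1 : partialSum (U.erase e) (stateWeight β) S = partialSum (U.erase e)
        (fun S' => outerWeight v β S * ∏ s ∈ F, spinWeight r (c S) s (S' ∘ π)) S := by
      refine partialSum_congr fun S' hS' => ?_
      rw [stateWeight_eq hr2 hv hL, hcone, outerWeight_congr hv (hagree S' hS'),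
        hc S' S (hagree S' hS')]
    rw [h1, partialSum_const_mul, partialSum_comp hbij hπ'
      (fun x => ∏ s ∈ F, spinWeight r (c S) s x), hG, Function.comp, hπw]
    ring
  let z : Fin (r - 1) := ⟨0, by omega⟩
  refine ⟨normalisation K r * partialSum Uᶜ (fun S => outerWeight v β S * G (c S)) fun _ => z,
    fun j => ?_⟩
  have h1 : ∑ S ∈ (Finset.univ : Finset (Labelling K r)).filter
      (fun S => IsAdmissible S ∧ ExtendsBoundary β S ∧ S e = j), weight S =
      ∑ S, (if S e = j then 1 else 0) * stateWeight β S := by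
    rw [Finset.sum_filter]
    refine Finset.sum_congr rfl fun S _ => ?_
    rw [stateWeight, ite_mul, one_mul, zero_mul, ← ite_and]
    exact if_congr (by tauto) rfl rfl
  have heU : e ∈ U := Finset.mem_filter.2 ⟨Finset.mem_univ _, hve⟩
  have h2 : (Finset.univ : Finset {e // e ∈ edges K}) = Uᶜ ∪ insert e (U.erase e) := by
    rw [Finset.insert_erase heU, Finset.union_comm, Finset.union_compl]
  have h3 : Disjoint Uᶜ (insert e (U.erase e)) := by
    rw [Finset.insert_erase heU]; exact disjoint_compl_left
  rw [ZFixed]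
  rw [show ∑ S ∈ (Finset.univ : Finset (Labelling K r)).filter
      (fun S => IsAdmissible S ∧ ExtendsBoundary β S ∧ S e = j), weight S =
      dimq r j ^ 2 * partialSum Uᶜ (fun S => outerWeight v β S * G (c S)) fun _ => z from ?_]
  · ring
  rw [h1, sum_eq_partialSum_univ _ fun _ => z, h2, partialSum_union h3, ← partialSum_const_mul]
  refine partialSum_congr fun S _ => ?_
  rw [partialSum_insert' (Finset.notMem_erase e U)]
  have h4 : ∀ k, partialSum (U.erase e) (fun S => (if S e = j then 1 else 0) * stateWeight β S)
      (Function.update S e k) = if k = j then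
        dimq r j ^ 2 * (outerWeight v β S * G (c S)) else 0 := by
    intro k
    rw [partialSum_mul_left (g := fun S : Labelling K r => if S e = j then (1 : ℂ) else 0), hinner]
    · have h5 : ∀ a : {e // e ∈ edges K}, v ∉ a.1 → Function.update S e k a = S a :=
        fun a ha => Function.update_of_ne (fun h' => ha (by rw [h']; exact hve)) _ _
      rw [Function.update_self, outerWeight_congr hv h5, hc _ _ h5]
      split_ifs with h6
      · rw [h6, one_mul]
      · rw [zero_mul]
    · intro S' hS'
      rw [hS' e (Finset.notMem_erase e U)]
  rw [Finset.sum_congr rfl fun k _ => h4 k]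
  simp

theorem sum_ZFixed (β : BoundaryLabelling K r) (e : {e // e ∈ edges K}) :
    ∑ j, ZFixed K r β e j = Z K r β := by
  classical
  simp only [ZFixed, Z, ← Finset.mul_sum]
  congr 1
  simp only [Finset.sum_filter]
  rw [Finset.sum_comm]
  refine Finset.sum_congr rfl fun S _ => ?_
  by_cases h : IsAdmissible S ∧ ExtendsBoundary β S
  · rw [if_pos h]
    simp [h.1, h.2]
  · rw [if_neg h]
    exact Finset.sum_eq_zero fun j _ => if_neg fun h' => h ⟨h'.1, h'.2.1⟩

end Observable

end TuraevViro

end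

theorem mainTheorem1 {V : Type*} [Fintype V] [DecidableEq V]
    (K : AbstractSimplicialComplex V) (hK : TuraevViro.IsTriangulated3Manifold K)
    (r : ℕ) (hr : 3 ≤ r) (β : TuraevViro.BoundaryLabelling K r)
    (e : {e // e ∈ TuraevViro.edges K}) (he : TuraevViro.IsOneEdgeObservable K e.1)
    (hZ : TuraevViro.Z K r β ≠ 0) (j : Fin (r - 1)) :
    TuraevViro.W K r β e j = TuraevViro.dimq r j ^ 2 / TuraevViro.N r := by
  obtain ⟨C, hC⟩ := TuraevViro.exists_ZFixed_eq hK hr β e he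
  have hsum : TuraevViro.Z K r β = TuraevViro.N r * C := by
    rw [← TuraevViro.sum_ZFixed β e, TuraevViro.N, Finset.sum_mul]
    exact Finset.sum_congr rfl fun k _ => hC k
  rw [hsum] at hZ
  rw [TuraevViro.W, hC, hsum, mul_div_mul_right _ _ (right_ne_zero_of_mul hZ)]
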